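/- Let $\Bbbk$ be a commutative ring in which $2$ is invertible, and let $n\in\mathbb N$. All superalgebras are associative unital $\Bbbk$-algebras with a $\mathbb Z/2$-grading, and $\otimes$ is the super tensor product, $(a'\otimes b)(a\otimes b')=(-1)^{\bar a\bar b}a'a\otimes bb'$. Let $\mathrm{Cl}=\Bbbk\oplus\Bbbk c$ be the rank two Clifford superalgebra ($c$ odd, $c^2=1$), with its odd trace map $\mathrm{tr}(1)=0$, $\mathrm{tr}(c)=1$, and let $c_i\in\mathrm{Cl}^{\otimes n}$ be $c$ in the $i$-th tensor factor, the factors being numbered from right to left. - The Clifford nilCoxeter algebra $NC_n(\mathrm{Cl})$ is generated by $\mathrm{Cl}^{\otimes n}$ and even elements $u_1,\dots,u_{n-1}$ subject to $u_i^2=0$, $u_iu_j=u_ju_i$ for $|i-j|>1$, $u_iu_{i+1}u_i=u_{i+1}u_iu_{i+1}$, $u_ic_i=c_{i+1}u_i$, $u_ic_{i+1}=c_iu_i$, and $u_ic_j=c_ju_i$ for $j\ne i,i+1$. - The Clifford nilHecke algebra $NH_n(\mathrm{Cl})$ is obtained from $NC_n(\mathrm{Cl})$ by adjoining odd elements $x_1,\dots,x_n$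 subject to $x_ix_j=-x_jx_i$ for $i\neq j$, $c_jx_i=-x_ic_j$ for all $i,j$, $x_ju_i=u_ix_j$ for $j\ne i,i+1$, $u_ix_{i+1}=x_iu_i+\tau_i$ and $x_{i+1}u_i=u_ix_i-\tau_i$, where $\tau_i=c_i-c_{i+1}$. - The odd nilCoxeter algebra $ONC_n$ is generated by odd elements $v_1,\dots,v_{n-1}$ subject to $v_i^2=0$, $v_iv_j=-v_jv_i$ for $|i-j|>1$, and $v_iv_{i+1}v_i=v_{i+1}v_iv_{i+1}$. - The odd nilHecke algebra $ONH_n$ is generated by odd elements $v_1,\dots,v_{n-1}$, $y_1,\dots,y_n$ subject to the relations of $ONC_n$ and $y_iy_j=-y_jy_i$ for $i\ne j$, $y_jv_i=-v_iy_j$ for $j\neq i,i+1$, $v_iy_{i+1}+y_iv_i=1$ and $y_{i+1}v_i+v_iy_i=1$. Then there is an isomorphism of superalgebras $NC_n(\mathrm{Cl})\to ONC_n\otimes\mathrm{Cl}^{\otimes n}$ given by $$c_i\mapsto c_i,\qquad u_i\mapsto(c_i-c_{i+1})v_i,$$ and it extends to an isomorphism of superalgebras $NH_n(\mathrm{Cl})\to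 ONH_n\otimes\mathrm{Cl}^{\otimes n}$ given by the same formulas together with $x_i\mapsto y_i$. In particular, $NC_n(\mathrm{Cl})$ and $ONC_n$ are Morita equivalent up to Clifford superalgebras ("weakly Morita superequivalent"), as are $NH_n(\mathrm{Cl})$ and $ONH_n$. Here two superalgebras are Morita superequivalent if there is a $\Bbbk$-linear equivalence between their categories of supermodules (with parity preserving morphisms) that commutes with the parity shifts $\Pi$, compatibly with $\Pi^2\cong 1$; and $A$, $B$ are weakly Morita superequivalent if $A\otimes\mathrm{Cl}^{\otimes r}$ and $B\otimes\mathrm{Cl}^{\otimes s}$ are Morita superequivalent for some $r,s\in\mathbb N$. More precisely, if $-1$ is a square in $\Bbbk$, then for even $n$ the superalgebras $NC_n(\mathrm{Cl})$ and $ONC_n$ are Morita superequivalent, as are $NH_n(\mathrm{Cl})$ and $ONH_n$, while for odd $n$ the superalgebras $NC_n(\mathrm{Cl})$ and $ONC_n\otimes\mathrm{Cl}$ are Morita superequivalent, as are $NH_n(\mathrm{Cl})$ and $ONH_n\otimes\mathrm{Cl}$. -/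

import Mathlib

universe u

open CategoryTheory
open scoped DirectSum TensorProduct

noncomputable section

namespace OddNil

/-! ## Superalgebras -/

/-- A superalgebra over `k`: an associative unital `k`-algebra with a `ZMod 2`-grading. -/
structure SuperAlg (k : Type u) [CommRing k] where
  carrier : Type u
  [ring : Ring carrier]
  [algebra : Algebra k carrier]
  gr : ZMod 2 → Submodule k carrier
  [graded : GradedAlgebra gr]

attribute [instance] SuperAlg.ring SuperAlg.algebra SuperAlg.graded

/-- The sign `(-1) ^ p` attached to a parity `p`. -/
def sgn (p : ZMod 2) : ℤˣ := (-1 : ℤˣ) ^ p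

/-- An isomorphism of superalgebras: a parity preserving isomorphism of `k`-algebras. -/
structure SuperIso {k : Type u} [CommRing k] (A B : SuperAlg.{u} k) where
  toAlgEquiv : A.carrier ≃ₐ[k] B.carrier
  map_mem : ∀ (p : ZMod 2) (a : A.carrier), a ∈ A.gr p → toAlgEquiv a ∈ B.gr p

/-- A family of submodules that is closed under products, spans, and is separated by an additive
map recording the degrees, is an algebra grading. -/
abbrev gradedOfSeparating {k : Type u} [CommRing k] {Q : Type u} [Ring Q] [Algebra k Q]
    (𝒜 : ZMod 2 → Submodule k Q) [SetLike.GradedMonoid 𝒜]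
    (d : Q →+ (ZMod 2 → Q)) (hd : ∀ p, ∀ q ∈ 𝒜 p, d q = Pi.single p q)
    (htop : ⨆ p, 𝒜 p = ⊤) : GradedAlgebra 𝒜 := by
  have hmem : ∀ q : Q, ∀ p, d q p ∈ 𝒜 p := by
    intro q
    have hq : q ∈ ⨆ p, 𝒜 p := htop ▸ Submodule.mem_top
    induction hq using Submodule.iSup_induction' with
    | mem i x hx =>
      intro p
      rw [hd i x hx]
      by_cases h : p = i
      · subst h; simpa using hx
      · simp [Pi.single_eq_of_ne h]
    | zero => intro p; simp
    | add x y _ _ hx hy => intro p; simpa using (𝒜 p).add_mem (hx p) (hy p)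
  have hsum : ∀ q : Q, ∑ p, d q p = q := by
    intro q
    have hq : q ∈ ⨆ p, 𝒜 p := htop ▸ Submodule.mem_top
    induction hq using Submodule.iSup_induction' with
    | mem i x hx => rw [hd i x hx]; simp
    | zero => simp
    | add x y _ _ hx hy => simp [Finset.sum_add_distrib, hx, hy]
  let f : Q →+ ⨁ p, 𝒜 p :=
    ∑ p, (DirectSum.of (fun p => 𝒜 p) p).comp
      { toFun := fun q => ⟨d q p, hmem q p⟩
        map_zero' := by ext; simp
        map_add' := by intro x y; ext; simp }
  have hf : ∀ q, f q = ∑ p, DirectSum.of (fun p => 𝒜 p) p ⟨d q p, hmem q p⟩ := by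
    intro q; simp [f]
  letI : DirectSum.Decomposition 𝒜 :=
    DirectSum.Decomposition.ofAddHom 𝒜 f
      (by
        ext q
        simp only [AddMonoidHom.comp_apply, AddMonoidHom.id_apply, hf, map_sum,
          DirectSum.coeAddMonoidHom_of]
        exact hsum q)
      (by
        ext i x : 2
        simp only [AddMonoidHom.comp_apply, AddMonoidHom.id_apply, hf,
          DirectSum.coeAddMonoidHom_of]
        rw [Finset.sum_eq_single i]
        · congr 1
          ext
          simp [hd i x x.2]
        · intro p _ hp
          have : (⟨d (x : Q) p, hmem x p⟩ : 𝒜 p) = 0 := by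
            ext
            simp [hd i x x.2, Pi.single_eq_of_ne hp]
          rw [this, map_zero]
        · simp)
  exact { (inferInstance : SetLike.GradedMonoid 𝒜), this with }

/-! ## The ground ring and tensor products -/

section Tensor

variable {k : Type u} [CommRing k]

/-- The parity pieces of the tensor product: `gr p` is spanned by the `a ⊗ b` with `a`, `b`
homogeneous and `|a| + |b| = p`. -/
def tensorGr (A B : SuperAlg.{u} k) (p : ZMod 2) :
    Submodule k (GradedTensorProduct k A.gr B.gr) :=
  Submodule.span k {z | ∃ (i j : ZMod 2) (a : A.gr i) (b : B.gr j), i + j = p ∧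
    z = GradedTensorProduct.tmul k (a : A.carrier) (b : B.carrier)}

instance tensorGr_gradedMonoid (A B : SuperAlg.{u} k) : SetLike.GradedMonoid (tensorGr A B) where
  one_mem := Submodule.subset_span
    ⟨0, 0, ⟨1, SetLike.GradedOne.one_mem⟩, ⟨1, SetLike.GradedOne.one_mem⟩, by simp, rfl⟩
  mul_mem := by
    intro p q x y hx hy
    induction hx using Submodule.span_induction with
    | zero => simp
    | add x x' _ _ hx hx' => rw [add_mul]; exact add_mem hx hx'
    | smul r x _ hx => rw [smul_mul_assoc]; exact Submodule.smul_mem _ _ hx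
    | mem x hx =>
      obtain ⟨i, j, a, b, rfl, rfl⟩ := hx
      induction hy using Submodule.span_induction with
      | zero => simp
      | add x x' _ _ hx hx' => rw [mul_add]; exact add_mem hx hx'
      | smul r x _ hx => rw [mul_smul_comm]; exact Submodule.smul_mem _ _ hx
      | mem y hy =>
        obtain ⟨i', j', a', b', rfl, rfl⟩ := hy
        rw [GradedTensorProduct.tmul_coe_mul_coe_tmul]
        rw [Units.smul_def]
        refine zsmul_mem ?_ _
        exact Submodule.subset_span ⟨i + i', j + j', ⟨_, SetLike.GradedMul.mul_mem a.2 a'.2⟩,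
          ⟨_, SetLike.GradedMul.mul_mem b.2 b'.2⟩, by ring, rfl⟩

/-- The projection of the tensor product onto its part of parity `p`. -/
def tensorProj (A B : SuperAlg.{u} k) (p : ZMod 2) :
    A.carrier ⊗[k] B.carrier →ₗ[k] A.carrier ⊗[k] B.carrier :=
  ∑ i, TensorProduct.map (GradedAlgebra.proj A.gr i) (GradedAlgebra.proj B.gr (p - i))

/-- The tensor product of superalgebras: Mathlib's graded tensor product, with
`(a' ⊗ b) (a ⊗ b') = (-1) ^ (|a| |b|) a' a ⊗ b b'`. -/
def tensor (A B : SuperAlg.{u} k) : SuperAlg.{u} k where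
  carrier := GradedTensorProduct k A.gr B.gr
  gr := tensorGr A B
  graded := gradedOfSeparating (tensorGr A B)
    { toFun := fun z p => GradedTensorProduct.of k A.gr B.gr
        (tensorProj A B p ((GradedTensorProduct.of k A.gr B.gr).symm z))
      map_zero' := by ext; simp
      map_add' := by intro x y; ext; simp }
    (by
      intro p q hq
      induction hq using Submodule.span_induction with
      | zero => ext; simp
      | add x x' _ _ hx hx' => rw [map_add, hx, hx', Pi.single_add]
      | smul r x _ hx =>
        ext p'
        have := congrFun hx p'
        simp only [AddMonoidHom.coe_mk, ZeroHom.coe_mk] at this ⊢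
        rw [map_smul, map_smul, map_smul, this, Pi.single_smul, Pi.smul_apply]
      | mem x hx =>
        obtain ⟨i, j, a, b, rfl, rfl⟩ := hx
        ext p'
        have e : (GradedTensorProduct.of k A.gr B.gr).symm
          (GradedTensorProduct.tmul k (a : A.carrier) (b : B.carrier)) =
            (a : A.carrier) ⊗ₜ[k] (b : B.carrier) := rfl
        simp only [AddMonoidHom.coe_mk, ZeroHom.coe_mk, tensorProj, e, LinearMap.sum_apply, TensorProduct.map_tmul,
          GradedAlgebra.proj_apply, DirectSum.decompose_coe]
        rw [Finset.sum_eq_single i]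
        · rw [DirectSum.of_eq_same]
          by_cases h : p' = i + j
          · subst h
            have : i + j - i = j := by ring
            rw [this, DirectSum.of_eq_same, Pi.single_eq_same]
          · have : j ≠ p' - i := by
              rintro rfl
              exact h (by ring)
            rw [DirectSum.of_eq_of_ne _ _ _ this.symm, Pi.single_eq_of_ne h]
            simp
        · intro i' _ hi'
          rw [DirectSum.of_eq_of_ne _ _ _ hi']
          simp
        · simp)
    (by
      rw [eq_top_iff]
      rintro z -
      obtain ⟨z, rfl⟩ := (GradedTensorProduct.of k A.gr B.gr).surjective z
      induction z using TensorProduct.induction_on with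
      | zero => simp
      | add x y hx hy => rw [map_add]; exact add_mem hx hy
      | tmul a b =>
        classical
        rw [← DirectSum.sum_support_decompose A.gr a, ← DirectSum.sum_support_decompose B.gr b,
          TensorProduct.sum_tmul, map_sum]
        refine sum_mem fun i _ => ?_
        rw [TensorProduct.tmul_sum, map_sum]
        refine sum_mem fun j _ => ?_
        exact Submodule.mem_iSup_of_mem (i + j)
          (Submodule.subset_span ⟨i, j, _, _, rfl, rfl⟩))

/-- The inclusion `a ↦ a ⊗ 1`. -/
def inl (A B : SuperAlg.{u} k) : A.carrier →ₐ[k] (tensor A B).carrier :=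
  GradedTensorProduct.includeLeft A.gr B.gr

/-- The inclusion `b ↦ 1 ⊗ b`. -/
def inr (A B : SuperAlg.{u} k) : B.carrier →ₐ[k] (tensor A B).carrier :=
  GradedTensorProduct.includeRight A.gr B.gr

variable (k) in
/-- The parity pieces of the ground ring, which is purely even. -/
def baseGr (p : ZMod 2) : Submodule k k := if p = 0 then ⊤ else ⊥

instance baseGr_gradedMonoid : SetLike.GradedMonoid (baseGr k) where
  one_mem := by simp [baseGr]
  mul_mem := by
    intro p q x y hx hy
    by_cases hp : p = 0
    · by_cases hq : q = 0
      · simp [baseGr, hp, hq]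
      · simp [baseGr, hq] at hy
        simp [hy]
    · simp [baseGr, hp] at hx
      simp [hx]

variable (k) in
/-- The ground ring as a purely even superalgebra. -/
def base : SuperAlg.{u} k where
  carrier := k
  gr := baseGr k
  graded := gradedOfSeparating (baseGr k)
    { toFun := fun r => Pi.single 0 r
      map_zero' := by simp
      map_add' := by intro x y; rw [Pi.single_add] }
    (by
      intro p q hq
      by_cases hp : p = 0
      · subst hp; rfl
      · simp [baseGr, hp] at hq
        simp [hq])
    (by
      rw [eq_top_iff]
      exact le_trans (by simp [baseGr]) (le_iSup (baseGr k) 0))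

/-- The `n`-fold tensor power `A ⊗ ⋯ ⊗ A`; a new factor is added on the left. -/
def tensorPow (A : SuperAlg.{u} k) : ℕ → SuperAlg.{u} k
  | 0 => base k
  | n + 1 => tensor A (tensorPow A n)

/-- The element `1 ⊗ ⋯ ⊗ 1 ⊗ a ⊗ 1 ⊗ ⋯ ⊗ 1` of the `n`-fold tensor power, with `a` in
position `i`. The factors are numbered from right to left, starting with `0`. -/
def place (A : SuperAlg.{u} k) : (n : ℕ) → Fin n → A.carrier →ₐ[k] (tensorPow A n).carrier
  | 0, i => i.elim0
  | n + 1, i => Fin.lastCases (motive := fun _ => A.carrier →ₐ[k] (tensorPow A (n + 1)).carrier)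
      (inl A (tensorPow A n)) (fun j => (inr A (tensorPow A n)).comp (place A n j)) i

end Tensor

/-! ## Superalgebras given by homogeneous generators and relations -/

section Presented

variable {k : Type u} [CommRing k]

/-- The part of parity `p` of the free superalgebra on generators `x : X` of parity `par x`:
the span of the words in the generators whose parities add up to `p`. -/
def freeGr (k : Type u) [CommRing k] {X : Type u} (par : X → ZMod 2) (p : ZMod 2) :
    Submodule k (FreeAlgebra k X) :=
  Submodule.span k {w | ∃ l : List X, (l.map par).sum = p ∧ w = (l.map (FreeAlgebra.ι k)).prod}

instance freeGr_gradedMonoid {X : Type u} (par : X → ZMod 2) :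
    SetLike.GradedMonoid (freeGr k par) where
  one_mem := Submodule.subset_span ⟨[], by simp, by simp⟩
  mul_mem := by
    intro p q x y hx hy
    induction hx using Submodule.span_induction with
    | zero => simp
    | add x x' _ _ hx hx' => rw [add_mul]; exact add_mem hx hx'
    | smul r x _ hx => rw [smul_mul_assoc]; exact Submodule.smul_mem _ _ hx
    | mem x hx =>
      obtain ⟨l, rfl, rfl⟩ := hx
      induction hy using Submodule.span_induction with
      | zero => simp
      | add x x' _ _ hx hx' => rw [mul_add]; exact add_mem hx hx'
      | smul r x _ hx => rw [mul_smul_comm]; exact Submodule.smul_mem _ _ hx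
      | mem y hy =>
        obtain ⟨l', rfl, rfl⟩ := hy
        exact Submodule.subset_span ⟨l ++ l', by simp, by simp⟩

theorem ι_mem_freeGr {X : Type u} (par : X → ZMod 2) (x : X) :
    FreeAlgebra.ι k x ∈ freeGr k par (par x) :=
  Submodule.subset_span ⟨[x], by simp, by simp⟩

theorem iSup_freeGr {X : Type u} (par : X → ZMod 2) : ⨆ p, freeGr k par p = ⊤ := by
  have one : (1 : FreeAlgebra k X) ∈ ⨆ p, freeGr k par p :=
    Submodule.mem_iSup_of_mem 0 SetLike.GradedOne.one_mem
  rw [eq_top_iff]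
  rintro z -
  induction z using FreeAlgebra.induction with
  | grade0 r => rw [Algebra.algebraMap_eq_smul_one]; exact Submodule.smul_mem _ _ one
  | grade1 x => exact Submodule.mem_iSup_of_mem (par x) (ι_mem_freeGr par x)
  | add a b ha hb => exact add_mem ha hb
  | mul a b ha hb =>
    induction ha using Submodule.iSup_induction' with
    | zero => simp
    | add x y _ _ hx hy => rw [add_mul]; exact add_mem hx hy
    | mem i x hx =>
      induction hb using Submodule.iSup_induction' with
      | zero => simp
      | add x y _ _ hx hy => rw [mul_add]; exact add_mem hx hy
      | mem j y hy =>
        exact Submodule.mem_iSup_of_mem (i + j) (SetLike.GradedMul.mul_mem hx hy)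

/-- Every relation is between two elements of the same parity. -/
def Homogeneous {X : Type u} (par : X → ZMod 2)
    (rel : FreeAlgebra k X → FreeAlgebra k X → Prop) : Prop :=
  ∀ a b, rel a b → ∃ p, a ∈ freeGr k par p ∧ b ∈ freeGr k par p

/-- The parity pieces of a quotient of a free superalgebra. -/
def quotGr {X : Type u} (par : X → ZMod 2) (rel : FreeAlgebra k X → FreeAlgebra k X → Prop)
    (p : ZMod 2) : Submodule k (RingQuot rel) :=
  (freeGr k par p).map (RingQuot.mkAlgHom k rel).toLinearMap

instance quotGr_gradedMonoid {X : Type u} (par : X → ZMod 2)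
    (rel : FreeAlgebra k X → FreeAlgebra k X → Prop) :
    SetLike.GradedMonoid (quotGr par rel) where
  one_mem := ⟨1, SetLike.GradedOne.one_mem, by simp⟩
  mul_mem := by
    rintro p q _ _ ⟨x, hx, rfl⟩ ⟨y, hy, rfl⟩
    exact ⟨x * y, SetLike.GradedMul.mul_mem hx hy, by simp⟩

/-- The map `x ↦ x t ^ |x|` that records degrees. -/
def degFree {X : Type u} (par : X → ZMod 2) (rel : FreeAlgebra k X → FreeAlgebra k X → Prop) :
    FreeAlgebra k X →ₐ[k] AddMonoidAlgebra (RingQuot rel) (ZMod 2) :=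
  FreeAlgebra.lift k fun x =>
    AddMonoidAlgebra.single (par x) (RingQuot.mkAlgHom k rel (FreeAlgebra.ι k x))

theorem degFree_eq {X : Type u} (par : X → ZMod 2)
    (rel : FreeAlgebra k X → FreeAlgebra k X → Prop) (p : ZMod 2) (a : FreeAlgebra k X)
    (ha : a ∈ freeGr k par p) :
    degFree par rel a = AddMonoidAlgebra.single p (RingQuot.mkAlgHom k rel a) := by
  induction ha using Submodule.span_induction with
  | zero => simp
  | add x y _ _ hx hy => rw [map_add, map_add, hx, hy, AddMonoidAlgebra.single_add]
  | smul r x _ hx => rw [map_smul, map_smul, hx, AddMonoidAlgebra.smul_single]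
  | mem x hx =>
    obtain ⟨l, rfl, rfl⟩ := hx
    induction l with
    | nil => simp [AddMonoidAlgebra.one_def]
    | cons x l ih =>
      simp only [List.map_cons, List.prod_cons, List.sum_cons, map_mul, ih]
      rw [← AddMonoidAlgebra.single_mul_single]
      congr 1
      simp [degFree]

/-- The superalgebra with generators `x : X` of parity `par x` and homogeneous relations `rel`. -/
def presented {X : Type u} (par : X → ZMod 2)
    (rel : FreeAlgebra k X → FreeAlgebra k X → Prop) (h : Homogeneous par rel) :
    SuperAlg.{u} k where
  carrier := RingQuot rel
  gr := quotGr par rel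
  graded :=
    let d : RingQuot rel →ₐ[k] AddMonoidAlgebra (RingQuot rel) (ZMod 2) :=
      RingQuot.liftAlgHom k ⟨degFree par rel, by
        intro a b hab
        obtain ⟨p, ha, hb⟩ := h a b hab
        rw [degFree_eq par rel p a ha, degFree_eq par rel p b hb,
          RingQuot.mkAlgHom_rel k hab]⟩
    gradedOfSeparating (quotGr par rel)
      { toFun := fun q p => (d q).coeff p
        map_zero' := by ext; simp
        map_add' := by intro x y; ext; simp }
      (by
        rintro p _ ⟨a, ha, rfl⟩
        ext p'
        simp only [AddMonoidHom.coe_mk, ZeroHom.coe_mk, AlgHom.toLinearMap_apply, d,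
          RingQuot.liftAlgHom_mkAlgHom_apply]
        rw [degFree_eq par rel p a ha, AddMonoidAlgebra.coeff_single, Finsupp.single_apply,
          Pi.single_apply]
        simp only [eq_comm])
      (by
        have : (⨆ p, freeGr k par p).map (RingQuot.mkAlgHom k rel).toLinearMap = ⊤ := by
          rw [iSup_freeGr, Submodule.map_top, LinearMap.range_eq_top]
          exact RingQuot.mkAlgHom_surjective k rel
        rw [Submodule.map_iSup] at this
        exact this)

/-- The class of a generator. -/
def gen {X : Type u} (par : X → ZMod 2)
    (rel : FreeAlgebra k X → FreeAlgebra k X → Prop) (h : Homogeneous par rel) (x : X) :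
    (presented par rel h).carrier :=
  RingQuot.mkAlgHom k rel (FreeAlgebra.ι k x)

end Presented

/-! ## Frobenius superalgebras and the rank two Clifford superalgebra -/

/-- The structure of a symmetric Frobenius superalgebra on `A`: a homogeneous trace map `tr` of
parity `σ` with `tr (ab) = (-1) ^ (|a| |b|) tr (ba)`, a homogeneous basis, and its dual basis, with
`tr (dual a * b) = δ_{ab}`. -/
structure FrobeniusData {k : Type u} [CommRing k] (A : SuperAlg.{u} k) where
  σ : ZMod 2
  tr : A.carrier →ₗ[k] k
  tr_parity : ∀ p, p ≠ σ → ∀ a ∈ A.gr p, tr a = 0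
  tr_symm : ∀ p q, ∀ a ∈ A.gr p, ∀ b ∈ A.gr q, tr (a * b) = sgn (p * q) • tr (b * a)
  idx : Type
  [idx_fintype : Fintype idx]
  [idx_decEq : DecidableEq idx]
  basis : Module.Basis idx k A.carrier
  par : idx → ZMod 2
  basis_mem : ∀ b, basis b ∈ A.gr (par b)
  dual : idx → A.carrier
  dual_mem : ∀ b, dual b ∈ A.gr (par b + σ)
  tr_dual : ∀ a b, tr (dual a * basis b) = if a = b then 1 else 0

attribute [instance] FrobeniusData.idx_fintype FrobeniusData.idx_decEq

section Clifford

variable (k : Type u) [CommRing k]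

/-- The rank two Clifford superalgebra `Cl = k ⊕ k c`, with `c` odd and `c ^ 2 = 1`, as the algebra
of the group `ZMod 2` with its tautological grading (`c` is the generator of the group). -/
def Cl : SuperAlg.{u} k where
  carrier := AddMonoidAlgebra k (ZMod 2)
  gr := AddMonoidAlgebra.grade k

/-- The odd generator of the Clifford superalgebra. -/
def clc : (Cl k).gr 1 :=
  ⟨(AddMonoidAlgebra.single 1 1 : AddMonoidAlgebra k (ZMod 2)),
    AddMonoidAlgebra.single_mem_grade 1 1⟩

theorem coeff_single_mul_single (p q : ZMod 2) (r s : k) :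
    (AddMonoidAlgebra.single p r * AddMonoidAlgebra.single q s :
      AddMonoidAlgebra k (ZMod 2)).coeff 1 = if p + q = 1 then r * s else 0 := by
  rw [AddMonoidAlgebra.single_mul_single, AddMonoidAlgebra.coeff_single, Finsupp.single_apply]

/-- The odd trace map with `tr 1 = 0`, `tr c = 1`; the basis is `{1, c}`, with dual basis
`1 ↦ c`, `c ↦ 1`. -/
def clFrobenius : FrobeniusData (Cl k) where
  σ := 1
  tr := (Finsupp.lapply (1 : ZMod 2)).comp
    (AddMonoidAlgebra.coeffLinearEquiv (M := ZMod 2) (S := k) k).toLinearMap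
  tr_parity := by
    intro p hp a ha
    obtain ⟨r, rfl⟩ := (AddMonoidAlgebra.mem_grade_iff' k p a).1 ha
    change (AddMonoidAlgebra.single p r : AddMonoidAlgebra k (ZMod 2)).coeff 1 = 0
    rw [AddMonoidAlgebra.coeff_single, Finsupp.single_apply, if_neg hp]
  tr_symm := by
    intro p q a ha b hb
    obtain ⟨r, rfl⟩ := (AddMonoidAlgebra.mem_grade_iff' k p a).1 ha
    obtain ⟨s, rfl⟩ := (AddMonoidAlgebra.mem_grade_iff' k q b).1 hb
    have hs : ∀ p q : ZMod 2, p + q = 1 → sgn (p * q) = 1 := by decide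
    refine (coeff_single_mul_single k p q r s).trans ?_
    refine Eq.trans ?_ (congrArg (sgn (p * q) • ·) (coeff_single_mul_single k q p s r).symm)
    simp only [add_comm q p, mul_comm s r]
    by_cases h : p + q = 1
    · rw [hs p q h, one_smul]
    · rw [if_neg h, smul_zero]
  idx := ZMod 2
  basis := Module.Basis.ofRepr (AddMonoidAlgebra.coeffLinearEquiv (M := ZMod 2) (S := k) k)
  par := fun b => b
  basis_mem := fun b => AddMonoidAlgebra.single_mem_grade b 1
  dual := fun b => (AddMonoidAlgebra.single (b + 1) 1 : AddMonoidAlgebra k (ZMod 2))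
  dual_mem := fun b => AddMonoidAlgebra.single_mem_grade (b + 1) 1
  tr_dual := by
    intro a b
    refine (coeff_single_mul_single k (a + 1) b 1 1).trans ?_
    have h : (a + 1 + b = 1) ↔ a = b := by
      revert a b; decide
    simp [h]

end Clifford

/-! ## Frobenius nilCoxeter and nilHecke algebras -/

/-- The strand `i` of the crossing of the strands `i` and `i + 1` (among `n` strands, which are
numbered from right to left, starting with `0`). -/
def lo {n : ℕ} (i : Fin (n - 1)) : Fin n := ⟨i, by omega⟩

/-- The strand `i + 1` of the crossing of the strands `i` and `i + 1`. -/
def hi {n : ℕ} (i : Fin (n - 1)) : Fin n := ⟨i + 1, by omega⟩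

section NC

variable {k : Type u} [CommRing k]

theorem sgn_smul_mem {X : Type u} {par : X → ZMod 2} {p : ZMod 2} (s : ZMod 2)
    {x : FreeAlgebra k X} (hx : x ∈ freeGr k par p) : sgn s • x ∈ freeGr k par p := by
  rw [Units.smul_def]
  exact zsmul_mem hx _

variable (A : SuperAlg.{u} k) (n : ℕ)

/-- Generators of the Frobenius nilCoxeter algebra: tokens (homogeneous elements of `A` on one of
the `n` strands) and crossings of neighbouring strands. -/
inductive NCGen : Type u
  | tok (p : ZMod 2) (a : A.gr p) (i : Fin n)
  | cross (i : Fin (n - 1))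

/-- Crossings are even, a token has the parity of its label. -/
def ncPar : NCGen A n → ZMod 2
  | .tok p _ _ => p
  | .cross _ => 0

variable {A n} in
/-- A token, in the free algebra. -/
def ftok {p : ZMod 2} (a : A.gr p) (i : Fin n) : FreeAlgebra k (NCGen A n) :=
  FreeAlgebra.ι k (.tok p a i)

variable {n} in
/-- A crossing, in the free algebra. -/
def fcross (i : Fin (n - 1)) : FreeAlgebra k (NCGen A n) := FreeAlgebra.ι k (.cross i)

/-- The relations of the Frobenius nilCoxeter algebra: the tokens generate a copy of the super
tensor power of `A`, the crossings satisfy the nilCoxeter relations, and the crossings permute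
the tokens. -/
inductive NCRel : FreeAlgebra k (NCGen A n) → FreeAlgebra k (NCGen A n) → Prop
  | tok_one (i : Fin n) : NCRel (ftok (⟨1, SetLike.GradedOne.one_mem⟩ : A.gr 0) i) 1
  | tok_add {p : ZMod 2} (a b : A.gr p) (i : Fin n) : NCRel (ftok (a + b) i) (ftok a i + ftok b i)
  | tok_smul {p : ZMod 2} (r : k) (a : A.gr p) (i : Fin n) : NCRel (ftok (r • a) i) (r • ftok a i)
  | tok_mul {p q : ZMod 2} (a : A.gr p) (b : A.gr q) (i : Fin n) :
      NCRel (ftok a i * ftok b i)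
        (ftok (⟨a * b, SetLike.GradedMul.mul_mem a.2 b.2⟩ : A.gr (p + q)) i)
  | tok_comm {p q : ZMod 2} (a : A.gr p) (b : A.gr q) (i j : Fin n) (h : i ≠ j) :
      NCRel (ftok a i * ftok b j) (sgn (p * q) • (ftok b j * ftok a i))
  | cross_sq (i : Fin (n - 1)) : NCRel (fcross A i * fcross A i) 0
  | cross_comm (i j : Fin (n - 1)) (h : (i : ℕ) + 1 < j) :
      NCRel (fcross A i * fcross A j) (fcross A j * fcross A i)
  | braid (i j : Fin (n - 1)) (h : (i : ℕ) + 1 = j) :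
      NCRel (fcross A i * fcross A j * fcross A i) (fcross A j * fcross A i * fcross A j)
  | cross_tok_lo {p : ZMod 2} (i : Fin (n - 1)) (a : A.gr p) :
      NCRel (fcross A i * ftok a (lo i)) (ftok a (hi i) * fcross A i)
  | cross_tok_hi {p : ZMod 2} (i : Fin (n - 1)) (a : A.gr p) :
      NCRel (fcross A i * ftok a (hi i)) (ftok a (lo i) * fcross A i)
  | cross_tok_far {p : ZMod 2} (i : Fin (n - 1)) (a : A.gr p) (j : Fin n)
      (hl : j ≠ lo i) (hh : j ≠ hi i) :
      NCRel (fcross A i * ftok a j) (ftok a j * fcross A i)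

variable {A n} in
theorem ftok_mem {p : ZMod 2} (a : A.gr p) (i : Fin n) : ftok a i ∈ freeGr k (ncPar A n) p :=
  ι_mem_freeGr (ncPar A n) (.tok p a i)

variable {n} in
theorem fcross_mem (i : Fin (n - 1)) : fcross A i ∈ freeGr k (ncPar A n) 0 :=
  ι_mem_freeGr (ncPar A n) (.cross i)

theorem ncRel_homogeneous : Homogeneous (ncPar A n) (NCRel A n) := by
  have mul : ∀ {p q r : ZMod 2} {a b : FreeAlgebra k (NCGen A n)}, a ∈ freeGr k (ncPar A n) p →
      b ∈ freeGr k (ncPar A n) q → p + q = r → a * b ∈ freeGr k (ncPar A n) r := by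
    rintro p q _ a b ha hb rfl
    exact SetLike.GradedMul.mul_mem ha hb
  intro a b h
  cases h with
  | tok_one i => exact ⟨0, ftok_mem _ i, SetLike.GradedOne.one_mem⟩
  | tok_add a b i => exact ⟨_, ftok_mem _ i, add_mem (ftok_mem a i) (ftok_mem b i)⟩
  | tok_smul r a i => exact ⟨_, ftok_mem _ i, Submodule.smul_mem _ _ (ftok_mem a i)⟩
  | tok_mul a b i => exact ⟨_, mul (ftok_mem a i) (ftok_mem b i) rfl, ftok_mem _ i⟩
  | tok_comm a b i j h =>
    exact ⟨_, mul (ftok_mem a i) (ftok_mem b j) rfl,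
      sgn_smul_mem _ (mul (ftok_mem b j) (ftok_mem a i) (add_comm _ _))⟩
  | cross_sq i => exact ⟨0, mul (fcross_mem A i) (fcross_mem A i) rfl, zero_mem _⟩
  | cross_comm i j h =>
    exact ⟨0, mul (fcross_mem A i) (fcross_mem A j) rfl, mul (fcross_mem A j) (fcross_mem A i) rfl⟩
  | braid i j h =>
    exact ⟨0, mul (mul (fcross_mem A i) (fcross_mem A j) rfl) (fcross_mem A i) rfl,
      mul (mul (fcross_mem A j) (fcross_mem A i) rfl) (fcross_mem A j) rfl⟩
  | cross_tok_lo i a =>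
    exact ⟨_, mul (fcross_mem A i) (ftok_mem a _) (zero_add _),
      mul (ftok_mem a _) (fcross_mem A i) (add_zero _)⟩
  | cross_tok_hi i a =>
    exact ⟨_, mul (fcross_mem A i) (ftok_mem a _) (zero_add _),
      mul (ftok_mem a _) (fcross_mem A i) (add_zero _)⟩
  | cross_tok_far i a j _ _ =>
    exact ⟨_, mul (fcross_mem A i) (ftok_mem a _) (zero_add _),
      mul (ftok_mem a _) (fcross_mem A i) (add_zero _)⟩

/-- The Frobenius nilCoxeter algebra `NC_n(A)`. It does not depend on the trace map. -/
def NC : SuperAlg.{u} k := presented (ncPar A n) (NCRel A n) (ncRel_homogeneous A n)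

variable {A} (F : FrobeniusData A)

/-- Generators of the Frobenius nilHecke algebra: those of the nilCoxeter algebra, and a dot on
each of the `n` strands. -/
abbrev NHGen (A : SuperAlg.{u} k) (n : ℕ) : Type u := NCGen A n ⊕ Fin n

/-- The dots have the parity of the trace map. -/
def nhPar : NHGen A n → ZMod 2 := Sum.elim (ncPar A n) (fun _ => F.σ)

variable (A) in
/-- The inclusion of free algebras given by the inclusion of generators. -/
def ncToNHFree : FreeAlgebra k (NCGen A n) →ₐ[k] FreeAlgebra k (NHGen A n) :=
  FreeAlgebra.lift k fun x => FreeAlgebra.ι k (Sum.inl x)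

variable {n}

/-- A token, in the free algebra. -/
def htok {p : ZMod 2} (a : A.gr p) (i : Fin n) : FreeAlgebra k (NHGen A n) :=
  FreeAlgebra.ι k (Sum.inl (.tok p a i))

variable (A) in
/-- A crossing, in the free algebra. -/
def hcross (i : Fin (n - 1)) : FreeAlgebra k (NHGen A n) := FreeAlgebra.ι k (Sum.inl (.cross i))

variable (A) in
/-- A dot, in the free algebra. -/
def hdot (i : Fin n) : FreeAlgebra k (NHGen A n) := FreeAlgebra.ι k (Sum.inr i)

/-- The teleporter `τ_i = ∑_b (-1) ^ (σ |b|) b ⊗ dual b` on the strands `i + 1` and `i`. -/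
def hteleport (i : Fin (n - 1)) : FreeAlgebra k (NHGen A n) :=
  ∑ b : F.idx, sgn (F.σ * F.par b) •
    (htok (⟨F.basis b, F.basis_mem b⟩ : A.gr (F.par b)) (hi i) *
      htok (⟨F.dual b, F.dual_mem b⟩ : A.gr (F.par b + F.σ)) (lo i))

variable (n) in
/-- The relations of the Frobenius nilHecke algebra. -/
inductive NHRel : FreeAlgebra k (NHGen A n) → FreeAlgebra k (NHGen A n) → Prop
  | nc {a b : FreeAlgebra k (NCGen A n)} (h : NCRel A n a b) :
      NHRel (ncToNHFree A n a) (ncToNHFree A n b)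
  | dot_dot (i j : Fin n) (h : i ≠ j) :
      NHRel (hdot A i * hdot A j) (sgn F.σ • (hdot A j * hdot A i))
  | tok_dot {p : ZMod 2} (a : A.gr p) (i j : Fin n) :
      NHRel (htok a j * hdot A i) (sgn (F.σ * p) • (hdot A i * htok a j))
  | dot_cross_far (i : Fin (n - 1)) (j : Fin n) (hl : j ≠ lo i) (hh : j ≠ hi i) :
      NHRel (hdot A j * hcross A i) (hcross A i * hdot A j)
  | cross_dot (i : Fin (n - 1)) :
      NHRel (hcross A i * hdot A (hi i)) (hdot A (lo i) * hcross A i + hteleport F i)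
  | dot_cross (i : Fin (n - 1)) :
      NHRel (hdot A (hi i) * hcross A i)
        (hcross A i * hdot A (lo i) + sgn F.σ • hteleport F i)

theorem htok_mem {p : ZMod 2} (a : A.gr p) (i : Fin n) : htok a i ∈ freeGr k (nhPar n F) p :=
  ι_mem_freeGr (nhPar n F) (Sum.inl (.tok p a i))

theorem hcross_mem (i : Fin (n - 1)) : hcross A i ∈ freeGr k (nhPar n F) 0 :=
  ι_mem_freeGr (nhPar n F) (Sum.inl (.cross i))

theorem hdot_mem (i : Fin n) : hdot A i ∈ freeGr k (nhPar n F) F.σ :=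
  ι_mem_freeGr (nhPar n F) (Sum.inr i)

theorem hteleport_mem (i : Fin (n - 1)) : hteleport F i ∈ freeGr k (nhPar n F) F.σ := by
  refine sum_mem fun b _ => sgn_smul_mem _ ?_
  have h := SetLike.GradedMul.mul_mem
    (htok_mem F (⟨F.basis b, F.basis_mem b⟩ : A.gr (F.par b)) (hi i))
    (htok_mem F (⟨F.dual b, F.dual_mem b⟩ : A.gr (F.par b + F.σ)) (lo i))
  rwa [← add_assoc, CharTwo.add_self_eq_zero, zero_add] at h

theorem map_mem_freeGr {X Y : Type u} {par : X → ZMod 2} {par' : Y → ZMod 2} (f : X → Y)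
    (hf : ∀ x, par' (f x) = par x) {p : ZMod 2} {a : FreeAlgebra k X} (ha : a ∈ freeGr k par p) :
    FreeAlgebra.lift k (fun x => FreeAlgebra.ι k (f x)) a ∈ freeGr k par' p := by
  induction ha using Submodule.span_induction with
  | zero => simp
  | add x y _ _ hx hy => rw [map_add]; exact add_mem hx hy
  | smul r x _ hx => rw [map_smul]; exact Submodule.smul_mem _ _ hx
  | mem x hx =>
    obtain ⟨l, rfl, rfl⟩ := hx
    refine Submodule.subset_span ⟨l.map f, ?_, ?_⟩
    · rw [List.map_map]
      congr 2
      ext x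
      exact hf x
    · rw [map_list_prod, List.map_map, List.map_map]
      congr 2
      ext x
      simp

variable (n) in
theorem nhRel_homogeneous : Homogeneous (nhPar n F) (NHRel n F) := by
  have mul : ∀ {p q r : ZMod 2} {a b : FreeAlgebra k (NHGen A n)}, a ∈ freeGr k (nhPar n F) p →
      b ∈ freeGr k (nhPar n F) q → p + q = r → a * b ∈ freeGr k (nhPar n F) r := by
    rintro p q _ a b ha hb rfl
    exact SetLike.GradedMul.mul_mem ha hb
  intro a b h
  cases h with
  | nc h =>
    obtain ⟨p, ha, hb⟩ := ncRel_homogeneous A n _ _ h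
    exact ⟨p, map_mem_freeGr Sum.inl (fun _ => rfl) ha, map_mem_freeGr Sum.inl (fun _ => rfl) hb⟩
  | dot_dot i j h =>
    exact ⟨_, mul (hdot_mem F i) (hdot_mem F j) rfl,
      sgn_smul_mem _ (mul (hdot_mem F j) (hdot_mem F i) rfl)⟩
  | tok_dot a i j =>
    exact ⟨_, mul (htok_mem F a j) (hdot_mem F i) rfl,
      sgn_smul_mem _ (mul (hdot_mem F i) (htok_mem F a j) (add_comm _ _))⟩
  | dot_cross_far i j _ _ =>
    exact ⟨_, mul (hdot_mem F j) (hcross_mem F i) (add_zero _),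
      mul (hcross_mem F i) (hdot_mem F j) (zero_add _)⟩
  | cross_dot i =>
    exact ⟨_, mul (hcross_mem F i) (hdot_mem F _) (zero_add _),
      add_mem (mul (hdot_mem F _) (hcross_mem F i) (add_zero _)) (hteleport_mem F i)⟩
  | dot_cross i =>
    exact ⟨_, mul (hdot_mem F _) (hcross_mem F i) (add_zero _),
      add_mem (mul (hcross_mem F i) (hdot_mem F _) (zero_add _))
        (sgn_smul_mem _ (hteleport_mem F i))⟩

variable (n) in
/-- The Frobenius nilHecke algebra `NH_n(A)`. -/
def NH : SuperAlg.{u} k := presented (nhPar n F) (NHRel n F) (nhRel_homogeneous n F)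

end NC

/-! ## Odd nilCoxeter and odd nilHecke algebras -/

section ONC

/-- Generators of the odd nilCoxeter algebra: crossings of neighbouring strands. -/
inductive ONCGen (n : ℕ) : Type u
  | cross (i : Fin (n - 1))

/-- Generators of the odd nilHecke algebra: crossings of neighbouring strands, and dots. -/
inductive ONHGen (n : ℕ) : Type u
  | cross (i : Fin (n - 1))
  | dot (i : Fin n)

variable (k : Type u) [CommRing k] {n : ℕ}

/-- A crossing, in the free algebra. -/
def ocross (i : Fin (n - 1)) : FreeAlgebra k (ONCGen.{u} n) := FreeAlgebra.ι k (.cross i)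

/-- A crossing, in the free algebra. -/
def ohcross (i : Fin (n - 1)) : FreeAlgebra k (ONHGen.{u} n) := FreeAlgebra.ι k (.cross i)

/-- A dot, in the free algebra. -/
def ohdot (i : Fin n) : FreeAlgebra k (ONHGen.{u} n) := FreeAlgebra.ι k (.dot i)

/-- The odd nilCoxeter relations for a family `v` of elements of an algebra. -/
inductive OddNilCoxeterRel {R : Type u} [Ring R] (v : Fin (n - 1) → R) : R → R → Prop
  | sq (i : Fin (n - 1)) : OddNilCoxeterRel v (v i * v i) 0
  | anticomm (i j : Fin (n - 1)) (h : (i : ℕ) + 1 < j) :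
      OddNilCoxeterRel v (v i * v j) (-(v j * v i))
  | braid (i j : Fin (n - 1)) (h : (i : ℕ) + 1 = j) :
      OddNilCoxeterRel v (v i * v j * v i) (v j * v i * v j)

variable (n) in
/-- The relations of the odd nilHecke algebra. -/
inductive ONHRel : FreeAlgebra k (ONHGen.{u} n) → FreeAlgebra k (ONHGen.{u} n) → Prop
  | onc {a b : FreeAlgebra k (ONHGen.{u} n)} (h : OddNilCoxeterRel (ohcross k) a b) : ONHRel a b
  | dot_dot (i j : Fin n) (h : i ≠ j) :
      ONHRel (ohdot k i * ohdot k j) (-(ohdot k j * ohdot k i))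
  | dot_cross_far (i : Fin (n - 1)) (j : Fin n) (hl : j ≠ lo i) (hh : j ≠ hi i) :
      ONHRel (ohdot k j * ohcross k i) (-(ohcross k i * ohdot k j))
  | cross_dot (i : Fin (n - 1)) :
      ONHRel (ohcross k i * ohdot k (hi i) + ohdot k (lo i) * ohcross k i) 1
  | dot_cross (i : Fin (n - 1)) :
      ONHRel (ohdot k (hi i) * ohcross k i + ohcross k i * ohdot k (lo i)) 1

theorem oddNilCoxeterRel_homogeneous {X : Type u} (par : X → ZMod 2)
    (v : Fin (n - 1) → FreeAlgebra k X) (hv : ∀ i, v i ∈ freeGr k par 1) :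
    Homogeneous par (OddNilCoxeterRel v) := by
  have mul : ∀ {p q : ZMod 2} {a b : FreeAlgebra k X}, a ∈ freeGr k par p →
      b ∈ freeGr k par q → a * b ∈ freeGr k par (p + q) :=
    fun ha hb => SetLike.GradedMul.mul_mem ha hb
  intro a b h
  cases h with
  | sq i => exact ⟨_, mul (hv i) (hv i), zero_mem _⟩
  | anticomm i j h => exact ⟨_, mul (hv i) (hv j), neg_mem (mul (hv j) (hv i))⟩
  | braid i j h =>
    exact ⟨_, mul (mul (hv i) (hv j)) (hv i), mul (mul (hv j) (hv i)) (hv j)⟩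

variable (n) in
theorem onhRel_homogeneous : Homogeneous (fun _ => 1) (ONHRel k n) := by
  have mul : ∀ {p q : ZMod 2} {a b : FreeAlgebra k (ONHGen.{u} n)},
      a ∈ freeGr k (fun _ => 1) p → b ∈ freeGr k (fun _ => 1) q →
        a * b ∈ freeGr k (fun _ => 1) (p + q) :=
    fun ha hb => SetLike.GradedMul.mul_mem ha hb
  have hv : ∀ i, ohcross k i ∈ freeGr k (fun _ : ONHGen.{u} n => 1) 1 :=
    fun i => ι_mem_freeGr _ _
  have hy : ∀ i, ohdot k i ∈ freeGr k (fun _ : ONHGen.{u} n => 1) 1 :=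
    fun i => ι_mem_freeGr _ _
  have h1 : (1 : FreeAlgebra k (ONHGen.{u} n)) ∈
      freeGr k (fun _ : ONHGen.{u} n => (1 : ZMod 2)) (1 + 1) :=
    SetLike.GradedOne.one_mem (A := freeGr k (fun _ : ONHGen.{u} n => (1 : ZMod 2)))
  intro a b h
  cases h with
  | onc h => exact oddNilCoxeterRel_homogeneous k _ _ hv _ _ h
  | dot_dot i j h => exact ⟨_, mul (hy i) (hy j), neg_mem (mul (hy j) (hy i))⟩
  | dot_cross_far i j _ _ => exact ⟨_, mul (hy j) (hv i), neg_mem (mul (hv i) (hy j))⟩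
  | cross_dot i =>
    exact ⟨1 + 1, add_mem (mul (hv i) (hy _)) (mul (hy _) (hv i)), h1⟩
  | dot_cross i =>
    exact ⟨1 + 1, add_mem (mul (hy _) (hv i)) (mul (hv i) (hy _)), h1⟩

variable (n)

/-- The odd nilCoxeter algebra `ONC_n`; its generators are odd. -/
def ONC : SuperAlg.{u} k :=
  presented (fun _ => 1) (OddNilCoxeterRel (ocross k (n := n)))
    (oddNilCoxeterRel_homogeneous k _ _ fun _ => ι_mem_freeGr _ _)

/-- The odd nilHecke algebra `ONH_n`; its generators are odd. -/
def ONH : SuperAlg.{u} k := presented (fun _ => 1) (ONHRel k n) (onhRel_homogeneous k n)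

end ONC

/-! ## Names for the generators -/

section Generators

variable (k : Type u) [CommRing k] {n : ℕ}

/-- `c_i` in the Clifford nilCoxeter algebra. -/
def ncC (i : Fin n) : (NC (Cl k) n).carrier := gen _ _ _ (.tok 1 (clc k) i)

/-- `u_i` in the Clifford nilCoxeter algebra. -/
def ncU (i : Fin (n - 1)) : (NC (Cl k) n).carrier := gen _ _ _ (.cross i)

/-- `c_i` in the Clifford nilHecke algebra. -/
def nhC (i : Fin n) : (NH n (clFrobenius k)).carrier := gen _ _ _ (Sum.inl (.tok 1 (clc k) i))

/-- `u_i` in the Clifford nilHecke algebra. -/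
def nhU (i : Fin (n - 1)) : (NH n (clFrobenius k)).carrier := gen _ _ _ (Sum.inl (.cross i))

/-- `x_i` in the Clifford nilHecke algebra. -/
def nhX (i : Fin n) : (NH n (clFrobenius k)).carrier := gen _ _ _ (Sum.inr i)

/-- `v_i` in the odd nilCoxeter algebra. -/
def oncV (i : Fin (n - 1)) : (ONC k n).carrier := gen _ _ _ (.cross i)

/-- `v_i` in the odd nilHecke algebra. -/
def onhV (i : Fin (n - 1)) : (ONH k n).carrier := gen _ _ _ (.cross i)

/-- `y_i` in the odd nilHecke algebra. -/
def onhY (i : Fin n) : (ONH k n).carrier := gen _ _ _ (.dot i)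

/-- `c_i` in the tensor power of the Clifford superalgebra. -/
def clC (i : Fin n) : (tensorPow (Cl k) n).carrier := place (Cl k) n i (clc k : (Cl k).carrier)

end Generators

/-! ## Supermodules and Morita superequivalence -/

section Modules

variable {k : Type u} [CommRing k]

/-- A (left) supermodule over `A`: an `A`-module `M = M₀ ⊕ M₁` with `A_p M_q ⊆ M_{p + q}`. -/
structure SMod (A : SuperAlg.{u} k) where
  carrier : Type u
  [addCommGroup : AddCommGroup carrier]
  [module : Module A.carrier carrier]
  gr : ZMod 2 → AddSubgroup carrier
  isCompl : IsCompl (gr 0) (gr 1)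
  smul_mem : ∀ {p q : ZMod 2} {a : A.carrier} {m : carrier},
    a ∈ A.gr p → m ∈ gr q → a • m ∈ gr (p + q)

attribute [instance] SMod.addCommGroup SMod.module

variable {A B : SuperAlg.{u} k}

/-- A morphism of supermodules: a parity preserving `A`-linear map. -/
@[ext]
structure SMod.Hom (M N : SMod A) where
  toLin : M.carrier →ₗ[A.carrier] N.carrier
  map_mem : ∀ (p : ZMod 2) (m : M.carrier), m ∈ M.gr p → toLin m ∈ N.gr p

instance : Category (SMod A) where
  Hom := SMod.Hom
  id M := ⟨LinearMap.id, fun _ _ h => h⟩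
  comp f g := ⟨g.toLin.comp f.toLin, fun p m h => g.map_mem p _ (f.map_mem p m h)⟩

namespace SMod

@[ext]
theorem hom_ext {M N : SMod A} {f g : M ⟶ N} (h : f.toLin = g.toLin) : f = g := Hom.ext h

@[simp] theorem toLin_id (M : SMod A) : Hom.toLin (𝟙 M) = LinearMap.id := rfl

@[simp] theorem toLin_comp {M N P : SMod A} (f : M ⟶ N) (g : N ⟶ P) :
    (f ≫ g).toLin = g.toLin.comp f.toLin := rfl

theorem algebraMap_smul_mem (M : SMod A) (r : k) {p : ZMod 2} {m : M.carrier} (hm : m ∈ M.gr p) :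
    algebraMap k A.carrier r • m ∈ M.gr p := by
  have h := M.smul_mem (SetLike.algebraMap_mem_graded A.gr r) hm
  rwa [zero_add] at h

/-- Multiplication by `r : k` on a supermodule. -/
def scalar (M : SMod A) (r : k) : M.carrier →ₗ[A.carrier] M.carrier where
  toFun m := algebraMap k A.carrier r • m
  map_add' := smul_add _
  map_smul' a m := by
    simp only [RingHom.id_apply, smul_smul]
    rw [Algebra.commutes]

instance (M N : SMod A) : Zero (M ⟶ N) := ⟨⟨0, fun _ _ _ => zero_mem _⟩⟩

instance (M N : SMod A) : Add (M ⟶ N) :=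
  ⟨fun f g => ⟨f.toLin + g.toLin, fun p m h => add_mem (f.map_mem p m h) (g.map_mem p m h)⟩⟩

instance (M N : SMod A) : Neg (M ⟶ N) :=
  ⟨fun f => ⟨-f.toLin, fun p m h => neg_mem (f.map_mem p m h)⟩⟩

instance (M N : SMod A) : SMul k (M ⟶ N) :=
  ⟨fun r f => ⟨(N.scalar r).comp f.toLin,
    fun p m h => N.algebraMap_smul_mem r (f.map_mem p m h)⟩⟩

@[simp] theorem toLin_zero (M N : SMod A) : Hom.toLin (0 : M ⟶ N) = 0 := rfl

@[simp] theorem toLin_add {M N : SMod A} (f g : M ⟶ N) : (f + g).toLin = f.toLin + g.toLin := rfl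

@[simp] theorem toLin_neg {M N : SMod A} (f : M ⟶ N) : (-f).toLin = -f.toLin := rfl

@[simp] theorem toLin_smul {M N : SMod A} (r : k) (f : M ⟶ N) (m : M.carrier) :
    (r • f).toLin m = algebraMap k A.carrier r • f.toLin m := rfl

instance (M N : SMod A) : AddCommGroup (M ⟶ N) where
  add_assoc f g h := by ext; simp [add_assoc]
  zero_add f := by ext; simp
  add_zero f := by ext; simp
  add_comm f g := by ext; simp [add_comm]
  neg_add_cancel f := by ext; simp
  nsmul := nsmulRec
  zsmul := zsmulRec

instance : Preadditive (SMod A) where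
  add_comp M N P f g h := by ext; simp
  comp_add M N P f g h := by ext; simp

instance (M N : SMod A) : Module k (M ⟶ N) where
  one_smul f := by ext; simp
  mul_smul r s f := by ext; simp [mul_smul]
  smul_zero r := by ext; simp
  smul_add r f g := by ext; simp
  add_smul r s f := by ext; simp [add_smul]
  zero_smul f := by ext; simp

instance : Linear k (SMod A) where
  smul_comp M N P r f g := by ext; simp
  comp_smul M N P f r g := by ext; simp

variable (A) in
/-- The parity shift functor `Π`: the same module with the opposite parities. (The other usual
convention, with the action of odd elements multiplied by `-1`, gives an isomorphic functor.) -/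
def shift : SMod A ⥤ SMod A where
  obj M :=
    { carrier := M.carrier
      gr := fun p => M.gr (p + 1)
      isCompl := M.isCompl.symm
      smul_mem := fun {p q a m} ha hm => by rw [add_assoc]; exact M.smul_mem ha hm }
  map f := ⟨f.toLin, fun p m h => f.map_mem (p + 1) m h⟩

theorem parity_shift_twice (p : ZMod 2) : p + 1 + 1 = p := by revert p; decide

/-- The isomorphism `ξ : Π Π M ≅ M`, the identity on the underlying modules. -/
def shiftTwice (M : SMod A) : (shift A).obj ((shift A).obj M) ≅ M where
  hom := ⟨(LinearMap.id : M.carrier →ₗ[A.carrier] M.carrier), fun p m h => by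
    have h' : m ∈ M.gr (p + 1 + 1) := h
    rwa [parity_shift_twice] at h'⟩
  inv := ⟨(LinearMap.id : M.carrier →ₗ[A.carrier] M.carrier), fun p m h => by
    change m ∈ M.gr (p + 1 + 1)
    rwa [parity_shift_twice]⟩

end SMod

/-- A Morita superequivalence between `A` and `B`: a `k`-linear equivalence between their
categories of supermodules that commutes with the parity shifts, compatibly with `ξ : Π Π ≅ 1`. -/
structure MoritaSuperequivalence (A B : SuperAlg.{u} k) where
  eqv : SMod A ≌ SMod B
  additive : eqv.functor.Additive
  linear : eqv.functor.Linear k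
  shiftIso : SMod.shift A ⋙ eqv.functor ≅ eqv.functor ⋙ SMod.shift B
  coherence : ∀ M : SMod A,
    shiftIso.hom.app ((SMod.shift A).obj M) ≫ (SMod.shift B).map (shiftIso.hom.app M) ≫
        (SMod.shiftTwice (eqv.functor.obj M)).hom =
      eqv.functor.map (SMod.shiftTwice M).hom

/-- Morita superequivalence up to Clifford superalgebras (also called weak Morita
superequivalence): `A ⊗ Cl^{⊗ r}` and `B ⊗ Cl^{⊗ s}` are Morita superequivalent for some `r`, `s`. -/
def WeaklyMoritaSuperequivalent (A B : SuperAlg.{u} k) : Prop :=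
  ∃ r s : ℕ, Nonempty
    (MoritaSuperequivalence (tensor A (tensorPow (Cl k) r)) (tensor B (tensorPow (Cl k) s)))

end Modules

end OddNil

/-! Write `d_i = c_i - c_{i+1}`. The Clifford relations give `d_i ^ 2 = 2` (`sub_mul_sub`). The
`d_i` anticommute when the crossings are far apart (`sub_anti`) and satisfy the braid relation
(`sub_braid`), so up to the value of the square they behave like odd crossings. Also `d_i c_i =
-c_{i+1} d_i`, `d_i c_{i+1} = -c_i d_i`, and `d_i` anticommutes with every other `c_j`. If an odd
`v_i` anticommutes with all `c_j`, the signs of `v_i` and `d_i` cancel in `u_i = d_i v_i`. The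
result is even, permutes the `c_j`, and satisfies the ordinary nilCoxeter relations exactly when the
`v_i` satisfy the odd ones. As `2` is invertible, `v_i = (1/2) d_i u_i` undoes the substitution. For
the dots, multiplying `v_i y_{i+1} + y_i v_i = 1` by `d_i` turns the constant `1` into `d_i`, which
is the teleporter of the Clifford superalgebra (`hteleport_clFrobenius`).

This is a statement about families of elements in an arbitrary algebra, and it is proved as such:
`IsOddNilCoxeterFamily.toNilCoxeter`, `IsNilCoxeterFamily.toOddNilCoxeter` and the two nilHecke
versions. Every algebra involved has a universal property, by generators and relations or as a super
tensor product, so these four lemmas give homomorphisms in both directions. They are inverse to each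
other because they are so on generators (`exists_ncIso`, `exists_nhIso`).

The weak Morita statements follow at once, since the isomorphisms already have the form `A ≅ B ⊗
Cl^{⊗ n}`. For the sharper statements let `ε ^ 2 = -1`. In `A ⊗ Cl ⊗ Cl`, with Clifford generators
`c` and `d`, the even element `e = (1 + ε c d) / 2` is an idempotent that commutes with `A`, and
conjugation by the odd `c` exchanges `e` and `1 - e`. So this superalgebra is a matrix superalgebra
of size `(1 | 1)` over `A` (`cliffordMatrix`), and `N ↦ e N` is a Morita superequivalence
(`MatrixData.morita`). Clifford factors can therefore be removed in pairs, and only the parity of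
`n` matters. -/

namespace OddNil

/-! ### Signs, supercommuting homomorphisms, homogeneous parts -/

section SuperCommute

variable {k : Type u} [CommRing k]

theorem sgn_smul_smul {M : Type*} [AddCommGroup M] (p : ZMod 2) (m : M) :
    sgn p • sgn p • m = m := by
  rw [smul_smul, Int.units_mul_self, one_smul]

theorem sgn_add (p q : ZMod 2) : sgn (p + q) = sgn p * sgn q := by
  revert p q; decide

theorem sgn_zero : sgn 0 = 1 := by decide

theorem sgn_one : sgn 1 = -1 := by decide

theorem sgn_one_smul {M : Type*} [AddCommGroup M] (m : M) : sgn 1 • m = -m := by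
  rw [sgn_one, Units.neg_smul, one_smul]

theorem zmod_two_eq (p : ZMod 2) : p = 0 ∨ p = 1 := by revert p; decide

theorem sgn_smul_comm {M : Type*} [AddCommGroup M] [Module k M] (p : ZMod 2) (r : k) (m : M) :
    sgn p • r • m = r • sgn p • m := by
  rcases zmod_two_eq p with rfl | rfl
  · simp [sgn_zero]
  · simp [sgn_one_smul]

theorem map_sgn_smul {M N F : Type*} [AddCommGroup M] [AddCommGroup N] [FunLike F M N]
    [AddMonoidHomClass F M N] (f : F) (p : ZMod 2) (m : M) : f (sgn p • m) = sgn p • f m := by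
  rcases zmod_two_eq p with rfl | rfl
  · simp [sgn_zero]
  · simp [sgn_one_smul]

/-- Two algebra homomorphisms with supercommuting images. -/
def SuperCommute {A B : SuperAlg.{u} k} {C : Type*} [Ring C] [Algebra k C]
    (f : A.carrier →ₐ[k] C) (g : B.carrier →ₐ[k] C) : Prop :=
  ∀ ⦃i j : ZMod 2⦄ ⦃a : A.carrier⦄ ⦃b : B.carrier⦄, a ∈ A.gr i → b ∈ B.gr j →
    f a * g b = sgn (i * j) • (g b * f a)

theorem SuperCommute.symm {A B : SuperAlg.{u} k} {C : Type*} [Ring C] [Algebra k C]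
    {f : A.carrier →ₐ[k] C} {g : B.carrier →ₐ[k] C} (h : SuperCommute f g) :
    SuperCommute g f := by
  intro i j a b ha hb
  rw [h hb ha, mul_comm i j, sgn_smul_smul]

theorem SuperCommute.map {A B : SuperAlg.{u} k} {C D : Type*} [Ring C] [Algebra k C]
    [Ring D] [Algebra k D] {f : A.carrier →ₐ[k] C} {g : B.carrier →ₐ[k] C}
    (h : SuperCommute f g) (φ : C →ₐ[k] D) : SuperCommute (φ.comp f) (φ.comp g) := by
  intro i j a b ha hb
  simp only [AlgHom.comp_apply, ← map_mul, h ha hb, map_sgn_smul]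

/-- An algebra homomorphism that sends the part of parity `p` into `𝒞 p`. -/
def IsGraded (A : SuperAlg.{u} k) {C : Type*} [Ring C] [Algebra k C]
    (𝒞 : ZMod 2 → Submodule k C) (f : A.carrier →ₐ[k] C) : Prop :=
  ∀ ⦃p : ZMod 2⦄ ⦃a : A.carrier⦄, a ∈ A.gr p → f a ∈ 𝒞 p

theorem IsGraded.comp {A B : SuperAlg.{u} k} {C : Type*} [Ring C] [Algebra k C]
    {𝒞 : ZMod 2 → Submodule k C} {g : B.carrier →ₐ[k] C} {f : A.carrier →ₐ[k] B.carrier}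
    (hg : IsGraded B 𝒞 g) (hf : IsGraded A B.gr f) : IsGraded A 𝒞 (g.comp f) :=
  fun _ _ ha => hg (hf ha)

theorem SuperCommute.comp {A A' B B' : SuperAlg.{u} k} {C : Type*} [Ring C] [Algebra k C]
    {f : A.carrier →ₐ[k] C} {g : B.carrier →ₐ[k] C} (h : SuperCommute f g)
    {f' : A'.carrier →ₐ[k] A.carrier} {g' : B'.carrier →ₐ[k] B.carrier}
    (hf : IsGraded A' A.gr f') (hg : IsGraded B' B.gr g') :
    SuperCommute (f.comp f') (g.comp g') :=
  fun _ _ _ _ ha hb => h (hf ha) (hg hb)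

/-- Every element is a sum of homogeneous elements. -/
theorem SuperAlg.homogeneous_induction (A : SuperAlg.{u} k) {P : A.carrier → Prop}
    (hom : ∀ p, ∀ a ∈ A.gr p, P a) (add : ∀ a b, P a → P b → P (a + b)) (a : A.carrier) : P a := by
  have h := DirectSum.Decomposition.inductionOn A.gr (motive := P) (hom 0 0 (zero_mem _))
    (fun {i} m => hom i m m.2) add
  exact h a

/-- Uniqueness of homogeneous parts: the projection to parity `p` fixes `a` and kills one of the two
summands. It shows that the inverse of a parity preserving isomorphism preserves parity. -/
theorem mem_gr_of_eq_add (A : SuperAlg.{u} k) {a a₀ a₁ : A.carrier} (h₀ : a₀ ∈ A.gr 0)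
    (h₁ : a₁ ∈ A.gr 1) (h : a₀ + a₁ = a) {p : ZMod 2} (ha : a ∈ A.gr p) :
    a = if p = 0 then a₀ else a₁ := by
  subst h
  have e₀ : GradedAlgebra.proj A.gr p a₀ = if p = 0 then a₀ else 0 := by
    rw [GradedAlgebra.proj_apply, DirectSum.decompose_of_mem _ h₀]
    split_ifs with hp
    · subst hp; rw [DirectSum.of_eq_same]
    · rw [DirectSum.of_eq_of_ne _ _ _ hp]; rfl
  have e₁ : GradedAlgebra.proj A.gr p a₁ = if p = 0 then 0 else a₁ := by
    rw [GradedAlgebra.proj_apply, DirectSum.decompose_of_mem _ h₁]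
    split_ifs with hp
    · subst hp; rw [DirectSum.of_eq_of_ne _ _ _ (by decide)]; rfl
    · obtain rfl : p = 1 := (zmod_two_eq p).resolve_left hp
      rw [DirectSum.of_eq_same]
  have e : GradedAlgebra.proj A.gr p (a₀ + a₁) = a₀ + a₁ := by
    rw [GradedAlgebra.proj_apply, DirectSum.decompose_of_mem_same _ ha]
  rw [map_add, e₀, e₁] at e
  rw [← e]
  split_ifs <;> simp

theorem SuperAlg.exists_parts (A : SuperAlg.{u} k) (a : A.carrier) :
    ∃ a₀ ∈ A.gr 0, ∃ a₁ ∈ A.gr 1, a₀ + a₁ = a := by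
  induction a using A.homogeneous_induction with
  | hom p a ha =>
    rcases zmod_two_eq p with rfl | rfl
    · exact ⟨a, ha, 0, zero_mem _, add_zero a⟩
    · exact ⟨0, zero_mem _, a, ha, zero_add a⟩
  | add a b ha hb =>
    obtain ⟨a₀, h₀, a₁, h₁, rfl⟩ := ha
    obtain ⟨b₀, h₀', b₁, h₁', rfl⟩ := hb
    exact ⟨a₀ + b₀, add_mem h₀ h₀', a₁ + b₁, add_mem h₁ h₁', by abel⟩

/-- The inverse of an isomorphism of superalgebras. -/
def SuperIso.symm {A B : SuperAlg.{u} k} (Φ : SuperIso A B) : SuperIso B A where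
  toAlgEquiv := Φ.toAlgEquiv.symm
  map_mem := by
    intro p b hb
    obtain ⟨a₀, h₀, a₁, h₁, h⟩ := A.exists_parts (Φ.toAlgEquiv.symm b)
    -- The images of the two parts of the preimage are the parts of `b`, and `b` has only one.
    have hb' := mem_gr_of_eq_add B (Φ.map_mem _ _ h₀) (Φ.map_mem _ _ h₁)
      (by rw [← map_add, h, AlgEquiv.apply_symm_apply]) hb
    rcases zmod_two_eq p with rfl | rfl
    · rw [hb', if_pos rfl, AlgEquiv.symm_apply_apply]; exact h₀
    · rw [hb', if_neg one_ne_zero, AlgEquiv.symm_apply_apply]; exact h₁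

/-- An isomorphism of superalgebras from mutually inverse homomorphisms. -/
def SuperIso.ofAlgHom {A B : SuperAlg.{u} k} (f : A.carrier →ₐ[k] B.carrier)
    (g : B.carrier →ₐ[k] A.carrier) (h₁ : f.comp g = AlgHom.id k _)
    (h₂ : g.comp f = AlgHom.id k _) (hf : IsGraded A B.gr f) : SuperIso A B where
  toAlgEquiv := AlgEquiv.ofAlgHom f g h₁ h₂
  map_mem := fun _ _ h => hf h

end SuperCommute

/-! ### Universal property, associativity and unit of the super tensor product -/

section TensorLift

variable {k : Type u} [CommRing k] {A B : SuperAlg.{u} k} {C : Type u} [Ring C] [Algebra k C]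

theorem tmul_eq (a : A.carrier) (b : B.carrier) :
    (GradedTensorProduct.tmul k a b : GradedTensorProduct k A.gr B.gr) =
      (inl A B a * inr A B b : GradedTensorProduct k A.gr B.gr) :=
  (GradedTensorProduct.tmul_one_mul_one_tmul A.gr B.gr a b).symm

theorem superCommute_inl_inr : SuperCommute (inl A B) (inr A B) := by
  intro i j a b ha hb
  have h := GradedTensorProduct.tmul_coe_mul_coe_tmul A.gr B.gr 1 ⟨b, hb⟩ ⟨a, ha⟩ 1
  rw [one_mul, mul_one] at h
  -- The multiplication rule governs the product with `b` on the left; the opposite order follows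
  -- because the sign squares to one.
  have h' : inr A B b * inl A B a = sgn (i * j) • (inl A B a * inr A B b) := by
    rw [mul_comm i j]
    exact h.trans (congrArg (fun z => ((-1 : ℤˣ) ^ (j * i)) • z) (tmul_eq a b))
  rw [h', sgn_smul_smul]

/-- The homomorphism from a tensor product given by homomorphisms with supercommuting images. -/
def tensorLift (f : A.carrier →ₐ[k] C) (g : B.carrier →ₐ[k] C) (h : SuperCommute f g) :
    (tensor A B).carrier →ₐ[k] C :=
  GradedTensorProduct.lift A.gr B.gr f g fun i j a b => by
    rw [mul_comm j i]; exact h a.2 b.2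

@[simp]
theorem tensorLift_inl (f : A.carrier →ₐ[k] C) (g : B.carrier →ₐ[k] C) (h : SuperCommute f g)
    (a : A.carrier) : tensorLift f g h (inl A B a) = f a := by
  refine (GradedTensorProduct.lift_tmul A.gr B.gr f g _ a 1).trans ?_
  rw [map_one, mul_one]

@[simp]
theorem tensorLift_inr (f : A.carrier →ₐ[k] C) (g : B.carrier →ₐ[k] C) (h : SuperCommute f g)
    (b : B.carrier) : tensorLift f g h (inr A B b) = g b := by
  refine (GradedTensorProduct.lift_tmul A.gr B.gr f g _ 1 b).trans ?_
  rw [map_one, one_mul]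

theorem tensor_hom_ext {f g : (tensor A B).carrier →ₐ[k] C}
    (hl : f.comp (inl A B) = g.comp (inl A B)) (hr : f.comp (inr A B) = g.comp (inr A B)) :
    f = g :=
  GradedTensorProduct.algHom_ext A.gr B.gr hl hr

theorem tensor_gr_induction {p : ZMod 2} {P : (tensor A B).carrier → Prop}
    {z : (tensor A B).carrier} (hz : z ∈ (tensor A B).gr p) (zero : P 0) (add : ∀ x y, P x → P y → P (x + y)) (smul : ∀ (r : k) x, P x → P (r • x))
    (mul : ∀ i j, i + j = p → ∀ a ∈ A.gr i, ∀ b ∈ B.gr j, P (inl A B a * inr A B b)) :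
    P z := by
  have hz' : z ∈ tensorGr A B p := hz
  induction hz' using Submodule.span_induction with
  | zero => exact zero
  | add x y hx hy ihx ihy => exact add x y (ihx hx) (ihy hy)
  | smul r x hx ih => exact smul r x (ih hx)
  | mem x hx =>
    obtain ⟨i, j, a, b, hij, rfl⟩ := hx
    have := mul i j hij a a.2 b b.2
    rwa [← tmul_eq] at this

theorem isGraded_inl : IsGraded A (tensor A B).gr (inl A B) := by
  intro p a ha
  change inl A B a ∈ tensorGr A B p
  exact Submodule.subset_span ⟨p, 0, ⟨a, ha⟩, ⟨1, SetLike.GradedOne.one_mem⟩, add_zero p, rfl⟩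

theorem isGraded_inr : IsGraded B (tensor A B).gr (inr A B) := by
  intro p b hb
  change inr A B b ∈ tensorGr A B p
  exact Submodule.subset_span ⟨0, p, ⟨1, SetLike.GradedOne.one_mem⟩, ⟨b, hb⟩, zero_add p, rfl⟩

theorem isGraded_tensorLift {𝒞 : ZMod 2 → Submodule k C} [SetLike.GradedMul 𝒞]
    {f : A.carrier →ₐ[k] C} {g : B.carrier →ₐ[k] C} (h : SuperCommute f g)
    (hf : IsGraded A 𝒞 f) (hg : IsGraded B 𝒞 g) :
    IsGraded (tensor A B) 𝒞 (tensorLift f g h) := by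
  intro p z hz
  refine tensor_gr_induction (P := fun z => tensorLift f g h z ∈ 𝒞 p) hz ?_ ?_ ?_ ?_
  · rw [map_zero]; exact zero_mem _
  · intro x y hx hy; rw [map_add]; exact add_mem hx hy
  · intro r x hx; rw [map_smul]; exact Submodule.smul_mem _ _ hx
  · intro i j hij a ha b hb
    rw [map_mul, tensorLift_inl, tensorLift_inr, ← hij]
    exact SetLike.GradedMul.mul_mem (hf ha) (hg hb)

/-- Moving `g d` past `a ⊗ b` means moving it past `b` and then past `a`; the signs multiply
correctly because `(i + j) q = i q + j q`. -/
theorem SuperCommute.of_tensor {D : SuperAlg.{u} k} {f : (tensor A B).carrier →ₐ[k] C}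
    {g : D.carrier →ₐ[k] C} (hl : SuperCommute (f.comp (inl A B)) g)
    (hr : SuperCommute (f.comp (inr A B)) g) : SuperCommute f g := by
  intro p q z d hz hd
  refine tensor_gr_induction (P := fun z => f z * g d = sgn (p * q) • (g d * f z)) hz ?_ ?_ ?_ ?_
  · simp
  · intro x y hx hy; rw [map_add, add_mul, hx, hy, mul_add, smul_add]
  · intro r x hx; rw [map_smul, smul_mul_assoc, hx, mul_smul_comm]; exact (sgn_smul_comm _ r _).symm
  · intro i j hij a ha b hb
    have h₁ := hl ha hd
    have h₂ := hr hb hd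
    simp only [AlgHom.comp_apply] at h₁ h₂
    rw [map_mul, mul_assoc, h₂, mul_smul_comm, ← mul_assoc, h₁, smul_mul_assoc, mul_assoc,
      smul_smul, ← sgn_add, ← hij, add_mul, add_comm]

variable (A B) in
/-- The tensor product of superalgebras is associative. -/
def tensorAssoc (D : SuperAlg.{u} k) :
    SuperIso (tensor A (tensor B D)) (tensor (tensor A B) D) :=
  -- Both directions are glued from the inclusions of the three factors by two nested lifts; `h₁` to
  -- `h₄` are the supercommutations that these four lifts need.
  have h₁ : SuperCommute ((inl (tensor A B) D).comp (inr A B)) (inr (tensor A B) D) :=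
    superCommute_inl_inr.comp isGraded_inr (g' := AlgHom.id k _) fun _ _ h => h
  have h₂ : SuperCommute ((inl (tensor A B) D).comp (inl A B)) (tensorLift _ _ h₁) := by
    refine (SuperCommute.of_tensor ?_ ?_).symm
    · convert! (superCommute_inl_inr.map (inl (tensor A B) D)).symm using 1
      ext; simp
    · convert! (superCommute_inl_inr.comp isGraded_inl (g' := AlgHom.id k _)
        fun _ _ h => h).symm using 1
      ext; simp
  have h₃ : SuperCommute (inl A (tensor B D)) ((inr A (tensor B D)).comp (inl B D)) :=
    superCommute_inl_inr.comp (f' := AlgHom.id k _) (fun _ _ h => h) isGraded_inl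
  have h₄ : SuperCommute (tensorLift _ _ h₃) ((inr A (tensor B D)).comp (inr B D)) := by
    refine SuperCommute.of_tensor ?_ ?_
    · convert! superCommute_inl_inr.comp (f' := AlgHom.id k _) (fun _ _ h => h)
        isGraded_inr using 1
      ext; simp
    · convert! superCommute_inl_inr.map (inr A (tensor B D)) using 1
      ext; simp
  SuperIso.ofAlgHom (tensorLift _ _ h₂) (tensorLift _ _ h₄)
    (by
      refine tensor_hom_ext (tensor_hom_ext ?_ ?_) ?_ <;> ext <;> simp)
    (by
      refine tensor_hom_ext ?_ (tensor_hom_ext ?_ ?_) <;> ext <;> simp)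
    (isGraded_tensorLift _ (isGraded_inl.comp isGraded_inl)
      (isGraded_tensorLift _ (isGraded_inl.comp isGraded_inr) isGraded_inr))

variable (C) in
/-- The structure homomorphism of an algebra, as a homomorphism from the ground superalgebra. -/
def baseHom : (base k).carrier →ₐ[k] C := Algebra.ofId k C

theorem base_hom_ext (f g : (base k).carrier →ₐ[k] C) : f = g :=
  Subsingleton.elim (α := k →ₐ[k] C) f g

theorem mem_base_one {r : (base k).carrier} (hr : r ∈ (base k).gr 1) : r = 0 := by
  have hr' : (r : k) ∈ baseGr k 1 := hr
  rw [baseGr, if_neg one_ne_zero] at hr'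
  exact (Submodule.mem_bot k).1 hr'

/-- Scalars are even and central, so no sign can occur. This starts the inductions over tensor
powers. -/
theorem SuperCommute.of_base (f : (base k).carrier →ₐ[k] C) (g : A.carrier →ₐ[k] C) :
    SuperCommute f g := by
  intro i j r a hr _
  rcases zmod_two_eq i with rfl | rfl
  · rw [zero_mul, sgn_zero, one_smul, base_hom_ext f (baseHom C)]
    exact Algebra.commutes (A := C) (show k from r) (g a)
  · rw [mem_base_one hr, map_zero, zero_mul, mul_zero, smul_zero]

theorem isGraded_base (f : (base k).carrier →ₐ[k] A.carrier) : IsGraded (base k) A.gr f := by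
  intro p r hr
  rcases zmod_two_eq p with rfl | rfl
  · rw [base_hom_ext f (baseHom _)]
    exact SetLike.algebraMap_mem_graded A.gr (show k from r)
  · rw [mem_base_one hr, map_zero]
    exact zero_mem _

variable (A) in
/-- The ground ring is a unit for the tensor product. -/
def tensorBase : SuperIso (tensor A (base k)) A :=
  have h : SuperCommute (AlgHom.id k A.carrier) (baseHom A.carrier) :=
    (SuperCommute.of_base _ _).symm
  SuperIso.ofAlgHom (tensorLift _ _ h) (inl A (base k))
    (by ext a; exact tensorLift_inl _ _ h a)
    (by
      refine tensor_hom_ext ?_ (base_hom_ext _ _)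
      ext a
      exact congrArg (inl A (base k)) (tensorLift_inl _ _ h a))
    (isGraded_tensorLift _ (fun _ _ h => h) (isGraded_base _))

end TensorLift

/-! ### Homomorphisms from tensor powers -/

section TensorPow

variable {k : Type u} [CommRing k] {A : SuperAlg.{u} k} {C : Type u} [Ring C] [Algebra k C]

@[simp]
theorem place_last (n : ℕ) : place A (n + 1) (Fin.last n) = inl A (tensorPow A n) :=
  Fin.lastCases_last

@[simp]
theorem place_castSucc (n : ℕ) (i : Fin n) :
    place A (n + 1) i.castSucc = (inr A (tensorPow A n)).comp (place A n i) :=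
  Fin.lastCases_castSucc _

theorem isGraded_place (n : ℕ) (i : Fin n) : IsGraded A (tensorPow A n).gr (place A n i) := by
  induction n with
  | zero => exact i.elim0
  | succ n ih =>
    induction i using Fin.lastCases with
    | last => rw [place_last]; exact isGraded_inl
    | cast i => rw [place_castSucc]; exact isGraded_inr.comp (ih i)

theorem superCommute_place (n : ℕ) {i j : Fin n} (h : i ≠ j) :
    SuperCommute (place A n i) (place A n j) := by
  induction n with
  | zero => exact i.elim0
  | succ n ih =>
    have aux : ∀ i : Fin n, SuperCommute (place A (n + 1) (Fin.last n))
        (place A (n + 1) i.castSucc) := by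
      intro i
      rw [place_last, place_castSucc]
      exact superCommute_inl_inr.comp (f' := AlgHom.id k _) (fun _ _ h => h) (isGraded_place n i)
    induction i using Fin.lastCases with
    | last =>
      induction j using Fin.lastCases with
      | last => exact absurd rfl h
      | cast j => exact aux j
    | cast i =>
      induction j using Fin.lastCases with
      | last => exact (aux i).symm
      | cast j =>
        rw [place_castSucc, place_castSucc]
        exact (ih (by rintro rfl; exact h rfl)).map _

theorem tensorPow_hom_ext (n : ℕ) {f g : (tensorPow A n).carrier →ₐ[k] C}
    (h : ∀ i, f.comp (place A n i) = g.comp (place A n i)) : f = g := by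
  induction n with
  | zero => exact base_hom_ext f g
  | succ n ih =>
    refine tensor_hom_ext ?_ (ih fun i => ?_)
    · have := h (Fin.last n)
      rwa [place_last] at this
    · have := h i.castSucc
      rwa [place_castSucc] at this

theorem SuperCommute.of_tensorPow (n : ℕ) {D : SuperAlg.{u} k}
    {f : (tensorPow A n).carrier →ₐ[k] C} {g : D.carrier →ₐ[k] C}
    (h : ∀ i, SuperCommute (f.comp (place A n i)) g) : SuperCommute f g := by
  induction n with
  | zero => exact SuperCommute.of_base f g
  | succ n ih =>
    refine SuperCommute.of_tensor ?_ (ih fun i => ?_)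
    · have := h (Fin.last n)
      rwa [place_last] at this
    · have := h i.castSucc
      rwa [place_castSucc] at this

/-- Pairwise supercommuting homomorphisms define a homomorphism from the tensor power. -/
theorem exists_tensorPow_hom (n : ℕ) (f : Fin n → (A.carrier →ₐ[k] C))
    (h : ∀ i j, i ≠ j → SuperCommute (f i) (f j)) :
    ∃ F : (tensorPow A n).carrier →ₐ[k] C, ∀ i, F.comp (place A n i) = f i := by
  induction n with
  | zero => exact ⟨baseHom C, fun i => i.elim0⟩
  | succ n ih =>
    obtain ⟨G, hG⟩ := ih (fun i => f i.castSucc) fun i j hij =>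
      h _ _ fun e => hij (Fin.castSucc_injective n e)
    -- Supercommuting with the map on the remaining factors can be tested one factor at a time.
    have hc : SuperCommute (f (Fin.last n)) G := by
      refine (SuperCommute.of_tensorPow n fun i => ?_).symm
      rw [hG]
      exact h _ _ (Fin.castSucc_ne_last i)
    refine ⟨tensorLift _ _ hc, fun i => ?_⟩
    induction i using Fin.lastCases with
    | last => rw [place_last]; ext a; exact tensorLift_inl _ _ hc a
    | cast i =>
      rw [place_castSucc, ← hG i]
      ext a
      exact tensorLift_inr _ _ hc _

end TensorPow

/-! ### Homomorphisms from superalgebras given by generators and relations -/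

section PresentedHom

variable {k : Type u} [CommRing k] {X : Type u} {par : X → ZMod 2}
  {rel : FreeAlgebra k X → FreeAlgebra k X → Prop} {h : Homogeneous par rel}
  {C : Type u} [Ring C] [Algebra k C]

/-- A homomorphism from the free algebra that respects the relations descends to the superalgebra
with these relations. -/
def presentedLift (h : Homogeneous par rel) (F : FreeAlgebra k X →ₐ[k] C)
    (hF : ∀ a b, rel a b → F a = F b) : (presented par rel h).carrier →ₐ[k] C :=
  RingQuot.liftAlgHom k ⟨F, fun {a b} => hF a b⟩

@[simp]
theorem presentedLift_gen (F : FreeAlgebra k X →ₐ[k] C) (hF : ∀ a b, rel a b → F a = F b) (x : X) :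
    presentedLift h F hF (gen par rel h x) = F (FreeAlgebra.ι k x) :=
  RingQuot.liftAlgHom_mkAlgHom_apply k F (fun {a b} => hF a b) _

theorem presented_hom_ext {f g : (presented par rel h).carrier →ₐ[k] C}
    (hfg : ∀ x, f (gen par rel h x) = g (gen par rel h x)) : f = g := by
  refine RingQuot.ringQuot_ext' (s := rel) k f g ?_
  ext x
  exact hfg x

theorem presented_gr_induction {p : ZMod 2} {P : (presented par rel h).carrier → Prop}
    {z : (presented par rel h).carrier} (hz : z ∈ (presented par rel h).gr p)
    (zero : P 0) (add : ∀ x y, P x → P y → P (x + y)) (smul : ∀ (r : k) x, P x → P (r • x))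
    (word : ∀ l : List X, (l.map par).sum = p → P (l.map (gen par rel h)).prod) : P z := by
  obtain ⟨a, ha, rfl⟩ := (show z ∈ quotGr par rel p from hz)
  clear hz
  have ha' : a ∈ freeGr k par p := ha
  clear ha
  induction ha' using Submodule.span_induction with
  | zero => rw [map_zero]; exact zero
  | add x y hx hy ihx ihy => rw [map_add]; exact add _ _ ihx ihy
  | smul r x hx ih => rw [map_smul]; exact smul r _ ih
  | mem x hx =>
    obtain ⟨l, hl, rfl⟩ := hx
    have e : RingQuot.mkAlgHom k rel (l.map (FreeAlgebra.ι k)).prod =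
        (l.map (gen par rel h)).prod := by
      refine (map_list_prod (RingQuot.mkAlgHom k rel) _).trans ?_
      rw [List.map_map]
      rfl
    exact e ▸ word l hl

theorem gen_mem (x : X) : gen par rel h x ∈ (presented par rel h).gr (par x) :=
  (⟨FreeAlgebra.ι k x, ι_mem_freeGr par x, rfl⟩ : _ ∈ quotGr par rel (par x))

theorem isGraded_of_gen {𝒞 : ZMod 2 → Submodule k C} [SetLike.GradedMonoid 𝒞]
    {f : (presented par rel h).carrier →ₐ[k] C}
    (hf : ∀ x, f (gen par rel h x) ∈ 𝒞 (par x)) : IsGraded (presented par rel h) 𝒞 f := by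
  intro p z hz
  refine presented_gr_induction (P := fun z => f z ∈ 𝒞 p) hz ?_ ?_ ?_ ?_
  · rw [map_zero]; exact zero_mem _
  · intro x y hx hy; rw [map_add]; exact add_mem hx hy
  · intro r x hx; rw [map_smul]; exact Submodule.smul_mem _ _ hx
  · rintro l rfl
    clear hz
    induction l with
    | nil => simpa using SetLike.GradedOne.one_mem
    | cons x l ih =>
      simp only [List.map_cons, List.prod_cons, List.sum_cons, map_mul]
      refine SetLike.GradedMul.mul_mem (hf x) ih
/-- An element that commutes with the generators up to the sign of an odd element does so with
everything. -/
theorem supercommute_of_gen {f : (presented par rel h).carrier →ₐ[k] C} {c : C}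
    (hc : ∀ x, c * f (gen par rel h x) = sgn (par x) • (f (gen par rel h x) * c)) {p : ZMod 2}
    {z : (presented par rel h).carrier} (hz : z ∈ (presented par rel h).gr p) :
    c * f z = sgn p • (f z * c) := by
  refine presented_gr_induction (P := fun z => c * f z = sgn p • (f z * c)) hz ?_ ?_ ?_ ?_
  · simp
  · intro x y hx hy; rw [map_add, mul_add, hx, hy, add_mul, smul_add]
  · intro r x hx
    rw [map_smul, mul_smul_comm, hx, smul_mul_assoc]
    exact (sgn_smul_comm _ r _).symm
  · rintro l rfl
    clear hz
    induction l with
    | nil => simp [sgn_zero]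
    | cons x l ih =>
      simp only [List.map_cons, List.prod_cons, List.sum_cons, map_mul]
      rw [← mul_assoc, hc, smul_mul_assoc, mul_assoc, ih, mul_smul_comm, smul_smul, sgn_add,
        mul_assoc]

end PresentedHom

/-! ### Homomorphisms from the rank two Clifford superalgebra -/

section CliffordHom

variable {k : Type u} [CommRing k] {C : Type u} [Ring C] [Algebra k C]

/-- The homomorphism from the rank two Clifford superalgebra given by a square root of one. -/
def clHom (c : C) (hc : c * c = 1) : (Cl k).carrier →ₐ[k] C :=
  AddMonoidAlgebra.lift k C (ZMod 2)
    { toFun := fun p => if p.toAdd = 0 then 1 else c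
      map_one' := rfl
      map_mul' := by
        intro p q
        rcases zmod_two_eq p.toAdd with hp | hp <;> rcases zmod_two_eq q.toAdd with hq | hq <;>
          simp [toAdd_mul, hp, hq, hc, CharTwo.add_self_eq_zero] }

@[simp]
theorem clHom_clc (c : C) (hc : c * c = 1) : clHom (k := k) c hc (clc k : (Cl k).carrier) = c := by
  refine (AddMonoidAlgebra.lift_single _ _ _).trans ?_
  rw [one_smul]
  rfl

/-- Together with `cl_odd`: both parity parts have rank one, so any linear condition on tokens with
arbitrary labels needs checking only at `1` and `c`. -/
theorem cl_even {a : (Cl k).carrier} (ha : a ∈ (Cl k).gr 0) : ∃ r : k, a = r • 1 := by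
  obtain ⟨r, rfl⟩ := (AddMonoidAlgebra.mem_grade_iff' k 0 a).1 ha
  refine ⟨r, Eq.symm ?_⟩
  refine (congrArg (r • ·) (AddMonoidAlgebra.one_def (R := k) (M := ZMod 2))).trans ?_
  refine (AddMonoidAlgebra.smul_single r _ _).trans ?_
  rw [smul_eq_mul, mul_one]
  rfl

theorem cl_odd {a : (Cl k).carrier} (ha : a ∈ (Cl k).gr 1) :
    ∃ r : k, a = r • (clc k : (Cl k).carrier) := by
  obtain ⟨r, rfl⟩ := (AddMonoidAlgebra.mem_grade_iff' k 1 a).1 ha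
  refine ⟨r, Eq.symm ?_⟩
  refine (AddMonoidAlgebra.smul_single r _ _).trans ?_
  rw [smul_eq_mul, mul_one]
  rfl

theorem clc_mul_clc : (clc k : (Cl k).carrier) * (clc k : (Cl k).carrier) = 1 := by
  refine (AddMonoidAlgebra.single_mul_single _ _ _ _).trans ?_
  rw [one_mul, show (1 : ZMod 2) + 1 = 0 from rfl]
  rfl

theorem cl_hom_ext {f g : (Cl k).carrier →ₐ[k] C} (h : f (clc k) = g (clc k)) : f = g := by
  ext a
  induction a using (Cl k).homogeneous_induction with
  | hom p a ha =>
    rcases zmod_two_eq p with rfl | rfl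
    · obtain ⟨r, rfl⟩ := cl_even ha
      simp
    · obtain ⟨r, rfl⟩ := cl_odd ha
      rw [map_smul, map_smul, h]
  | add a b ha hb => rw [map_add, map_add, ha, hb]

theorem isGraded_cl {𝒞 : ZMod 2 → Submodule k C} [SetLike.GradedMonoid 𝒞]
    {f : (Cl k).carrier →ₐ[k] C} (hf : f (clc k) ∈ 𝒞 1) : IsGraded (Cl k) 𝒞 f := by
  intro p a ha
  rcases zmod_two_eq p with rfl | rfl
  · obtain ⟨r, rfl⟩ := cl_even ha
    rw [map_smul, map_one]
    exact Submodule.smul_mem _ _ SetLike.GradedOne.one_mem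
  · obtain ⟨r, rfl⟩ := cl_odd ha
    rw [map_smul]
    exact Submodule.smul_mem _ _ hf

theorem SuperCommute.of_cl {B : SuperAlg.{u} k} {f : (Cl k).carrier →ₐ[k] C}
    {g : B.carrier →ₐ[k] C}
    (h : ∀ j, ∀ b ∈ B.gr j, f (clc k) * g b = sgn j • (g b * f (clc k))) : SuperCommute f g := by
  intro i j a b ha hb
  rcases zmod_two_eq i with rfl | rfl
  · obtain ⟨r, rfl⟩ := cl_even ha
    simp [sgn_zero]
  · obtain ⟨r, rfl⟩ := cl_odd ha
    rw [map_smul, smul_mul_assoc, h j b hb, mul_smul_comm, one_mul]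
    exact (sgn_smul_comm _ r _).symm

theorem superCommute_cl {f g : (Cl k).carrier →ₐ[k] C}
    (h : f (clc k) * g (clc k) = -(g (clc k) * f (clc k))) : SuperCommute f g := by
  refine SuperCommute.of_cl fun j b hb => ?_
  rcases zmod_two_eq j with rfl | rfl
  · obtain ⟨r, rfl⟩ := cl_even hb
    simp [sgn_zero]
  · obtain ⟨r, rfl⟩ := cl_odd hb
    rw [sgn_one_smul, map_smul, mul_smul_comm, h, smul_mul_assoc, smul_neg]

/-- Both sides are linear in `a` and agree at `1` and `c`. This supplies the relations between
crossings and tokens with arbitrary labels. -/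
theorem cl_intertwine {f g : (Cl k).carrier →ₐ[k] C} {x : C}
    (h : x * f (clc k) = g (clc k) * x) (a : (Cl k).carrier) : x * f a = g a * x := by
  induction a using (Cl k).homogeneous_induction with
  | hom p a ha =>
    rcases zmod_two_eq p with rfl | rfl
    · obtain ⟨r, rfl⟩ := cl_even ha
      simp
    · obtain ⟨r, rfl⟩ := cl_odd ha
      rw [map_smul, map_smul, mul_smul_comm, h, smul_mul_assoc]
  | add a b ha hb => rw [map_add, map_add, mul_add, ha, hb, add_mul]

end CliffordHom

/-! ### The substitutions `u = d v` and `v = d u / 2` on families of elements -/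

section Families

variable {R : Type u} [Ring R] {n : ℕ}

/-- Pairwise anticommuting square roots of one. -/
structure IsCliffordFamily (c : Fin n → R) : Prop where
  sq : ∀ i, c i * c i = 1
  anti : ∀ i j, i ≠ j → c i * c j = -(c j * c i)

/-- The relations of the Clifford nilCoxeter algebra. -/
structure IsNilCoxeterFamily (c : Fin n → R) (u : Fin (n - 1) → R) : Prop
    extends IsCliffordFamily c where
  u_sq : ∀ i, u i * u i = 0
  u_comm : ∀ i j : Fin (n - 1), (i : ℕ) + 1 < j → u i * u j = u j * u i
  u_braid : ∀ i j : Fin (n - 1), (i : ℕ) + 1 = j → u i * u j * u i = u j * u i * u j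
  u_lo : ∀ i, u i * c (lo i) = c (hi i) * u i
  u_hi : ∀ i, u i * c (hi i) = c (lo i) * u i
  u_far : ∀ i j, j ≠ lo i → j ≠ hi i → u i * c j = c j * u i

/-- The relations of the Clifford nilHecke algebra. -/
structure IsNilHeckeFamily (c : Fin n → R) (u : Fin (n - 1) → R) (x : Fin n → R) : Prop
    extends IsNilCoxeterFamily c u where
  x_anti : ∀ i j, i ≠ j → x i * x j = -(x j * x i)
  c_x : ∀ i j, c j * x i = -(x i * c j)
  x_far : ∀ i j, j ≠ lo i → j ≠ hi i → x j * u i = u i * x j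
  u_x : ∀ i, u i * x (hi i) = x (lo i) * u i + (c (lo i) - c (hi i))
  x_u : ∀ i, x (hi i) * u i = u i * x (lo i) - (c (lo i) - c (hi i))

/-- The relations of the tensor product of the odd nilCoxeter algebra and a Clifford
superalgebra. -/
structure IsOddNilCoxeterFamily (c : Fin n → R) (v : Fin (n - 1) → R) : Prop
    extends IsCliffordFamily c where
  v_rel : ∀ a b, OddNilCoxeterRel v a b → a = b
  c_v : ∀ i j, c j * v i = -(v i * c j)

/-- The relations of the tensor product of the odd nilHecke algebra and a Clifford
superalgebra. -/
structure IsOddNilHeckeFamily (c : Fin n → R) (v : Fin (n - 1) → R) (y : Fin n → R) : Prop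
    extends IsOddNilCoxeterFamily c v where
  y_anti : ∀ i j, i ≠ j → y i * y j = -(y j * y i)
  c_y : ∀ i j, c j * y i = -(y i * c j)
  y_far : ∀ i j, j ≠ lo i → j ≠ hi i → y j * v i = -(v i * y j)
  v_y : ∀ i, v i * y (hi i) + y (lo i) * v i = 1
  y_v : ∀ i, y (hi i) * v i + v i * y (lo i) = 1

/-- A relation in the form needed for rewriting inside longer products that are associated to the
right. -/
theorem mul_eq_assoc {a b c : R} (h : a * b = c) (z : R) : a * (b * z) = c * z := by
  rw [← mul_assoc, h]

theorem lo_ne_hi (i : Fin (n - 1)) : lo i ≠ hi i := by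
  simp [lo, hi, Fin.ext_iff]

namespace IsCliffordFamily

variable {c : Fin n → R}

/-- The mixed terms cancel and the squares contribute `1 + 1`. Hence `d / 2` is inverse to `d` once
`2` is invertible. -/
theorem sub_mul_sub (hc : IsCliffordFamily c) {i j : Fin n} (hij : i ≠ j) :
    (c i - c j) * (c i - c j) = 2 := by
  simp only [mul_sub, sub_mul, hc.sq, hc.anti j i hij.symm]
  rw [← one_add_one_eq_two]
  abel

/-- With `a = c i - c j` and `b = c j - c l` one has `a ^ 2 = b ^ 2 = 2` and `a b + b a = -2`, so
both sides equal `-2 (a + b)`. Here this is checked by expanding and sorting the monomials. -/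
theorem sub_braid (hc : IsCliffordFamily c) {i j l : Fin n} (hij : i ≠ j) (hil : i ≠ l)
    (hjl : j ≠ l) : (c i - c j) * (c j - c l) * (c i - c j) =
      (c j - c l) * (c i - c j) * (c j - c l) := by
  simp only [mul_sub, sub_mul, mul_assoc, hc.sq, hc.anti j i hij.symm, hc.anti l i hil.symm,
    hc.anti l j hjl.symm, mul_eq_assoc (hc.sq _), mul_neg, neg_mul,
    mul_eq_assoc (hc.anti j i hij.symm), one_mul, mul_one]
  abel

theorem sub_anti (hc : IsCliffordFamily c) {i j l m : Fin n} (hil : i ≠ l) (him : i ≠ m)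
    (hjl : j ≠ l) (hjm : j ≠ m) :
    (c i - c j) * (c l - c m) = -((c l - c m) * (c i - c j)) := by
  simp only [mul_sub, sub_mul, hc.anti i l hil, hc.anti i m him, hc.anti j l hjl, hc.anti j m hjm]
  abel

end IsCliffordFamily

theorem sub_mul_anti {a b v : R} (ha : a * v = -(v * a)) (hb : b * v = -(v * b)) :
    v * (a - b) = -((a - b) * v) := by
  rw [mul_sub, sub_mul, ha, hb]
  abel

/-- Each relation is a cancellation of signs between `d` and `v`. For distant crossings the `d`
anticommute and so do the `v`. Moving `c_j` past `v_i` costs a sign, and moving it past `d_i` costs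
another while exchanging `c_i` and `c_{i+1}`. -/
theorem IsOddNilCoxeterFamily.toNilCoxeter {c : Fin n → R} {v : Fin (n - 1) → R}
    (h : IsOddNilCoxeterFamily c v) :
    IsNilCoxeterFamily c fun i => (c (lo i) - c (hi i)) * v i := by
  have hvd : ∀ i j, v i * (c (lo j) - c (hi j)) = -((c (lo j) - c (hi j)) * v i) :=
    fun i j => sub_mul_anti (h.c_v _ _) (h.c_v _ _)
  refine { h.toIsCliffordFamily with
    u_sq := ?_, u_comm := ?_, u_braid := ?_, u_lo := ?_, u_hi := ?_, u_far := ?_ }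
  · intro i
    rw [mul_assoc, mul_eq_assoc (hvd i i), neg_mul, mul_assoc, h.v_rel _ _ (.sq i)]
    simp
  · intro i j hij
    have hd := h.sub_anti (i := lo i) (j := hi i) (l := lo j) (m := hi j)
      (by simp [lo, Fin.ext_iff]; omega) (by simp [lo, hi, Fin.ext_iff]; omega)
      (by simp [lo, hi, Fin.ext_iff]; omega) (by simp [hi, Fin.ext_iff]; omega)
    rw [mul_assoc, mul_eq_assoc (hvd i j), mul_assoc (_ - _) (v j), mul_eq_assoc (hvd j i),
      neg_mul, neg_mul, mul_assoc, mul_assoc, h.v_rel _ _ (.anticomm i j hij)]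
    simp only [mul_neg, neg_neg, mul_assoc, mul_eq_assoc hd, neg_mul]
  · intro i j hij
    have hd := h.sub_braid (i := lo i) (j := hi i) (l := hi j)
      (by simp [lo, hi, Fin.ext_iff]) (by simp [lo, hi, Fin.ext_iff]; omega)
      (by simp [hi, Fin.ext_iff]; omega)
    -- The middle strand of the braid has two names, which have to be identified before the
    -- relations match.
    have e : hi i = lo j := by simp [lo, hi, Fin.ext_iff]; omega
    rw [e] at hd
    have hvi := hvd i i
    have hji := hvd j i
    rw [e] at hvi hji
    rw [e]
    -- All `d` move to the left. Each side picks up three signs, so the braid relations of the `v`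
    -- and of the `d` can be applied separately.
    simp only [mul_assoc, mul_eq_assoc (hvd _ j), mul_eq_assoc hvi, mul_eq_assoc hji, neg_mul,
      mul_neg, neg_neg]
    have hb := h.v_rel _ _ (.braid i j hij)
    simp only [mul_assoc] at hb hd
    rw [hb]
    simp only [← mul_assoc] at hd ⊢
    rw [hd]
  · intro i
    have hl := neg_eq_iff_eq_neg.2 (h.c_v i (lo i))
    rw [mul_assoc, ← hl, mul_neg, ← mul_assoc, ← mul_assoc, sub_mul, mul_sub, h.sq, h.sq, ← neg_mul,
      neg_sub]
  · intro i
    have hl := neg_eq_iff_eq_neg.2 (h.c_v i (hi i))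
    rw [mul_assoc, ← hl, mul_neg, ← mul_assoc, ← mul_assoc, sub_mul, mul_sub, h.sq, h.sq, ← neg_mul,
      neg_sub]
  · intro i j hl hh
    have hj := neg_eq_iff_eq_neg.2 (h.c_v i j)
    rw [mul_assoc, ← hj, mul_neg, ← mul_assoc, ← mul_assoc, ← neg_mul, sub_mul, mul_sub,
      h.anti j _ hl, h.anti j _ hh]
    congr 1
    abel

/-- The dots anticommute with `d_i`, so `d_i v_i y_{i+1} = d_i (1 - y_i v_i) = d_i + y_i d_i v_i`;
the other mixed relation is similar. For distant dots two signs cancel. -/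
theorem IsOddNilHeckeFamily.toNilHecke {c : Fin n → R} {v : Fin (n - 1) → R} {y : Fin n → R}
    (h : IsOddNilHeckeFamily c v y) :
    IsNilHeckeFamily c (fun i => (c (lo i) - c (hi i)) * v i) y := by
  have hyd : ∀ i j, y i * (c (lo j) - c (hi j)) = -((c (lo j) - c (hi j)) * y i) :=
    fun i j => sub_mul_anti (h.c_y _ _) (h.c_y _ _)
  refine { h.toIsOddNilCoxeterFamily.toNilCoxeter with
    x_anti := h.y_anti, c_x := h.c_y, x_far := ?_, u_x := ?_, x_u := ?_ }
  · intro i j hl hh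
    rw [mul_eq_assoc (hyd j i), neg_mul, mul_assoc, h.y_far i j hl hh, mul_assoc]
    simp
  · intro i
    rw [mul_assoc, eq_sub_of_add_eq (h.v_y i), mul_eq_assoc (hyd _ i), mul_sub, mul_one, neg_mul,
      mul_assoc]
    abel
  · intro i
    rw [mul_eq_assoc (hyd _ i), neg_mul, mul_assoc, eq_sub_of_add_eq (h.y_v i), mul_sub, mul_one,
      mul_assoc]
    abel

variable {k : Type u} [CommRing k] [Algebra k R] [Invertible (2 : k)]

/-- Since `u_i` exchanges `c_i` and `c_{i+1}`, it anticommutes with `d_i`; it commutes with `d_j`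
for distant `j`. So the sign in the relation for distant crossings comes from the `d` alone, and
`d_i u_i` anticommutes with every `c_j`. -/
theorem IsNilCoxeterFamily.toOddNilCoxeter {c : Fin n → R} {u : Fin (n - 1) → R}
    (h : IsNilCoxeterFamily c u) :
    IsOddNilCoxeterFamily c fun i => (⅟2 : k) • ((c (lo i) - c (hi i)) * u i) := by
  have hud : ∀ i, u i * (c (lo i) - c (hi i)) = -((c (lo i) - c (hi i)) * u i) := by
    intro i
    rw [mul_sub, sub_mul, h.u_lo, h.u_hi]
    abel
  have hfar : ∀ i j : Fin (n - 1), ((i : ℕ) + 1 < j ∨ (j : ℕ) + 1 < i) →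
      u i * (c (lo j) - c (hi j)) = (c (lo j) - c (hi j)) * u i := by
    intro i j hij
    rw [mul_sub, sub_mul, h.u_far i _ (by simp [lo, Fin.ext_iff]; omega)
      (by simp [lo, hi, Fin.ext_iff]; omega), h.u_far i _ (by simp [lo, hi, Fin.ext_iff]; omega)
      (by simp [hi, Fin.ext_iff]; omega)]
  refine { h.toIsCliffordFamily with v_rel := ?_, c_v := ?_ }
  · rintro _ _ (i | ⟨i, j, hij⟩ | ⟨i, j, hij⟩)
    · rw [smul_mul_assoc, mul_smul_comm, mul_assoc, mul_eq_assoc (hud i), neg_mul, mul_assoc,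
        h.u_sq]
      simp
    · have hd := h.sub_anti (i := lo i) (j := hi i) (l := lo j) (m := hi j)
        (by simp [lo, Fin.ext_iff]; omega) (by simp [lo, hi, Fin.ext_iff]; omega)
        (by simp [lo, hi, Fin.ext_iff]; omega) (by simp [hi, Fin.ext_iff]; omega)
      simp only [smul_mul_assoc, mul_smul_comm, ← smul_neg]
      congr 2
      rw [mul_assoc, mul_eq_assoc (hfar i j (Or.inl hij)), mul_assoc, h.u_comm i j hij,
        ← mul_assoc, hd, mul_assoc, mul_eq_assoc (hfar j i (Or.inr hij))]
      simp [mul_assoc]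
    · have e : hi i = lo j := by simp [lo, hi, Fin.ext_iff]; omega
      have hab : lo i ≠ lo j := by simp [lo, Fin.ext_iff]; omega
      have hac : lo i ≠ hi j := by simp [lo, hi, Fin.ext_iff]; omega
      have hbc : lo j ≠ hi j := lo_ne_hi j
      -- The letters `a`, `b`, `c` stand for the strands `lo i`, `lo j = hi i` and `hi j`. The rules
      -- `ia` to `jc` move a Clifford generator to the left of a crossing, and `ba`, `ca`, `cb` sort
      -- the generators.
      have ia := h.u_lo i
      have ib := h.u_hi i
      have ic := h.u_far i (hi j) hac.symm (by rw [e]; exact hbc.symm)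
      have ja := h.u_far j (lo i) hab hac
      have jb := h.u_lo j
      have jc := h.u_hi j
      have hb := h.u_braid i j hij
      have ba := h.anti _ _ hab.symm
      have ca := h.anti _ _ hac.symm
      have cb := h.anti _ _ hbc.symm
      rw [e] at ia ib ⊢
      simp only [smul_mul_assoc, mul_smul_comm]
      congr 3
      -- After this every term is a sorted Clifford word times one of the two sides of the braid
      -- relation for `u`.
      simp only [mul_sub, sub_mul, mul_assoc, mul_eq_assoc ia, mul_eq_assoc ib, mul_eq_assoc ic,
        mul_eq_assoc ja, mul_eq_assoc jb, mul_eq_assoc jc, mul_eq_assoc ba, mul_eq_assoc ca,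
        mul_eq_assoc cb, mul_neg, neg_mul, mul_eq_assoc (h.sq _), one_mul]
      simp only [mul_assoc] at hb
      rw [hb]
      abel
  · intro i j
    rw [mul_smul_comm, smul_mul_assoc, ← smul_neg]
    congr 1
    by_cases hl : j = lo i
    · subst hl
      rw [mul_assoc, h.u_lo]
      simp only [mul_sub, sub_mul, mul_eq_assoc (h.sq _), one_mul]
      abel
    by_cases hh : j = hi i
    · subst hh
      rw [mul_assoc, h.u_hi]
      simp only [mul_sub, sub_mul, mul_eq_assoc (h.sq _), one_mul]
      abel
    rw [mul_assoc, h.u_far i j hl hh]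
    simp only [mul_sub, sub_mul, mul_eq_assoc (h.anti j _ hl), mul_eq_assoc (h.anti j _ hh),
      neg_mul, mul_assoc]
    abel

theorem invOf_two_smul_two : (⅟2 : k) • (2 : R) = 1 := by
  rw [show (2 : R) = 1 + 1 from one_add_one_eq_two.symm, smul_add, ← add_smul, invOf_two_add_invOf_two, one_smul]

/-- As `x_i` anticommutes with `d_i`, the sum `v_i x_{i+1} + x_i v_i` is `(1/2) d_i (u_i x_{i+1} -
x_i u_i) = (1/2) d_i ^ 2 = 1`, and likewise for the other mixed relation. -/
theorem IsNilHeckeFamily.toOddNilHecke {c : Fin n → R} {u : Fin (n - 1) → R} {x : Fin n → R}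
    (h : IsNilHeckeFamily c u x) :
    IsOddNilHeckeFamily c (fun i => (⅟2 : k) • ((c (lo i) - c (hi i)) * u i)) x := by
  have hxd : ∀ i j, x i * (c (lo j) - c (hi j)) = -((c (lo j) - c (hi j)) * x i) :=
    fun i j => sub_mul_anti (h.c_x _ _) (h.c_x _ _)
  refine { h.toIsNilCoxeterFamily.toOddNilCoxeter (k := k) with
    y_anti := h.x_anti, c_y := h.c_x, y_far := ?_, v_y := ?_, y_v := ?_ }
  · intro i j hl hh
    rw [mul_smul_comm, smul_mul_assoc, ← smul_neg, mul_eq_assoc (hxd j i), neg_mul, mul_assoc,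
      h.x_far i j hl hh, mul_assoc]
  · intro i
    rw [mul_smul_comm, smul_mul_assoc, ← smul_add, mul_eq_assoc (hxd _ i), mul_assoc, h.u_x,
      mul_add, h.sub_mul_sub (lo_ne_hi i), neg_mul, mul_assoc, add_right_comm, add_neg_cancel,
      zero_add, invOf_two_smul_two]
  · intro i
    rw [mul_smul_comm, smul_mul_assoc, ← smul_add, mul_eq_assoc (hxd _ i), neg_mul, mul_assoc,
      h.x_u, mul_sub, h.sub_mul_sub (lo_ne_hi i), neg_sub, mul_assoc, sub_add_cancel,
      invOf_two_smul_two]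

end Families

/-! ### Universal properties of the nilCoxeter and nilHecke algebras -/

section NilHom

variable {k : Type u} [CommRing k] {R : Type u} [Ring R] [Algebra k R] {n : ℕ}

/-- The images of the generators of the Clifford nilCoxeter algebra. -/
def ncVal (k : Type u) [CommRing k] [Algebra k R] {c : Fin n → R} {u : Fin (n - 1) → R}
    (h : IsNilCoxeterFamily c u) : NCGen (Cl k) n → R
  | .tok _ a i => clHom (k := k) (c i) (h.sq i) (a : (Cl k).carrier)
  | .cross i => u i

theorem ncVal_rel {c : Fin n → R} {u : Fin (n - 1) → R} (h : IsNilCoxeterFamily c u)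
    (a b : FreeAlgebra k (NCGen (Cl k) n)) (hab : NCRel (Cl k) n a b) :
    FreeAlgebra.lift k (ncVal k h) a = FreeAlgebra.lift k (ncVal k h) b := by
  have e : ∀ (p : ZMod 2) (a : (Cl k).gr p) (i : Fin n),
      FreeAlgebra.lift k (ncVal k h) (ftok a i) =
        clHom (k := k) (c i) (h.sq i) (a : (Cl k).carrier) :=
    fun p a i => FreeAlgebra.lift_ι_apply _ _
  have e' : ∀ i, FreeAlgebra.lift k (ncVal k h) (fcross (Cl k) i) = u i :=
    fun i => FreeAlgebra.lift_ι_apply _ _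
  cases hab with
  | tok_one i => rw [e]; exact (map_one (clHom (c i) (h.sq i))).trans (map_one _).symm
  | tok_add a b i => rw [map_add, e, e, e]; exact map_add _ _ _
  | tok_smul r a i => rw [map_smul, e, e]; exact map_smul _ _ _
  | tok_mul a b i => rw [map_mul, e, e, e]; exact (map_mul _ _ _).symm
  | tok_comm a b i j hij =>
    rw [map_mul, map_sgn_smul, map_mul, e, e]
    exact superCommute_cl (by rw [clHom_clc, clHom_clc]; exact h.anti i j hij) a.2 b.2
  | cross_sq i => rw [map_mul, map_zero, e', h.u_sq]
  | cross_comm i j hij => rw [map_mul, map_mul, e', e', h.u_comm i j hij]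
  | braid i j hij => simp only [map_mul, e', h.u_braid i j hij]
  | cross_tok_lo i a =>
    rw [map_mul, map_mul, e, e, e']
    exact cl_intertwine (by rw [clHom_clc, clHom_clc]; exact h.u_lo i) _
  | cross_tok_hi i a =>
    rw [map_mul, map_mul, e, e, e']
    exact cl_intertwine (by rw [clHom_clc, clHom_clc]; exact h.u_hi i) _
  | cross_tok_far i a j hl hh =>
    rw [map_mul, map_mul, e, e']
    exact cl_intertwine (by rw [clHom_clc]; exact h.u_far i j hl hh) _

/-- The homomorphism from the Clifford nilCoxeter algebra given by elements that satisfy its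
relations. -/
def ncHom (k : Type u) [CommRing k] [Algebra k R] {c : Fin n → R} {u : Fin (n - 1) → R}
    (h : IsNilCoxeterFamily c u) : (NC (Cl k) n).carrier →ₐ[k] R :=
  presentedLift (ncRel_homogeneous (Cl k) n) (FreeAlgebra.lift k (ncVal k h)) (ncVal_rel h)

theorem ncHom_tok {c : Fin n → R} {u : Fin (n - 1) → R} (h : IsNilCoxeterFamily c u)
    {p : ZMod 2} (a : (Cl k).gr p) (i : Fin n) :
    ncHom k h (gen _ _ _ (.tok p a i)) = clHom (c i) (h.sq i) (a : (Cl k).carrier) :=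
  (presentedLift_gen _ _ _).trans (FreeAlgebra.lift_ι_apply _ _)

@[simp]
theorem ncHom_ncC {c : Fin n → R} {u : Fin (n - 1) → R} (h : IsNilCoxeterFamily c u)
    (i : Fin n) : ncHom k h (ncC k i) = c i :=
  (ncHom_tok h _ i).trans (clHom_clc _ _)

@[simp]
theorem ncHom_ncU {c : Fin n → R} {u : Fin (n - 1) → R} (h : IsNilCoxeterFamily c u)
    (i : Fin (n - 1)) : ncHom k h (ncU k i) = u i :=
  (presentedLift_gen _ _ _).trans (FreeAlgebra.lift_ι_apply _ _)

theorem gen_rel {X : Type u} {par : X → ZMod 2} {rel : FreeAlgebra k X → FreeAlgebra k X → Prop}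
    (h : Homogeneous par rel) {a b : FreeAlgebra k X} (hab : rel a b) :
    (RingQuot.mkAlgHom k rel a : (presented par rel h).carrier) = RingQuot.mkAlgHom k rel b :=
  RingQuot.mkAlgHom_rel k hab

/-- Tokens are linear in the label and unital, and the parity parts of the Clifford superalgebra
have rank one. So the `c_i` and `u_i` generate the algebra, although the presentation has a token
for every homogeneous label. -/
theorem nc_tok (a : ZMod 2) (x : (Cl k).gr a) (i : Fin n) :
    ∃ r : k, (gen _ _ _ (.tok a x i) : (NC (Cl k) n).carrier) =
      r • if a = 0 then 1 else ncC k i := by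
  have hs := fun (p : ZMod 2) (r : k) (x : (Cl k).gr p) =>
    gen_rel (ncRel_homogeneous (Cl k) n) (NCRel.tok_smul r x i)
  have h1 := gen_rel (ncRel_homogeneous (Cl k) n) (NCRel.tok_one i)
  simp only [map_smul, map_one] at hs h1
  rcases zmod_two_eq a with rfl | rfl
  · obtain ⟨r, hr⟩ := cl_even x.2
    refine ⟨r, ?_⟩
    obtain rfl : x = r • ⟨1, SetLike.GradedOne.one_mem⟩ := Subtype.ext hr
    refine (hs 0 r _).trans ?_
    rw [h1, if_pos rfl]
    rfl
  · obtain ⟨r, hr⟩ := cl_odd x.2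
    refine ⟨r, ?_⟩
    obtain rfl : x = r • clc k := Subtype.ext hr
    refine (hs 1 r _).trans ?_
    rw [if_neg one_ne_zero]
    rfl

theorem nc_hom_ext {f g : (NC (Cl k) n).carrier →ₐ[k] R}
    (hc : ∀ i, f (ncC k i) = g (ncC k i)) (hu : ∀ i, f (ncU k i) = g (ncU k i)) : f = g := by
  refine presented_hom_ext fun x => ?_
  cases x with
  | tok p a i =>
    obtain ⟨r, hr⟩ := nc_tok p a i
    refine (congrArg f hr).trans (Eq.trans ?_ (congrArg g hr).symm)
    rw [map_smul, map_smul]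
    split_ifs
    · rw [map_one, map_one]
    · rw [hc]
  | cross i => exact hu i

variable (k n) in
theorem isNilCoxeterFamily_nc : IsNilCoxeterFamily (ncC k (n := n)) (ncU k) := by
  have hr := fun a b => gen_rel (ncRel_homogeneous (Cl k) n) (a := a) (b := b)
  refine {
    sq := ?_, anti := ?_, u_sq := ?_, u_comm := ?_, u_braid := ?_, u_lo := ?_, u_hi := ?_,
    u_far := ?_ }
  · intro i
    have h := hr _ _ (.tok_mul (clc k) (clc k) i)
    have h1 := hr _ _ (.tok_one i)
    rw [map_mul] at h
    refine h.trans (Eq.trans ?_ (h1.trans (map_one _)))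
    congr 2
    exact Subtype.ext clc_mul_clc
  · intro i j hij
    have h := hr _ _ (.tok_comm (clc k) (clc k) i j hij)
    rw [map_sgn_smul, mul_one, sgn_one_smul, map_mul, map_mul] at h
    exact h
  · intro i
    have h := hr _ _ (.cross_sq i)
    rw [map_mul, map_zero] at h
    exact h
  · intro i j hij
    have h := hr _ _ (.cross_comm i j hij)
    rw [map_mul, map_mul] at h
    exact h
  · intro i j hij
    have h := hr _ _ (.braid i j hij)
    simp only [map_mul] at h
    exact h
  · intro i
    have h := hr _ _ (.cross_tok_lo i (clc k))
    rw [map_mul, map_mul] at h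
    exact h
  · intro i
    have h := hr _ _ (.cross_tok_hi i (clc k))
    rw [map_mul, map_mul] at h
    exact h
  · intro i j hl hh
    have h := hr _ _ (.cross_tok_far i (clc k) j hl hh)
    rw [map_mul, map_mul] at h
    exact h

theorem isGraded_nc {B : SuperAlg.{u} k}
    {f : (NC (Cl k) n).carrier →ₐ[k] B.carrier} (hc : ∀ i, f (ncC k i) ∈ B.gr 1)
    (hu : ∀ i, f (ncU k i) ∈ B.gr 0) : IsGraded (NC (Cl k) n) B.gr f := by
  refine isGraded_of_gen fun x => ?_
  cases x with
  | tok p a i =>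
    obtain ⟨r, hr⟩ := nc_tok p a i
    have e := congrArg f hr
    rw [map_smul] at e
    refine (e ▸ Submodule.smul_mem _ r ?_ : f _ ∈ B.gr p)
    split_ifs with hp
    · subst hp; rw [map_one]; exact SetLike.GradedOne.one_mem
    · obtain rfl := (zmod_two_eq p).resolve_left hp
      exact hc i
  | cross i => exact hu i

/-! ### The nilHecke algebra -/

/-- The parity is part of the type of a label; this identifies tokens whose parities are written
differently, such as `1 + 1` and `0`. -/
theorem htok_congr {A : SuperAlg.{u} k} {p q : ZMod 2} {a : A.gr p} {b : A.gr q} (hpq : p = q)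
    (hab : (a : A.carrier) = b) (i : Fin n) : htok a i = htok b i := by
  subst hpq
  rw [Subtype.ext hab]

/-- The basis is `1, c` with dual basis `c, 1`, and the odd trace puts a minus sign on the term of
`c`. Once the unit tokens become `1`, this is `c_i - c_{i+1}`. -/
theorem hteleport_clFrobenius (i : Fin (n - 1)) :
    hteleport (clFrobenius k) i =
      htok (⟨1, SetLike.GradedOne.one_mem⟩ : (Cl k).gr 0) (hi i) * htok (clc k) (lo i) -
        htok (clc k) (hi i) * htok (⟨1, SetLike.GradedOne.one_mem⟩ : (Cl k).gr 0) (lo i) := by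
  refine (Fin.sum_univ_two (M := FreeAlgebra k (NHGen (Cl k) n)) _).trans ?_
  refine (congrArg₂ (· + ·) (one_smul ℤˣ _) (sgn_one_smul _)).trans ?_
  rw [← sub_eq_add_neg]
  have h0 : (clFrobenius k).basis (0 : ZMod 2) = 1 := (AddMonoidAlgebra.one_def).symm
  have h1 : (clFrobenius k).dual (1 : ZMod 2) = 1 := (AddMonoidAlgebra.one_def).symm
  exact congrArg₂ (· - ·)
    (congrArg₂ (· * ·) (htok_congr rfl h0 _) (htok_congr rfl rfl _))
    (congrArg₂ (· * ·) (htok_congr rfl rfl _) (htok_congr (CharTwo.add_self_eq_zero (1 : ZMod 2)) h1 _))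

/-- The images of the generators of the Clifford nilHecke algebra. -/
def nhVal (k : Type u) [CommRing k] [Algebra k R] {c : Fin n → R} {u : Fin (n - 1) → R}
    {x : Fin n → R} (h : IsNilHeckeFamily c u x) : NHGen (Cl k) n → R :=
  Sum.elim (ncVal k h.toIsNilCoxeterFamily) x

theorem nhVal_rel {c : Fin n → R} {u : Fin (n - 1) → R} {x : Fin n → R}
    (h : IsNilHeckeFamily c u x)
    (a b : FreeAlgebra k (NHGen (Cl k) n)) (hab : NHRel n (clFrobenius k) a b) :
    FreeAlgebra.lift k (nhVal k h) a = FreeAlgebra.lift k (nhVal k h) b := by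
  have e : ∀ (p : ZMod 2) (a : (Cl k).gr p) (i : Fin n),
      FreeAlgebra.lift k (nhVal k h) (htok a i) =
        clHom (k := k) (c i) (h.sq i) (a : (Cl k).carrier) :=
    fun p a i => FreeAlgebra.lift_ι_apply _ _
  have e' : ∀ i, FreeAlgebra.lift k (nhVal k h) (hcross (Cl k) i) = u i :=
    fun i => FreeAlgebra.lift_ι_apply _ _
  have e'' : ∀ i, FreeAlgebra.lift k (nhVal k h) (hdot (Cl k) i) = x i :=
    fun i => FreeAlgebra.lift_ι_apply _ _
  have et : ∀ i, FreeAlgebra.lift k (nhVal k h) (hteleport (clFrobenius k) i) =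
      c (lo i) - c (hi i) := by
    intro i
    have h1 : ∀ j : Fin n, clHom (k := k) (c j) (h.sq j)
      ((⟨1, SetLike.GradedOne.one_mem⟩ : (Cl k).gr 0) : (Cl k).carrier) = 1 := fun j => map_one _
    rw [hteleport_clFrobenius, map_sub, map_mul, map_mul, e, e, e, e, h1, h1, clHom_clc, clHom_clc,
      one_mul, mul_one]
  -- The trace map is odd, hence the sign in the relations between dots.
  have hσ : ∀ z : R, sgn (clFrobenius k).σ • z = -z := sgn_one_smul
  cases hab with
  | nc hab =>
    have hcomp : (FreeAlgebra.lift k (nhVal k h)).comp (ncToNHFree (Cl k) n) =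
        FreeAlgebra.lift k (ncVal k h.toIsNilCoxeterFamily) := by
      ext x
      simp [ncToNHFree, nhVal]
    have := ncVal_rel h.toIsNilCoxeterFamily _ _ hab
    rw [← hcomp] at this
    exact this
  | dot_dot i j hij => rw [map_mul, map_sgn_smul, map_mul, e'', e'', hσ, h.x_anti i j hij]
  | @tok_dot p a i j =>
    rw [map_mul, map_sgn_smul, map_mul, e, e'']
    change _ = sgn (1 * p) • _
    rw [one_mul]
    rcases zmod_two_eq p with rfl | rfl
    · obtain ⟨r, hr⟩ := cl_even a.2
      rw [hr]
      simp [sgn_zero]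
    · obtain ⟨r, hr⟩ := cl_odd a.2
      rw [hr, map_smul, clHom_clc, sgn_one_smul, smul_mul_assoc, h.c_x, mul_smul_comm, smul_neg]
  | dot_cross_far i j hl hh => rw [map_mul, map_mul, e', e'', h.x_far i j hl hh]
  | cross_dot i => rw [map_mul, map_add, map_mul, e', e'', e'', et, h.u_x]
  | dot_cross i =>
    rw [map_mul, map_add, map_mul, map_sgn_smul, e', e'', e'', et, hσ, h.x_u, sub_eq_add_neg]

/-- The homomorphism from the Clifford nilHecke algebra given by elements that satisfy its
relations. -/
def nhHom (k : Type u) [CommRing k] [Algebra k R] {c : Fin n → R} {u : Fin (n - 1) → R}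
    {x : Fin n → R} (h : IsNilHeckeFamily c u x) : (NH n (clFrobenius k)).carrier →ₐ[k] R :=
  presentedLift (nhRel_homogeneous n (clFrobenius k)) (FreeAlgebra.lift k (nhVal k h))
    (nhVal_rel h)

@[simp]
theorem nhHom_nhC {c : Fin n → R} {u : Fin (n - 1) → R} {x : Fin n → R}
    (h : IsNilHeckeFamily c u x) (i : Fin n) : nhHom k h (nhC k i) = c i :=
  (presentedLift_gen _ _ _).trans ((FreeAlgebra.lift_ι_apply _ _).trans (clHom_clc _ _))

@[simp]
theorem nhHom_nhU {c : Fin n → R} {u : Fin (n - 1) → R} {x : Fin n → R}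
    (h : IsNilHeckeFamily c u x) (i : Fin (n - 1)) : nhHom k h (nhU k i) = u i :=
  (presentedLift_gen _ _ _).trans (FreeAlgebra.lift_ι_apply _ _)

@[simp]
theorem nhHom_nhX {c : Fin n → R} {u : Fin (n - 1) → R} {x : Fin n → R}
    (h : IsNilHeckeFamily c u x) (i : Fin n) : nhHom k h (nhX k i) = x i :=
  (presentedLift_gen _ _ _).trans (FreeAlgebra.lift_ι_apply _ _)

variable (k n) in
/-- The homomorphism from the nilCoxeter algebra to the nilHecke algebra. -/
def ncToNH : (NC (Cl k) n).carrier →ₐ[k] (NH n (clFrobenius k)).carrier :=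
  presentedLift (ncRel_homogeneous (Cl k) n)
    ((RingQuot.mkAlgHom k (NHRel n (clFrobenius k))).comp (ncToNHFree (Cl k) n))
    fun _ _ hab => gen_rel (nhRel_homogeneous n (clFrobenius k)) (NHRel.nc hab)

theorem ncToNH_gen (x : NCGen (Cl k) n) :
    ncToNH k n (gen _ _ _ x) = gen _ _ _ (Sum.inl x) := by
  refine (presentedLift_gen _ _ _).trans ?_
  exact congrArg (RingQuot.mkAlgHom k (NHRel n (clFrobenius k))) (FreeAlgebra.lift_ι_apply _ _)

theorem IsNilCoxeterFamily.map {S : Type u} [Ring S] {c : Fin n → R} {u : Fin (n - 1) → R}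
    (h : IsNilCoxeterFamily c u) (f : R →+* S) :
    IsNilCoxeterFamily (fun i => f (c i)) (fun i => f (u i)) where
  sq i := by rw [← map_mul, h.sq, map_one]
  anti i j hij := by rw [← map_mul, h.anti i j hij, map_neg, map_mul]
  u_sq i := by rw [← map_mul, h.u_sq, map_zero]
  u_comm i j hij := by rw [← map_mul, h.u_comm i j hij, map_mul]
  u_braid i j hij := by simp only [← map_mul, h.u_braid i j hij]
  u_lo i := by simp only [← map_mul, h.u_lo i]
  u_hi i := by simp only [← map_mul, h.u_hi i]
  u_far i j hl hh := by simp only [← map_mul, h.u_far i j hl hh]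

variable (k n) in
theorem isNilHeckeFamily_nh : IsNilHeckeFamily (nhC k (n := n)) (nhU k) (nhX k) := by
  have hr := fun a b => gen_rel (nhRel_homogeneous n (clFrobenius k)) (a := a) (b := b)
  have hc : (fun i => ncToNH k n (ncC k i)) = nhC k := funext fun i => ncToNH_gen _
  have hu : (fun i => ncToNH k n (ncU k i)) = nhU k := funext fun i => ncToNH_gen _
  -- The relations without dots are transported from the nilCoxeter algebra instead of being derived
  -- again.
  have hnc : IsNilCoxeterFamily (nhC k (n := n)) (nhU k) := by
    have := (isNilCoxeterFamily_nc k n).map (ncToNH k n).toRingHom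
    rw [← hc, ← hu]
    exact this
  have hone : ∀ i : Fin n, RingQuot.mkAlgHom k (NHRel n (clFrobenius k))
      (htok (⟨1, SetLike.GradedOne.one_mem⟩ : (Cl k).gr 0) i) = 1 := by
    intro i
    have h := hr _ _ (NHRel.nc (.tok_one i))
    rw [map_one, map_one] at h
    refine Eq.trans ?_ h
    exact congrArg (RingQuot.mkAlgHom k (NHRel n (clFrobenius k)))
      (by simp [ncToNHFree, ftok, htok])
  have ht : ∀ i : Fin (n - 1), (RingQuot.mkAlgHom k (NHRel n (clFrobenius k))
      (hteleport (clFrobenius k) i) : (NH n (clFrobenius k)).carrier) =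
        nhC k (lo i) - nhC k (hi i) := by
    intro i
    rw [hteleport_clFrobenius, map_sub, map_mul, map_mul, hone, hone, one_mul, mul_one]
    rfl
  have hσ : ∀ z : FreeAlgebra k (NHGen (Cl k) n), sgn (clFrobenius k).σ • z = -z := sgn_one_smul
  refine { hnc with x_anti := ?_, c_x := ?_, x_far := ?_, u_x := ?_, x_u := ?_ }
  · intro i j hij
    have h := hr _ _ (.dot_dot i j hij)
    rw [hσ, map_neg, map_mul, map_mul] at h
    exact h
  · intro i j
    have h := hr _ _ (.tok_dot (clc k) i j)
    rw [mul_one, hσ, map_neg, map_mul, map_mul] at h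
    exact h
  · intro i j hl hh
    have h := hr _ _ (.dot_cross_far i j hl hh)
    rw [map_mul, map_mul] at h
    exact h
  · intro i
    have h := hr _ _ (.cross_dot i)
    rw [map_mul, map_add, map_mul, ht] at h
    exact h
  · intro i
    have h := hr _ _ (.dot_cross i)
    rw [hσ, map_mul, map_add, map_mul, map_neg, ht] at h
    exact h.trans (sub_eq_add_neg _ _).symm

theorem nh_hom_ext {f g : (NH n (clFrobenius k)).carrier →ₐ[k] R}
    (hc : ∀ i, f (nhC k i) = g (nhC k i)) (hu : ∀ i, f (nhU k i) = g (nhU k i))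
    (hx : ∀ i, f (nhX k i) = g (nhX k i)) : f = g := by
  have h : f.comp (ncToNH k n) = g.comp (ncToNH k n) := by
    refine nc_hom_ext (fun i => ?_) (fun i => ?_)
    · exact ((congrArg f (ncToNH_gen _)).trans (hc i)).trans (congrArg g (ncToNH_gen _)).symm
    · exact ((congrArg f (ncToNH_gen _)).trans (hu i)).trans (congrArg g (ncToNH_gen _)).symm
  refine presented_hom_ext fun x => ?_
  cases x with
  | inl x =>
    rw [← ncToNH_gen]
    exact DFunLike.congr_fun h _
  | inr i => exact hx i

theorem isGraded_nh {B : SuperAlg.{u} k}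
    {f : (NH n (clFrobenius k)).carrier →ₐ[k] B.carrier} (hc : ∀ i, f (nhC k i) ∈ B.gr 1)
    (hu : ∀ i, f (nhU k i) ∈ B.gr 0) (hx : ∀ i, f (nhX k i) ∈ B.gr 1) :
    IsGraded (NH n (clFrobenius k)) B.gr f := by
  have h : IsGraded (NC (Cl k) n) B.gr (f.comp (ncToNH k n)) := by
    refine isGraded_nc (fun i => ?_) (fun i => ?_)
    · exact (congrArg f (ncToNH_gen _) ▸ hc i)
    · exact (congrArg f (ncToNH_gen _) ▸ hu i)
  refine isGraded_of_gen fun x => ?_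
  cases x with
  | inl x =>
    rw [← ncToNH_gen]
    exact h (gen_mem x)
  | inr i => exact hx i

/-! ### The odd algebras -/

/-- The homomorphism from the odd nilCoxeter algebra given by elements that satisfy its
relations. -/
theorem exists_oncHom (k : Type u) [CommRing k] [Algebra k R] {v : Fin (n - 1) → R}
    (h : ∀ a b, OddNilCoxeterRel v a b → a = b) :
    ∃ f : (ONC k n).carrier →ₐ[k] R, ∀ i, f (oncV k i) = v i := by
  let F : FreeAlgebra k (ONCGen.{u} n) →ₐ[k] R := FreeAlgebra.lift k fun | .cross i => v i
  have e : ∀ i, F (ocross k i) = v i := fun i => FreeAlgebra.lift_ι_apply _ _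
  refine ⟨presentedLift _ F ?_, fun i => (presentedLift_gen _ _ _).trans (e i)⟩
  rintro _ _ (i | ⟨i, j, hij⟩ | ⟨i, j, hij⟩)
  · rw [map_mul, map_zero, e, h _ _ (.sq i)]
  · rw [map_mul, map_neg, map_mul, e, e, h _ _ (.anticomm i j hij)]
  · simp only [map_mul, e, h _ _ (.braid i j hij)]

theorem exists_onhHom (k : Type u) [CommRing k] [Algebra k R] {c : Fin n → R}
    {v : Fin (n - 1) → R} {y : Fin n → R} (h : IsOddNilHeckeFamily c v y) :
    ∃ f : (ONH k n).carrier →ₐ[k] R, (∀ i, f (onhV k i) = v i) ∧ ∀ i, f (onhY k i) = y i := by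
  let F : FreeAlgebra k (ONHGen.{u} n) →ₐ[k] R := FreeAlgebra.lift k fun
    | .cross i => v i
    | .dot i => y i
  have e : ∀ i, F (ohcross k i) = v i := fun i => FreeAlgebra.lift_ι_apply _ _
  have e' : ∀ i, F (ohdot k i) = y i := fun i => FreeAlgebra.lift_ι_apply _ _
  refine ⟨presentedLift _ F ?_, fun i => (presentedLift_gen _ _ _).trans (e i),
    fun i => (presentedLift_gen _ _ _).trans (e' i)⟩
  rintro _ _ (hab | ⟨i, j, hij⟩ | ⟨i, j, hl, hh⟩ | i | i)
  · rcases hab with i | ⟨i, j, hij⟩ | ⟨i, j, hij⟩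
    · rw [map_mul, map_zero, e, h.v_rel _ _ (.sq i)]
    · rw [map_mul, map_neg, map_mul, e, e, h.v_rel _ _ (.anticomm i j hij)]
    · simp only [map_mul, e, h.v_rel _ _ (.braid i j hij)]
  · rw [map_mul, map_neg, map_mul, e', e', h.y_anti i j hij]
  · rw [map_mul, map_neg, map_mul, e', e, h.y_far i j hl hh]
  · rw [map_add, map_mul, map_mul, map_one, e', e', e, h.v_y]
  · rw [map_add, map_mul, map_mul, map_one, e', e', e, h.y_v]

end NilHom

/-! ### The isomorphisms with the odd algebras tensored with Clifford factors -/

section Isomorphisms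

variable {k : Type u} [CommRing k] {R : Type u} [Ring R] [Algebra k R] {n : ℕ}

theorem onc_hom_ext {f g : (ONC k n).carrier →ₐ[k] R} (hv : ∀ i, f (oncV k i) = g (oncV k i)) :
    f = g :=
  presented_hom_ext fun | .cross i => hv i

theorem onh_hom_ext {f g : (ONH k n).carrier →ₐ[k] R} (hv : ∀ i, f (onhV k i) = g (onhV k i))
    (hy : ∀ i, f (onhY k i) = g (onhY k i)) : f = g :=
  presented_hom_ext fun
    | .cross i => hv i
    | .dot i => hy i

theorem cl_tensorPow_hom_ext {f g : (tensorPow (Cl k) n).carrier →ₐ[k] R}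
    (h : ∀ i, f (clC k i) = g (clC k i)) : f = g :=
  tensorPow_hom_ext n fun i => cl_hom_ext (h i)

theorem exists_cl_tensorPow_hom (k : Type u) [CommRing k] [Algebra k R] {c : Fin n → R}
    (h : IsCliffordFamily c) :
    ∃ f : (tensorPow (Cl k) n).carrier →ₐ[k] R, ∀ i, f (clC k i) = c i := by
  obtain ⟨f, hf⟩ := exists_tensorPow_hom n (fun i => clHom (k := k) (c i) (h.sq i))
    fun i j hij => superCommute_cl (by rw [clHom_clc, clHom_clc]; exact h.anti i j hij)
  exact ⟨f, fun i => (DFunLike.congr_fun (hf i) _).trans (clHom_clc _ _)⟩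

variable (k n) in
theorem isCliffordFamily_clC : IsCliffordFamily (clC k (n := n)) where
  sq i := by
    rw [clC, ← map_mul, clc_mul_clc, map_one]
  anti i j hij := by
    have := superCommute_place n hij (clc k).2 (clc k).2
    rwa [mul_one, sgn_one_smul] at this

theorem clC_mem (i : Fin n) : clC k i ∈ (tensorPow (Cl k) n).gr 1 :=
  isGraded_place n i (clc k).2

/-- Supercommutation reduces to the generators on both sides, all of which are odd. It is the
condition for gluing a map from the odd algebra to a map from the Clifford factors. -/
theorem superCommute_of_odd_gen {X : Type u}
    {rel : FreeAlgebra k X → FreeAlgebra k X → Prop} {h : Homogeneous (fun _ => 1) rel}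
    {f : (presented (fun _ => 1) rel h).carrier →ₐ[k] R}
    {g : (tensorPow (Cl k) n).carrier →ₐ[k] R}
    (hfg : ∀ i x, g (clC k i) * f (gen _ rel h x) = -(f (gen _ rel h x) * g (clC k i))) :
    SuperCommute f g := by
  refine (SuperCommute.of_tensorPow n fun i => SuperCommute.of_cl fun j b hb => ?_).symm
  refine supercommute_of_gen (fun x => ?_) hb
  rw [sgn_one_smul]
  exact hfg i x

theorem inr_anticomm_inl {A B : SuperAlg.{u} k} {a : A.carrier} {b : B.carrier}
    (ha : a ∈ A.gr 1) (hb : b ∈ B.gr 1) :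
    inr A B b * inl A B a = -(inl A B a * inr A B b) := by
  have := superCommute_inl_inr.symm hb ha
  rwa [mul_one, sgn_one_smul] at this

theorem IsCliffordFamily.map {S : Type u} [Ring S] {c : Fin n → R} (h : IsCliffordFamily c)
    (f : R →+* S) : IsCliffordFamily fun i => f (c i) where
  sq i := by rw [← map_mul, h.sq, map_one]
  anti i j hij := by rw [← map_mul, h.anti i j hij, map_neg, map_mul]

theorem isCliffordFamily_inr (A : SuperAlg.{u} k) :
    IsCliffordFamily fun i => inr A (tensorPow (Cl k) n) (clC k i) :=
  (isCliffordFamily_clC k n).map (inr A (tensorPow (Cl k) n)).toRingHom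

theorem oncV_mem (i : Fin (n - 1)) : oncV k i ∈ (ONC k n).gr 1 :=
  gen_mem (ONCGen.cross i)

theorem onhV_mem (i : Fin (n - 1)) : onhV k i ∈ (ONH k n).gr 1 :=
  gen_mem (ONHGen.cross i)

theorem onhY_mem (i : Fin n) : onhY k i ∈ (ONH k n).gr 1 :=
  gen_mem (ONHGen.dot i)

theorem oddNilCoxeterRel_map {S : Type u} [Ring S] {v : Fin (n - 1) → R}
    (h : ∀ a b, OddNilCoxeterRel v a b → a = b) (f : R →+* S) :
    ∀ a b, OddNilCoxeterRel (fun i => f (v i)) a b → a = b := by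
  rintro _ _ (i | ⟨i, j, hij⟩ | ⟨i, j, hij⟩)
  · rw [← map_mul, h _ _ (.sq i), map_zero]
  · rw [← map_mul, h _ _ (.anticomm i j hij), map_neg, map_mul]
  · simp only [← map_mul, h _ _ (.braid i j hij)]

variable (k n) in
theorem oncV_rel : ∀ a b, OddNilCoxeterRel (oncV k (n := n)) a b → a = b := by
  have hr := fun a b => gen_rel (oddNilCoxeterRel_homogeneous k (fun _ : ONCGen.{u} n => 1)
    (ocross k (n := n)) fun _ => ι_mem_freeGr _ _) (a := a) (b := b)
  rintro _ _ (i | ⟨i, j, hij⟩ | ⟨i, j, hij⟩)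
  · have h := hr _ _ (.sq i)
    rw [map_mul, map_zero] at h
    exact h
  · have h := hr _ _ (.anticomm i j hij)
    rw [map_neg, map_mul, map_mul] at h
    exact h
  · have h := hr _ _ (.braid i j hij)
    simp only [map_mul] at h
    exact h

variable (k n) in
theorem onhV_rel : ∀ a b, OddNilCoxeterRel (onhV k (n := n)) a b → a = b := by
  have hr := fun a b => gen_rel (onhRel_homogeneous k n) (a := a) (b := b)
  rintro _ _ (i | ⟨i, j, hij⟩ | ⟨i, j, hij⟩)
  · have h := hr _ _ (.onc (.sq i))
    rw [map_mul, map_zero] at h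
    exact h
  · have h := hr _ _ (.onc (.anticomm i j hij))
    rw [map_neg, map_mul, map_mul] at h
    exact h
  · have h := hr _ _ (.onc (.braid i j hij))
    simp only [map_mul] at h
    exact h

variable (k n) in
-- Relations within one tensor factor survive the inclusions, and odd elements of different factors
-- anticommute.
theorem isOddNilCoxeterFamily_tensor :
    IsOddNilCoxeterFamily (fun i => inr (ONC k n) (tensorPow (Cl k) n) (clC k i))
      (fun i => inl (ONC k n) (tensorPow (Cl k) n) (oncV k i)) :=
  { isCliffordFamily_inr _ with
    v_rel := oddNilCoxeterRel_map (oncV_rel k n) (inl (ONC k n) (tensorPow (Cl k) n)).toRingHom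
    c_v := fun i j => inr_anticomm_inl (oncV_mem i) (clC_mem j) }

variable (k n) in
theorem isOddNilHeckeFamily_tensor :
    IsOddNilHeckeFamily (fun i => inr (ONH k n) (tensorPow (Cl k) n) (clC k i))
      (fun i => inl (ONH k n) (tensorPow (Cl k) n) (onhV k i))
      (fun i => inl (ONH k n) (tensorPow (Cl k) n) (onhY k i)) := by
  have hr := fun a b => gen_rel (onhRel_homogeneous k n) (a := a) (b := b)
  refine { isCliffordFamily_inr _ with
    v_rel := oddNilCoxeterRel_map (onhV_rel k n) (inl (ONH k n) (tensorPow (Cl k) n)).toRingHom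
    c_v := fun i j => inr_anticomm_inl (onhV_mem i) (clC_mem j)
    y_anti := ?_
    c_y := fun i j => inr_anticomm_inl (onhY_mem i) (clC_mem j)
    y_far := ?_, v_y := ?_, y_v := ?_ }
  · intro i j hij
    have h := hr _ _ (.dot_dot i j hij)
    rw [map_neg, map_mul, map_mul] at h
    have h' : onhY k i * onhY k j = -(onhY k j * onhY k i) := h
    rw [← map_mul, h', map_neg, map_mul]
  · intro i j hl hh
    have h := hr _ _ (.dot_cross_far i j hl hh)
    rw [map_neg, map_mul, map_mul] at h
    have h' : onhY k j * onhV k i = -(onhV k i * onhY k j) := h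
    rw [← map_mul, h', map_neg, map_mul]
  · intro i
    have h := hr _ _ (.cross_dot i)
    rw [map_add, map_mul, map_mul, map_one] at h
    have h' : onhV k i * onhY k (hi i) + onhY k (lo i) * onhV k i = 1 := h
    rw [← map_mul, ← map_mul, ← map_add, h', map_one]
  · intro i
    have h := hr _ _ (.dot_cross i)
    rw [map_add, map_mul, map_mul, map_one] at h
    have h' : onhY k (hi i) * onhV k i + onhV k i * onhY k (lo i) = 1 := h
    rw [← map_mul, ← map_mul, ← map_add, h', map_one]

theorem mul_mem_gr {A : SuperAlg.{u} k} {p q r : ZMod 2} {a b : A.carrier} (ha : a ∈ A.gr p)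
    (hb : b ∈ A.gr q) (h : p + q = r) : a * b ∈ A.gr r :=
  h ▸ SetLike.GradedMul.mul_mem ha hb

/-- With `d = c_i - c_{i+1}` this makes the two substitutions inverse to each other, in either
order. -/
theorem invOf_smul_mul_mul [Invertible (2 : k)] {d : R} (hd : d * d = 2) (u : R) :
    (⅟2 : k) • (d * (d * u)) = u := by
  rw [← mul_assoc, hd, ← smul_mul_assoc, invOf_two_smul_two, one_mul]

variable (k n) in
/-- The isomorphism from the Clifford nilCoxeter algebra to the tensor product of the odd
nilCoxeter algebra with a Clifford superalgebra. -/
theorem exists_ncIso [Invertible (2 : k)] :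
    ∃ Φ : SuperIso (NC (Cl k) n) (tensor (ONC k n) (tensorPow (Cl k) n)),
      (∀ i : Fin n, Φ.toAlgEquiv (ncC k i) = inr _ _ (clC k i)) ∧
      (∀ i : Fin (n - 1), Φ.toAlgEquiv (ncU k i) =
        inr _ _ (clC k (lo i) - clC k (hi i)) * inl _ _ (oncV k i)) := by
  have h := isOddNilCoxeterFamily_tensor k n
  -- The inverse has to send `v_i` to `(1/2) (c_i - c_{i+1}) u_i`, because `d_i ^ 2 = 2`.
  have h' := (isNilCoxeterFamily_nc k n).toOddNilCoxeter (k := k)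
  obtain ⟨f, hf⟩ := exists_oncHom k h'.v_rel
  obtain ⟨g, hg⟩ := exists_cl_tensorPow_hom k h'.toIsCliffordFamily
  have hfg : SuperCommute f g := by
    refine superCommute_of_odd_gen fun i x => ?_
    cases x with
    | cross j =>
      have := h'.c_v j i
      rw [← hf, ← hg] at this
      exact this
  have hC : ∀ i, tensorLift f g hfg (inr _ _ (clC k i)) = ncC k i :=
    fun i => (tensorLift_inr f g hfg _).trans (hg i)
  have hV : ∀ i, tensorLift f g hfg (inl _ _ (oncV k i)) =
      (⅟2 : k) • ((ncC k (lo i) - ncC k (hi i)) * ncU k i) :=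
    fun i => (tensorLift_inl f g hfg _).trans (hf i)
  refine ⟨SuperIso.ofAlgHom (ncHom k h.toNilCoxeter) (tensorLift f g hfg) ?_ ?_ ?_, ?_, ?_⟩
  · refine tensor_hom_ext (onc_hom_ext fun i => ?_) (cl_tensorPow_hom_ext fun i => ?_)
    · simp only [AlgHom.comp_apply, hV, map_smul, map_mul, map_sub, ncHom_ncC, ncHom_ncU,
        AlgHom.id_apply]
      exact invOf_smul_mul_mul (h.sub_mul_sub (lo_ne_hi i)) _
    · simp only [AlgHom.comp_apply, hC, ncHom_ncC, AlgHom.id_apply]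
  · refine nc_hom_ext (fun i => ?_) (fun i => ?_)
    · simp only [AlgHom.comp_apply, ncHom_ncC, hC, AlgHom.id_apply]
    · simp only [AlgHom.comp_apply, ncHom_ncU, map_mul, map_sub, hC, hV, AlgHom.id_apply,
        mul_smul_comm]
      exact invOf_smul_mul_mul (h'.sub_mul_sub (lo_ne_hi i)) _
  · refine isGraded_nc (fun i => ?_) (fun i => ?_)
    · rw [ncHom_ncC]; exact isGraded_inr (clC_mem i)
    · rw [ncHom_ncU]
      exact mul_mem_gr (sub_mem (isGraded_inr (clC_mem _)) (isGraded_inr (clC_mem _)))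
        (isGraded_inl (oncV_mem i)) (CharTwo.add_self_eq_zero 1)
  · exact fun i => ncHom_ncC _ i
  · intro i
    rw [map_sub]
    exact ncHom_ncU _ i

variable (k n) in
/-- The isomorphism from the Clifford nilHecke algebra to the tensor product of the odd
nilHecke algebra with a Clifford superalgebra. -/
theorem exists_nhIso [Invertible (2 : k)] :
    ∃ Ψ : SuperIso (NH n (clFrobenius k)) (tensor (ONH k n) (tensorPow (Cl k) n)),
      (∀ i : Fin n, Ψ.toAlgEquiv (nhC k i) = inr _ _ (clC k i)) ∧
      (∀ i : Fin (n - 1), Ψ.toAlgEquiv (nhU k i) =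
        inr _ _ (clC k (lo i) - clC k (hi i)) * inl _ _ (onhV k i)) ∧
      (∀ i : Fin n, Ψ.toAlgEquiv (nhX k i) = inl _ _ (onhY k i)) := by
  have h := isOddNilHeckeFamily_tensor k n
  have h' := (isNilHeckeFamily_nh k n).toOddNilHecke (k := k)
  obtain ⟨f, hf, hf'⟩ := exists_onhHom k h'
  obtain ⟨g, hg⟩ := exists_cl_tensorPow_hom k h'.toIsCliffordFamily
  have hfg : SuperCommute f g := by
    refine superCommute_of_odd_gen fun i x => ?_
    cases x with
    | cross j =>
      have := h'.c_v j i
      rw [← hf, ← hg] at this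
      exact this
    | dot j =>
      have := h'.c_y j i
      rw [← hf', ← hg] at this
      exact this
  have hC : ∀ i, tensorLift f g hfg (inr _ _ (clC k i)) = nhC k i :=
    fun i => (tensorLift_inr f g hfg _).trans (hg i)
  have hV : ∀ i, tensorLift f g hfg (inl _ _ (onhV k i)) =
      (⅟2 : k) • ((nhC k (lo i) - nhC k (hi i)) * nhU k i) :=
    fun i => (tensorLift_inl f g hfg _).trans (hf i)
  have hY : ∀ i, tensorLift f g hfg (inl _ _ (onhY k i)) = nhX k i :=
    fun i => (tensorLift_inl f g hfg _).trans (hf' i)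
  refine ⟨SuperIso.ofAlgHom (nhHom k h.toNilHecke) (tensorLift f g hfg) ?_ ?_ ?_, ?_, ?_, ?_⟩
  · refine tensor_hom_ext (onh_hom_ext (fun i => ?_) fun i => ?_)
      (cl_tensorPow_hom_ext fun i => ?_)
    · simp only [AlgHom.comp_apply, hV, map_smul, map_mul, map_sub, nhHom_nhC, nhHom_nhU,
        AlgHom.id_apply]
      exact invOf_smul_mul_mul (h.sub_mul_sub (lo_ne_hi i)) _
    · simp only [AlgHom.comp_apply, hY, nhHom_nhX, AlgHom.id_apply]
    · simp only [AlgHom.comp_apply, hC, nhHom_nhC, AlgHom.id_apply]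
  · refine nh_hom_ext (fun i => ?_) (fun i => ?_) (fun i => ?_)
    · simp only [AlgHom.comp_apply, nhHom_nhC, hC, AlgHom.id_apply]
    · simp only [AlgHom.comp_apply, nhHom_nhU, map_mul, map_sub, hC, hV, AlgHom.id_apply,
        mul_smul_comm]
      exact invOf_smul_mul_mul (h'.sub_mul_sub (lo_ne_hi i)) _
    · simp only [AlgHom.comp_apply, nhHom_nhX, hY, AlgHom.id_apply]
  · refine isGraded_nh (fun i => ?_) (fun i => ?_) (fun i => ?_)
    · rw [nhHom_nhC]; exact isGraded_inr (clC_mem i)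
    · rw [nhHom_nhU]
      exact mul_mem_gr (sub_mem (isGraded_inr (clC_mem _)) (isGraded_inr (clC_mem _)))
        (isGraded_inl (onhV_mem i)) (CharTwo.add_self_eq_zero 1)
    · rw [nhHom_nhX]; exact isGraded_inl (onhY_mem i)
  · exact fun i => nhHom_nhC _ i
  · intro i
    rw [map_sub]
    exact nhHom_nhU _ i
  · exact fun i => nhHom_nhX _ i

end Isomorphisms

/-! ### Composition of Morita superequivalences, and those given by isomorphisms -/

section Morita

variable {k : Type u} [CommRing k] {A B D : SuperAlg.{u} k}

namespace MoritaSuperequivalence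

/-- A linear equivalence of categories that commutes with the parity shifts. -/
def ofFunctor (F : SMod A ⥤ SMod B) (hF : F.IsEquivalence) (hadd : F.Additive)
    (hlin : F.Linear k) (s : SMod.shift A ⋙ F ≅ F ⋙ SMod.shift B)
    (hs : ∀ M : SMod A, s.hom.app ((SMod.shift A).obj M) ≫ (SMod.shift B).map (s.hom.app M) ≫
      (SMod.shiftTwice (F.obj M)).hom = F.map (SMod.shiftTwice M).hom) :
    MoritaSuperequivalence A B where
  eqv := F.asEquivalence
  additive := hadd
  linear := hlin
  shiftIso := s
  coherence := hs

/-- The composite of two functors that commute with the parity shifts does so, too. -/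
def compShiftIso {F : SMod A ⥤ SMod B} {G : SMod B ⥤ SMod D}
    (s : SMod.shift A ⋙ F ≅ F ⋙ SMod.shift B) (t : SMod.shift B ⋙ G ≅ G ⋙ SMod.shift D) :
    SMod.shift A ⋙ F ⋙ G ≅ (F ⋙ G) ⋙ SMod.shift D :=
  NatIso.ofComponents (fun M => G.mapIso (s.app M) ≪≫ t.app (F.obj M)) fun {M N} f => by
    have hs := s.hom.naturality f
    have ht := t.hom.naturality (F.map f)
    simp only [Functor.comp_map] at hs ht
    simp only [Functor.comp_map, Iso.trans_hom, Functor.mapIso_hom, Iso.app_hom, Category.assoc]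
    rw [← ht, ← Functor.map_comp_assoc, hs, Functor.map_comp_assoc]

/-- The composite of two Morita superequivalences. -/
def trans (E : MoritaSuperequivalence A B) (E' : MoritaSuperequivalence B D) :
    MoritaSuperequivalence A D where
  eqv := E.eqv.trans E'.eqv
  additive := by
    have := E.additive
    have := E'.additive
    exact inferInstanceAs (E.eqv.functor ⋙ E'.eqv.functor).Additive
  linear := by
    have := E.additive
    have := E'.additive
    have := E.linear
    have := E'.linear
    exact inferInstanceAs ((E.eqv.functor ⋙ E'.eqv.functor).Linear k)
  shiftIso := compShiftIso E.shiftIso E'.shiftIso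
  coherence M := by
    have h := E.coherence M
    have h' := E'.coherence (E.eqv.functor.obj M)
    -- Naturality of the second shift isomorphism at a component of the first brings the two shifts
    -- of each functor together; then the two coherence conditions apply in turn.
    have nat := E'.shiftIso.hom.naturality (E.shiftIso.hom.app M)
    change (E'.eqv.functor.map (E.shiftIso.hom.app ((SMod.shift A).obj M)) ≫
      E'.shiftIso.hom.app (E.eqv.functor.obj ((SMod.shift A).obj M))) ≫
        (SMod.shift D).map (E'.eqv.functor.map (E.shiftIso.hom.app M) ≫
          E'.shiftIso.hom.app (E.eqv.functor.obj M)) ≫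
            (SMod.shiftTwice (E'.eqv.functor.obj (E.eqv.functor.obj M))).hom =
      E'.eqv.functor.map (E.eqv.functor.map (SMod.shiftTwice M).hom)
    change E'.eqv.functor.map ((SMod.shift B).map (E.shiftIso.hom.app M)) ≫
      E'.shiftIso.hom.app ((SMod.shift B).obj (E.eqv.functor.obj M)) =
        E'.shiftIso.hom.app (E.eqv.functor.obj ((SMod.shift A).obj M)) ≫
          (SMod.shift D).map (E'.eqv.functor.map (E.shiftIso.hom.app M)) at nat
    rw [Functor.map_comp, Category.assoc, Category.assoc, ← reassoc_of% nat, h', ← h,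
      Functor.map_comp, Functor.map_comp]

end MoritaSuperequivalence

namespace SMod

theorem exists_parts (M : SMod A) (m : M.carrier) : ∃ m₀ ∈ M.gr 0, ∃ m₁ ∈ M.gr 1, m₀ + m₁ = m := by
  have h : m ∈ M.gr 0 ⊔ M.gr 1 := M.isCompl.sup_eq_top ▸ AddSubgroup.mem_top m
  exact AddSubgroup.mem_sup.1 h

theorem eq_zero_of_mem (M : SMod A) {m : M.carrier} (h₀ : m ∈ M.gr 0) (h₁ : m ∈ M.gr 1) : m = 0 :=
  AddSubgroup.disjoint_def.1 M.isCompl.disjoint h₀ h₁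

theorem isCompl_of {G : Type*} [AddCommGroup G] {H K : AddSubgroup G}
    (h : ∀ x, x ∈ H → x ∈ K → x = 0) (h' : ∀ x, ∃ y ∈ H, ∃ z ∈ K, y + z = x) : IsCompl H K where
  disjoint := AddSubgroup.disjoint_def.2 fun {x} => h x
  codisjoint := codisjoint_iff.2 (eq_top_iff.2 fun x _ => AddSubgroup.mem_sup.2 (h' x))

/-- An isomorphism of supermodules from a parity preserving linear equivalence. -/
def isoOfLinearEquiv {M N : SMod A} (e : M.carrier ≃ₗ[A.carrier] N.carrier)
    (h : ∀ p m, m ∈ M.gr p → e m ∈ N.gr p) (h' : ∀ p m, m ∈ N.gr p → e.symm m ∈ M.gr p) :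
    M ≅ N where
  hom := ⟨e.toLinearMap, h⟩
  inv := ⟨e.symm.toLinearMap, h'⟩
  hom_inv_id := by ext x; exact e.symm_apply_apply x
  inv_hom_id := by ext x; exact e.apply_symm_apply x

/-- Restriction of supermodules along a homomorphism of superalgebras. -/
def restrict (φ : A.carrier →ₐ[k] B.carrier) (hφ : IsGraded A B.gr φ) : SMod B ⥤ SMod A where
  obj M :=
    { carrier := M.carrier
      module := Module.compHom M.carrier φ.toRingHom
      gr := M.gr
      isCompl := M.isCompl
      smul_mem := fun ha hm => M.smul_mem (hφ ha) hm }
  map {M N} f :=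
    letI := Module.compHom M.carrier φ.toRingHom
    letI := Module.compHom N.carrier φ.toRingHom
    { toLin :=
        { toFun := f.toLin
          map_add' := map_add f.toLin
          map_smul' := fun a m => map_smul f.toLin (φ a) m }
      map_mem := f.map_mem }

end SMod

/-- Isomorphic superalgebras are Morita superequivalent. -/
def SuperIso.morita (Φ : SuperIso A B) : MoritaSuperequivalence A B :=
  let F : SMod A ⥤ SMod B :=
    SMod.restrict Φ.symm.toAlgEquiv.toAlgHom fun _ _ h => Φ.symm.map_mem _ _ h
  MoritaSuperequivalence.ofFunctor F
    { faithful := ⟨fun {M N f g} h => by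
        ext x
        exact DFunLike.congr_fun (congrArg SMod.Hom.toLin h) x⟩
      full := ⟨fun {M N} g => by
        refine ⟨⟨{ toFun := g.toLin, map_add' := map_add g.toLin, map_smul' := ?_ }, g.map_mem⟩, ?_⟩
        · intro a x
          -- On the restricted modules `Φ a` acts as `a` did, so linearity over `B` gives linearity
          -- over `A`.
          have h := g.toLin.map_smul (Φ.toAlgEquiv a) x
          have e : Φ.toAlgEquiv.symm (Φ.toAlgEquiv a) = a := Φ.toAlgEquiv.symm_apply_apply a
          have h₁ : (Φ.toAlgEquiv a • (show (F.obj M).carrier from x) : (F.obj M).carrier) =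
            (a • x : M.carrier) := congrArg (fun b => (b • x : M.carrier)) e
          have h₂ : (Φ.toAlgEquiv a • g.toLin x : (F.obj N).carrier) =
            (a • (show N.carrier from g.toLin x) : N.carrier) :=
              congrArg (fun b => (b • (show N.carrier from g.toLin x) : N.carrier)) e
          exact (congrArg g.toLin h₁.symm).trans (h.trans h₂)
        · rfl⟩
      essSurj := ⟨fun (M : SMod B) => ⟨(SMod.restrict Φ.toAlgEquiv.toAlgHom
          fun _ _ h => Φ.map_mem _ _ h).obj M, ⟨SMod.isoOfLinearEquiv
            { toFun := fun x => (x : M.carrier)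
              invFun := fun x => (x : M.carrier)
              map_add' := fun _ _ => rfl
              map_smul' := fun b (x : M.carrier) =>
                congrArg (fun b : B.carrier => (b • x : M.carrier))
                  (Φ.toAlgEquiv.apply_symm_apply b)
              left_inv := fun _ => rfl
              right_inv := fun _ => rfl } (fun _ _ h => h) (fun _ _ h => h)⟩⟩⟩ }
    ⟨fun {M N f g} => rfl⟩
    ⟨fun {M N} f r => by
      ext x
      exact congrArg (fun a : A.carrier => (a • f.toLin x : N.carrier))
        (Φ.symm.toAlgEquiv.commutes r).symm⟩
    -- Restriction leaves the grading alone and the shift leaves the action alone, so they commute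
    -- on the nose.
    (Iso.refl _)
    (fun M => rfl)

end Morita

/-! ### Matrix superalgebras of size `(1 | 1)` and the corner functor -/

section Corner

variable {k : Type u} [CommRing k] {A B : SuperAlg.{u} k}

/-- The parity pieces of the algebra of `(1 | 1) × (1 | 1)`-matrices. -/
def matGr (A : SuperAlg.{u} k) (p : ZMod 2) :
    Submodule k (Matrix (Fin 2) (Fin 2) A.carrier) where
  carrier := {m | m 0 0 ∈ A.gr p ∧ m 0 1 ∈ A.gr (p + 1) ∧ m 1 0 ∈ A.gr (p + 1) ∧ m 1 1 ∈ A.gr p}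
  zero_mem' := ⟨zero_mem _, zero_mem _, zero_mem _, zero_mem _⟩
  add_mem' := fun hm hm' => ⟨add_mem hm.1 hm'.1, add_mem hm.2.1 hm'.2.1,
    add_mem hm.2.2.1 hm'.2.2.1, add_mem hm.2.2.2 hm'.2.2.2⟩
  smul_mem' := fun r _ hm => ⟨Submodule.smul_mem _ r hm.1, Submodule.smul_mem _ r hm.2.1,
    Submodule.smul_mem _ r hm.2.2.1, Submodule.smul_mem _ r hm.2.2.2⟩

instance matGr_gradedMonoid (A : SuperAlg.{u} k) : SetLike.GradedMonoid (matGr A) where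
  one_mem := ⟨SetLike.GradedOne.one_mem, zero_mem _, zero_mem _, SetLike.GradedOne.one_mem⟩
  mul_mem := by
    rintro p q m m' ⟨h₁, h₂, h₃, h₄⟩ ⟨h₁', h₂', h₃', h₄'⟩
    have e : p + 1 + (q + 1) = p + q := by
      rw [add_add_add_comm, CharTwo.add_self_eq_zero, add_zero]
    have e' : p + 1 + q = p + q + 1 := by abel
    have e'' : p + (q + 1) = p + q + 1 := by abel
    refine ⟨?_, ?_, ?_, ?_⟩ <;> rw [Matrix.mul_apply, Fin.sum_univ_two]
    · exact add_mem (mul_mem_gr h₁ h₁' rfl) (mul_mem_gr h₂ h₃' e)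
    · exact add_mem (mul_mem_gr h₁ h₂' e'') (mul_mem_gr h₂ h₄' e')
    · exact add_mem (mul_mem_gr h₃ h₁' e') (mul_mem_gr h₄ h₃' e'')
    · exact add_mem (mul_mem_gr h₃ h₂' e) (mul_mem_gr h₄ h₄' rfl)

variable (A B) in
/-- A presentation of `B` as a matrix superalgebra of size `(1 | 1)` over `A`: a copy of `A` in `B`,
the idempotent `e` that projects to the even part, and the odd element `c` that exchanges the even
and the odd part. -/
structure MatrixData where
  φ : A.carrier →ₐ[k] B.carrier
  φ_graded : IsGraded A B.gr φ
  e : B.carrier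
  c : B.carrier
  e_mem : e ∈ B.gr 0
  c_mem : c ∈ B.gr 1
  e_mul_e : e * e = e
  c_mul_c : c * c = 1
  e_mul_c : e * c = c * (1 - e)
  e_mul_φ : ∀ a, e * φ a = φ a * e
  c_mul_φ : ∀ ⦃p a⦄, a ∈ A.gr p → c * φ a = sgn p • (φ a * c)
  -- Generation lets linearity over `B` be tested on `φ a`, `c` and `e`; the representation `ρ` and
  -- its properties serve only to build modules of column vectors, for essential surjectivity.
  gen : ∀ S : Subalgebra k B.carrier, (∀ a, φ a ∈ S) → c ∈ S → e ∈ S → ∀ b, b ∈ S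
  ρ : B.carrier →ₐ[k] Matrix (Fin 2) (Fin 2) A.carrier
  ρ_graded : IsGraded B (matGr A) ρ
  ρ_φ₀ : ∀ a, ρ (φ a) 0 0 = a
  ρ_φ₁ : ∀ a, ρ (φ a) 0 1 = 0
  ρ_e : ρ e = !![1, 0; 0, 0]

namespace MatrixData

variable (X : MatrixData A B)

/-- The part of a module cut out by the idempotent. -/
def corner (N : SMod B) : Submodule A.carrier ((SMod.restrict X.φ X.φ_graded).obj N).carrier where
  carrier := {x | X.e • (show N.carrier from x) = (show N.carrier from x)}
  zero_mem' := (smul_zero X.e : X.e • (0 : N.carrier) = 0)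
  add_mem' := fun {x y} hx hy => by
    have hx' : X.e • (show N.carrier from x) = (show N.carrier from x) := hx
    have hy' : X.e • (show N.carrier from y) = (show N.carrier from y) := hy
    exact (smul_add X.e (show N.carrier from x) (show N.carrier from y)).trans
      (congrArg₂ (fun a b : N.carrier => a + b) hx' hy')
  smul_mem' := fun a x hx => by
    have hx' : X.e • (show N.carrier from x) = (show N.carrier from x) := hx
    change X.e • X.φ a • (show N.carrier from x) = X.φ a • (show N.carrier from x)
    rw [smul_smul, X.e_mul_φ, mul_smul, hx']

/-- The inclusion of the corner. -/
def incl (N : SMod B) : X.corner N →+ N.carrier where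
  toFun x := x.1
  map_zero' := rfl
  map_add' _ _ := rfl

/-- The projection to the corner. -/
def proj (N : SMod B) : N.carrier →+ X.corner N where
  toFun x := ⟨(show N.carrier from X.e • x), by
    change X.e • X.e • x = X.e • x
    rw [smul_smul, X.e_mul_e]⟩
  map_zero' := Subtype.ext (smul_zero X.e : X.e • (0 : N.carrier) = 0)
  map_add' x y := Subtype.ext (smul_add X.e x y)

section

variable {X} {N : SMod B}

theorem incl_injective : Function.Injective (X.incl N) := Subtype.val_injective

theorem incl_proj (x : N.carrier) : X.incl N (X.proj N x) = X.e • x := rfl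

theorem e_smul_incl (x : X.corner N) : X.e • X.incl N x = X.incl N x := x.2

theorem proj_incl (x : X.corner N) : X.proj N (X.incl N x) = x := Subtype.ext x.2

theorem incl_smul (a : A.carrier) (x : X.corner N) : X.incl N (a • x) = X.φ a • X.incl N x := rfl

theorem proj_φ_smul (a : A.carrier) (x : N.carrier) :
    X.proj N (X.φ a • x) = a • X.proj N x := by
  apply incl_injective
  rw [incl_smul, incl_proj, incl_proj, smul_smul, smul_smul, X.e_mul_φ]

theorem proj_e_smul (x : N.carrier) : X.proj N (X.e • x) = X.proj N x := by
  apply incl_injective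
  rw [incl_proj, incl_proj, smul_smul, X.e_mul_e]

/-- The element `c` carries the image of `e` into that of `1 - e`, which `e` kills. -/
theorem e_mul_c_mul_e : X.e * X.c * X.e = 0 := by
  rw [X.e_mul_c, mul_assoc, sub_mul, one_mul, X.e_mul_e, sub_self, mul_zero]

theorem proj_c_e_smul (x : N.carrier) : X.proj N (X.c • X.e • x) = 0 := by
  apply incl_injective
  rw [incl_proj, smul_smul, smul_smul, e_mul_c_mul_e, zero_smul, map_zero]

theorem e_c_smul_incl (x : X.corner N) : X.e • X.c • X.incl N x = 0 := by
  rw [← e_smul_incl, smul_smul, smul_smul, e_mul_c_mul_e, zero_smul]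

theorem proj_mem {p : ZMod 2} {x : N.carrier} (hx : x ∈ N.gr p) : X.incl N (X.proj N x) ∈ N.gr p := by
  have h := N.smul_mem X.e_mem hx
  rwa [zero_add] at h

/-- Since `c e c = 1 - e`, a module `N` is `e N ⊕ c e N`, and `x` has the coordinates `e x` and `e c
x`, both in the corner. Fullness and faithfulness rest on this. -/
theorem eq_incl_add (x : N.carrier) :
    X.incl N (X.proj N x) + X.c • X.incl N (X.proj N (X.c • x)) = x := by
  rw [incl_proj, incl_proj, smul_smul, smul_smul, mul_assoc, X.e_mul_c, ← mul_assoc, X.c_mul_c, one_mul,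
    ← add_smul, add_sub_cancel, one_smul]

end

/-- The functor that cuts out the part of a module given by the idempotent. -/
def cornerFunctor : SMod B ⥤ SMod A where
  obj N :=
    { carrier := X.corner N
      gr := fun p => (N.gr p).comap (X.incl N)
      isCompl := SMod.isCompl_of
        (fun x h₀ h₁ => incl_injective ((N.eq_zero_of_mem h₀ h₁).trans (map_zero _).symm))
        (fun x => by
          obtain ⟨x₀, h₀, x₁, h₁, h⟩ := N.exists_parts (X.incl N x)
          refine ⟨X.proj N x₀, proj_mem h₀, X.proj N x₁, proj_mem h₁, ?_⟩
          rw [← map_add, h, proj_incl])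
      smul_mem := fun ha hm => N.smul_mem (X.φ_graded ha) hm }
  map {N N'} f :=
    { toLin :=
        { toFun := fun x => ⟨f.toLin (X.incl N x), by
            change X.e • f.toLin (X.incl N x) = f.toLin (X.incl N x)
            rw [← map_smul, e_smul_incl]⟩
          map_add' := fun x y => Subtype.ext (f.toLin.map_add _ _)
          map_smul' := fun a x => Subtype.ext (f.toLin.map_smul (X.φ a) (X.incl N x)) }
      map_mem := fun p m h => f.map_mem p _ h }

theorem incl_map {N N' : SMod B} (f : N ⟶ N') (x : X.corner N) :
    X.incl N' ((X.cornerFunctor.map f).toLin x) = f.toLin (X.incl N x) := rfl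

theorem faithful : X.cornerFunctor.Faithful where
  map_injective {N N' f g} h := by
    have h' : ∀ x : X.corner N, f.toLin (X.incl N x) = g.toLin (X.incl N x) := by
      intro x
      rw [← incl_map, ← incl_map, h]
    ext x
    rw [← eq_incl_add (X := X) x, map_add, map_add, map_smul f.toLin, map_smul g.toLin, h', h']

/-- The extension of a map between corners. -/
def extend {N N' : SMod B} (g : X.corner N →ₗ[A.carrier] X.corner N') : N.carrier →+ N'.carrier where
  toFun x := X.incl N' (g (X.proj N x)) + X.c • X.incl N' (g (X.proj N (X.c • x)))
  map_zero' := by simp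
  map_add' x y := by
    simp only [map_add, smul_add]
    abel

theorem extend_apply {N N' : SMod B} (g : X.corner N →ₗ[A.carrier] X.corner N') (x : N.carrier) :
    X.extend g x = X.incl N' (g (X.proj N x)) + X.c • X.incl N' (g (X.proj N (X.c • x))) := rfl

/-- The elements that commute with the extension form a subalgebra, so `φ a`, `c` and `e` suffice.
Here `c` exchanges the two summands, and `e` keeps the first and kills the second. -/
theorem extend_smul {N N' : SMod B} (g : X.corner N →ₗ[A.carrier] X.corner N') (b : B.carrier)
    (x : N.carrier) : X.extend g (b • x) = b • X.extend g x := by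
  let S : Subalgebra k B.carrier :=
    { carrier := {b | ∀ x, X.extend g (b • x) = b • X.extend g x}
      mul_mem' := fun {a b} ha hb x => by
        rw [mul_smul, ha, hb, mul_smul]
      add_mem' := fun {a b} ha hb x => by
        rw [add_smul, map_add, ha, hb, add_smul]
      algebraMap_mem' := fun r x => by
        -- Scalars lie in the image of `φ` and are central, so they pass `c` without a sign.
        have h : X.c * X.φ (algebraMap k A.carrier r) = X.φ (algebraMap k A.carrier r) * X.c := by
          rw [X.φ.commutes]
          exact (Algebra.commutes r X.c).symm
        change X.extend g (_ • x) = _ • X.extend g x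
        rw [extend_apply, extend_apply]
        rw [← X.φ.commutes, smul_smul X.c, h, mul_smul, proj_φ_smul, proj_φ_smul,
          g.map_smul, g.map_smul, incl_smul, incl_smul, smul_add, smul_smul X.c, h, mul_smul] }
  refine X.gen S ?_ ?_ ?_ b x
  · intro a
    induction a using A.homogeneous_induction with
    | hom p a ha =>
      intro x
      rw [extend_apply, extend_apply]
      -- In the second summand `φ a` passes `c` twice, once inside `g` and once outside; the two
      -- signs cancel.
      have h : X.proj N (X.c • X.φ a • x) = sgn p • a • X.proj N (X.c • x) := by
        rw [smul_smul, X.c_mul_φ ha]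
        rcases zmod_two_eq p with rfl | rfl
        · rw [sgn_zero, one_smul, one_smul, mul_smul, proj_φ_smul]
        · rw [sgn_one_smul, sgn_one_smul, neg_smul, map_neg, mul_smul, proj_φ_smul]
      have h' : ∀ y : N'.carrier, X.c • sgn p • X.φ a • y = X.φ a • X.c • y := by
        intro y
        have hc := X.c_mul_φ ha
        rcases zmod_two_eq p with rfl | rfl
        · rw [sgn_zero, one_smul] at hc ⊢
          rw [smul_smul, hc, mul_smul]
        · rw [sgn_one_smul] at hc ⊢
          rw [smul_neg, smul_smul, hc, neg_smul, neg_neg, mul_smul]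
      rw [h, proj_φ_smul, g.map_smul, map_sgn_smul g, map_sgn_smul (X.incl N'), g.map_smul, incl_smul,
        incl_smul, smul_add, h']
    | add a b ha hb => rw [map_add]; exact S.add_mem ha hb
  · intro x
    rw [extend_apply, extend_apply]
    rw [smul_smul X.c X.c, X.c_mul_c, one_smul, smul_add, smul_smul X.c X.c, X.c_mul_c, one_smul,
      add_comm]
  · intro x
    rw [extend_apply, extend_apply]
    rw [proj_e_smul, proj_c_e_smul, map_zero, map_zero, smul_zero, smul_add, e_smul_incl,
      e_c_smul_incl]

theorem full : X.cornerFunctor.Full where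
  map_surjective {N N'} g := by
    let g' : X.corner N →ₗ[A.carrier] X.corner N' := g.toLin
    have hg : ∀ p (x : X.corner N), X.incl N x ∈ N.gr p → X.incl N' (g' x) ∈ N'.gr p :=
      g.map_mem
    refine ⟨⟨{ X.extend g' with map_smul' := X.extend_smul g' }, ?_⟩, ?_⟩
    · intro p x hx
      change X.incl N' (g' (X.proj N x)) + X.c • X.incl N' (g' (X.proj N (X.c • x))) ∈ N'.gr p
      refine add_mem (hg p _ (proj_mem hx)) ?_
      -- The odd `c` acts twice, so the parity is restored.
      have h := N'.smul_mem X.c_mem (hg _ _ (proj_mem (N.smul_mem X.c_mem hx)))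
      rwa [← add_assoc, CharTwo.add_self_eq_zero, zero_add] at h
    · have h : ∀ x : X.corner N, X.extend g' (X.incl N x) = X.incl N' (g' x) := by
        intro x
        rw [extend_apply, proj_incl, ← e_smul_incl x, proj_c_e_smul, map_zero, map_zero, smul_zero,
          add_zero]
      ext x
      exact incl_injective (X := X) (N := N') (h x)

open Matrix.Module in
/-- The module of column vectors. -/
def columns (M : SMod A) : SMod B where
  carrier := Fin 2 → M.carrier
  module := Module.compHom (Fin 2 → M.carrier) X.ρ.toRingHom
  -- The second coordinate has shifted parity: the module is `M ⊕ Π M`.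
  gr p :=
    { carrier := {v | v 0 ∈ M.gr p ∧ v 1 ∈ M.gr (p + 1)}
      zero_mem' := ⟨zero_mem _, zero_mem _⟩
      add_mem' := fun h h' => ⟨add_mem h.1 h'.1, add_mem h.2 h'.2⟩
      neg_mem' := fun h => ⟨neg_mem h.1, neg_mem h.2⟩ }
  isCompl := SMod.isCompl_of
    (fun v h₀ h₁ => by
      ext i
      fin_cases i
      · exact M.eq_zero_of_mem h₀.1 h₁.1
      · exact M.eq_zero_of_mem h₁.2 h₀.2)
    (fun v => by
      obtain ⟨x₀, h₀, x₁, h₁, h⟩ := M.exists_parts (v 0)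
      obtain ⟨y₀, h₀', y₁, h₁', h'⟩ := M.exists_parts (v 1)
      -- By the shift, the even part of a column has an even first and an odd second entry.
      refine ⟨![x₀, y₁], ⟨h₀, h₁'⟩, ![x₁, y₀], ⟨h₁, h₀'⟩, ?_⟩
      ext i
      fin_cases i
      · exact h
      · exact (add_comm _ _).trans h')
  smul_mem := by
    rintro p q b v hb ⟨h₀, h₁⟩
    obtain ⟨r₁, r₂, r₃, r₄⟩ := X.ρ_graded hb
    have mem : ∀ {s t r : ZMod 2} {a : A.carrier} {m : M.carrier}, a ∈ A.gr s → m ∈ M.gr t →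
        s + t = r → a • m ∈ M.gr r := fun ha hm h => h ▸ M.smul_mem ha hm
    have e : p + 1 + (q + 1) = p + q := by
      rw [add_add_add_comm, CharTwo.add_self_eq_zero, add_zero]
    refine ⟨?_, ?_⟩
    · change ∑ j, X.ρ b 0 j • v j ∈ _
      rw [Fin.sum_univ_two]
      exact add_mem (mem r₁ h₀ rfl) (mem r₂ h₁ e)
    · change ∑ j, X.ρ b 1 j • v j ∈ _
      rw [Fin.sum_univ_two]
      exact add_mem (mem r₃ h₀ (by abel)) (mem r₄ h₁ (by abel))

theorem columns_smul_zero (M : SMod A) (b : B.carrier) (v : (X.columns M).carrier) :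
    (b • v : (X.columns M).carrier) (0 : Fin 2) =
      X.ρ b 0 0 • (v (0 : Fin 2) : M.carrier) + X.ρ b 0 1 • (v (1 : Fin 2) : M.carrier) :=
  Fin.sum_univ_two (fun j : Fin 2 => X.ρ b 0 j • (v j : M.carrier))

theorem columns_smul_one (M : SMod A) (b : B.carrier) (v : (X.columns M).carrier) :
    (b • v : (X.columns M).carrier) (1 : Fin 2) =
      X.ρ b 1 0 • (v (0 : Fin 2) : M.carrier) + X.ρ b 1 1 • (v (1 : Fin 2) : M.carrier) :=
  Fin.sum_univ_two (fun j : Fin 2 => X.ρ b 1 j • (v j : M.carrier))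

/-- The idempotent acts as the first diagonal matrix unit, so a vector it fixes has only a first
entry. -/
theorem corner_columns_one (M : SMod A) (v : X.corner (X.columns M)) :
    (X.incl _ v : Fin 2 → M.carrier) 1 = 0 := by
  have h := congrFun (e_smul_incl v) (1 : Fin 2)
  refine h.symm.trans ?_
  rw [columns_smul_one, X.ρ_e]
  simp

/-- The corner of the module of column vectors. -/
def cornerColumns (M : SMod A) : X.cornerFunctor.obj (X.columns M) ≅ M :=
  SMod.isoOfLinearEquiv
    { toFun := fun v => (X.incl _ v : Fin 2 → M.carrier) 0
      invFun := fun m => ⟨(![m, 0] : Fin 2 → M.carrier), by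
        change X.e • (show (X.columns M).carrier from (![m, 0] : Fin 2 → M.carrier)) = _
        refine funext fun i : Fin 2 => ?_
        fin_cases i
        · refine (X.columns_smul_zero M _ _).trans ?_
          rw [X.ρ_e]
          simp
        · refine (X.columns_smul_one M _ _).trans ?_
          rw [X.ρ_e]
          simp⟩
      map_add' := fun v w => rfl
      map_smul' := fun a v => by
        refine (X.columns_smul_zero M (X.φ a) (X.incl _ v)).trans ?_
        rw [X.ρ_φ₀, X.ρ_φ₁, zero_smul, add_zero]
        rfl
      left_inv := fun v => by
        apply incl_injective
        refine funext fun i : Fin 2 => ?_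
        fin_cases i
        · rfl
        · exact (X.corner_columns_one M v).symm
      right_inv := fun m => rfl }
    (fun p v hv => hv.1)
    (fun p m hm => ⟨hm, zero_mem _⟩)

/-- A matrix superalgebra over `A` is Morita superequivalent to `A`. -/
def morita : MoritaSuperequivalence B A :=
  MoritaSuperequivalence.ofFunctor X.cornerFunctor
    { faithful := X.faithful
      full := X.full
      essSurj := ⟨fun M => ⟨X.columns M, ⟨X.cornerColumns M⟩⟩⟩ }
    ⟨fun {M N f g} => rfl⟩
    ⟨fun {M N} f r => by
      ext x
      refine incl_injective (X := X) (N := N) ?_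
      exact congrArg (fun a : B.carrier => (a • f.toLin (X.incl M x) : N.carrier))
        (X.φ.commutes r).symm⟩
    (Iso.refl _)
    (fun M => rfl)

end MatrixData

end Corner

/-! ### Two Clifford factors form a matrix superalgebra -/

section CliffordMatrix

variable {k : Type u} [CommRing k]

/-- The parity automorphism `a ↦ (-1) ^ |a| a`, as a linear map. -/
def parityLin (A : SuperAlg.{u} k) : A.carrier →ₗ[k] A.carrier :=
  GradedAlgebra.proj A.gr 0 - GradedAlgebra.proj A.gr 1

theorem parityLin_of_mem {A : SuperAlg.{u} k} {p : ZMod 2} {a : A.carrier} (ha : a ∈ A.gr p) :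
    parityLin A a = sgn p • a := by
  rw [parityLin, LinearMap.sub_apply, GradedAlgebra.proj_apply, GradedAlgebra.proj_apply]
  rcases zmod_two_eq p with rfl | rfl
  · rw [DirectSum.decompose_of_mem_same _ ha, DirectSum.decompose_of_mem_ne _ ha (by decide),
      sub_zero, sgn_zero, one_smul]
  · rw [DirectSum.decompose_of_mem_same _ ha, DirectSum.decompose_of_mem_ne _ ha (by decide),
      zero_sub, sgn_one_smul]

theorem parityLin_mul {A : SuperAlg.{u} k} (a b : A.carrier) :
    parityLin A (a * b) = parityLin A a * parityLin A b := by
  induction a using A.homogeneous_induction with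
  | hom p a ha =>
    induction b using A.homogeneous_induction with
    | hom q b hb =>
      rw [parityLin_of_mem ha, parityLin_of_mem hb, parityLin_of_mem (mul_mem_gr ha hb rfl),
        sgn_add, smul_mul_assoc, mul_smul_comm, smul_smul]
    | add b b' hb hb' => rw [mul_add, map_add, hb, hb', map_add, mul_add]
  | add a a' ha ha' => rw [add_mul, map_add, ha, ha', map_add, add_mul]

theorem parityLin_algebraMap {A : SuperAlg.{u} k} (r : k) :
    parityLin A (algebraMap k A.carrier r) = algebraMap k A.carrier r := by
  rw [parityLin_of_mem (SetLike.algebraMap_mem_graded A.gr r), sgn_zero, one_smul]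

theorem parityLin_mem {A : SuperAlg.{u} k} {p : ZMod 2} {a : A.carrier} (ha : a ∈ A.gr p) :
    parityLin A a ∈ A.gr p := by
  rw [parityLin_of_mem ha, Units.smul_def]
  exact zsmul_mem ha _

/-- The action of a superalgebra on the sum of a module and its parity shift. -/
def diagHom (A : SuperAlg.{u} k) : A.carrier →ₐ[k] Matrix (Fin 2) (Fin 2) A.carrier where
  toFun a := !![a, 0; 0, parityLin A a]
  map_one' := by
    rw [← map_one (algebraMap k A.carrier), parityLin_algebraMap, map_one, Matrix.one_fin_two]
  map_mul' a b := by
    rw [parityLin_mul, Matrix.mul_fin_two]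
    simp
  map_zero' := by
    rw [map_zero]
    ext i j
    fin_cases i <;> fin_cases j <;> rfl
  map_add' a b := by
    rw [map_add]
    ext i j
    fin_cases i <;> fin_cases j <;> simp
  commutes' r := by
    rw [parityLin_algebraMap]
    ext i j
    fin_cases i <;> fin_cases j <;> simp [Matrix.algebraMap_matrix_apply]

theorem diagHom_apply {A : SuperAlg.{u} k} (a : A.carrier) :
    diagHom A a = !![a, 0; 0, parityLin A a] := rfl

theorem isGraded_diagHom (A : SuperAlg.{u} k) : IsGraded A (matGr A) (diagHom A) :=
  fun _ _ ha => ⟨ha, zero_mem _, zero_mem _, parityLin_mem ha⟩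

/-- The odd matrix with entries `x` and `y`. -/
def offDiag (A : SuperAlg.{u} k) (x y : k) : Matrix (Fin 2) (Fin 2) A.carrier :=
  !![0, algebraMap k A.carrier x; algebraMap k A.carrier y, 0]

theorem offDiag_mem (A : SuperAlg.{u} k) (x y : k) : offDiag A x y ∈ matGr A 1 :=
  ⟨zero_mem _, SetLike.algebraMap_mem_graded A.gr x, SetLike.algebraMap_mem_graded A.gr y,
    zero_mem _⟩

theorem offDiag_mul (A : SuperAlg.{u} k) (x y z w : k) : offDiag A x y * offDiag A z w =
    !![algebraMap k A.carrier (x * w), 0; 0, algebraMap k A.carrier (y * z)] := by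
  rw [offDiag, offDiag, Matrix.mul_fin_two]
  simp

theorem offDiag_mul_self (A : SuperAlg.{u} k) {x y : k} (h : x * y = 1) :
    offDiag A x y * offDiag A x y = 1 := by
  rw [offDiag_mul, mul_comm y x, h, map_one, Matrix.one_fin_two]

/-- This is why `diagHom` twists the lower entry by the parity automorphism: an odd matrix with
scalar entries then exchanges `a` and `(-1) ^ |a| a`, as an odd element supercommuting with `A`
must. -/
theorem offDiag_mul_diagHom (A : SuperAlg.{u} k) (x y : k) {p : ZMod 2} {a : A.carrier}
    (ha : a ∈ A.gr p) :
    offDiag A x y * diagHom A a = sgn p • (diagHom A a * offDiag A x y) := by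
  rw [offDiag, diagHom_apply, parityLin_of_mem ha, Matrix.mul_fin_two, Matrix.mul_fin_two]
  simp only [zero_mul, mul_zero, add_zero, zero_add]
  rw [Algebra.commutes x, Algebra.commutes y]
  rcases zmod_two_eq p with rfl | rfl
  · simp only [sgn_zero, one_smul]
  · rw [sgn_one_smul]
    ext i j
    fin_cases i <;> fin_cases j <;> simp [sgn_one_smul]

theorem superCommute_diagHom (A : SuperAlg.{u} k) {x y : k} (h : x * y = 1) :
    SuperCommute (diagHom A) (clHom (k := k) (offDiag A x y) (offDiag_mul_self A h)) :=
  (SuperCommute.of_cl fun _ _ hb => by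
    rw [clHom_clc]; exact offDiag_mul_diagHom A x y hb).symm

theorem tensor_subalgebra {A B : SuperAlg.{u} k} (S : Subalgebra k (tensor A B).carrier)
    (hl : ∀ a, inl A B a ∈ S) (hr : ∀ b, inr A B b ∈ S) (z : (tensor A B).carrier) : z ∈ S := by
  obtain ⟨t, rfl⟩ := (GradedTensorProduct.of k A.gr B.gr).surjective z
  induction t using TensorProduct.induction_on with
  | zero => rw [map_zero]; exact S.zero_mem
  | add x y hx hy => rw [map_add]; exact S.add_mem hx hy
  | tmul a b =>
    have h := S.mul_mem (hl a) (hr b)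
    rwa [← tmul_eq] at h

theorem cl_subalgebra (S : Subalgebra k (Cl k).carrier) (h : (clc k : (Cl k).carrier) ∈ S)
    (a : (Cl k).carrier) : a ∈ S := by
  induction a using (Cl k).homogeneous_induction with
  | hom p a ha =>
    rcases zmod_two_eq p with rfl | rfl
    · obtain ⟨r, rfl⟩ := cl_even ha
      exact S.smul_mem S.one_mem r
    · obtain ⟨r, rfl⟩ := cl_odd ha
      exact S.smul_mem h r
  | add a b ha hb => exact S.add_mem ha hb

section Idempotent

variable {R : Type u} [Ring R] [Algebra k R] [Invertible (2 : k)] {ε : k} {c d : R}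

variable (ε c d) in
/-- The idempotent given by two anticommuting square roots of one. -/
def cliffordIdem : R := (⅟2 : k) • (1 + ε • (c * d))

theorem two_smul_cliffordIdem : (2 : k) • cliffordIdem ε c d = 1 + ε • (c * d) := by
  rw [cliffordIdem, smul_smul, mul_invOf_self, one_smul]

theorem half_add_half (x : R) : (⅟2 : k) • (x + x) = x := by
  rw [smul_add, ← add_smul, invOf_two_add_invOf_two, one_smul]

/-- The element `w = ε c d` has square `-ε ^ 2 c ^ 2 d ^ 2 = 1`, so `(1 + w) / 2` is idempotent. -/
theorem cliffordIdem_mul_self (hε : ε * ε = -1) (hc : c * c = 1) (hd : d * d = 1)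
    (hcd : c * d = -(d * c)) : cliffordIdem ε c d * cliffordIdem ε c d = cliffordIdem ε c d := by
  have h : (ε • (c * d)) * (ε • (c * d)) = 1 := by
    rw [smul_mul_assoc, mul_smul_comm, smul_smul, hε, mul_assoc, ← mul_assoc d c d,
      ← neg_eq_iff_eq_neg.2 hcd, neg_mul, mul_assoc, hd, mul_one, mul_neg, hc, neg_smul, one_smul,
      neg_neg]
  rw [cliffordIdem, smul_mul_assoc, mul_smul_comm]
  congr 1
  rw [mul_add, add_mul, add_mul, h, one_mul, mul_one, one_mul,
    add_comm (ε • (c * d)) 1, half_add_half]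

/-- Since `c` anticommutes with `c d`, conjugation by `c` changes the sign of `ε c d` and exchanges
`e` and `1 - e`. -/
theorem cliffordIdem_mul (hc : c * c = 1) (hcd : c * d = -(d * c)) :
    cliffordIdem ε c d * c = c * (1 - cliffordIdem ε c d) := by
  have h : c * d * c = -d := by
    rw [hcd, neg_mul, mul_assoc, hc, mul_one]
  have h' : c * (c * d) = d := by rw [← mul_assoc, hc, one_mul]
  have e : c = (⅟2 : k) • (c + c) := (half_add_half c).symm
  rw [mul_sub, mul_one, cliffordIdem, smul_mul_assoc, mul_smul_comm, add_mul, mul_add, one_mul,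
    mul_one, smul_mul_assoc, mul_smul_comm, h, h']
  -- Writing the isolated `c` as half of `c + c` gives both sides the common factor one half.
  nth_rw 2 [e]
  rw [← smul_sub, smul_neg]
  congr 1
  abel

/-- From `2 e - 1 = ε c d` one gets `c (2 e - 1) = ε d`, and `-ε` is inverse to `ε`. Hence `c` and
`e` generate the second Clifford generator. -/
theorem eq_of_cliffordIdem (hε : ε * ε = -1) (hc : c * c = 1) :
    d = -(ε • (c * ((2 : k) • cliffordIdem ε c d - 1))) := by
  rw [two_smul_cliffordIdem, add_sub_cancel_left, mul_smul_comm, smul_smul, hε, ← mul_assoc, hc,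
    one_mul, neg_smul, one_smul, neg_neg]

end Idempotent

theorem inr_mul_inl {A B : SuperAlg.{u} k} {p : ZMod 2} {a : A.carrier} {b : B.carrier}
    (ha : a ∈ A.gr p) (hb : b ∈ B.gr 1) :
    inr A B b * inl A B a = sgn p • (inl A B a * inr A B b) := by
  have := superCommute_inl_inr.symm hb ha
  rwa [one_mul] at this

/-- The tensor product with two copies of the Clifford superalgebra is a matrix superalgebra if `-1`
is a square and `2` is invertible. -/
def cliffordMatrix [Invertible (2 : k)] (A : SuperAlg.{u} k) {ε : k} (hε : ε * ε = -1) :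
    MatrixData A (tensor (tensor A (Cl k)) (Cl k)) :=
  let φ := (inl (tensor A (Cl k)) (Cl k)).comp (inl A (Cl k))
  let c := inl (tensor A (Cl k)) (Cl k) (inr A (Cl k) (clc k))
  let d := inr (tensor A (Cl k)) (Cl k) (clc k)
  have c_mem : c ∈ (tensor (tensor A (Cl k)) (Cl k)).gr 1 :=
    isGraded_inl (isGraded_inr (clc k).2)
  have d_mem : d ∈ (tensor (tensor A (Cl k)) (Cl k)).gr 1 := isGraded_inr (clc k).2
  have hc : c * c = 1 := by simp only [c, ← map_mul, clc_mul_clc, map_one]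
  have hd : d * d = 1 := by simp only [d, ← map_mul, clc_mul_clc, map_one]
  have hcd : c * d = -(d * c) :=
    (neg_eq_iff_eq_neg.2 (inr_anticomm_inl (isGraded_inr (clc k).2) (clc k).2)).symm
  have hcφ : ∀ {p : ZMod 2} {a : A.carrier}, a ∈ A.gr p → c * φ a = sgn p • (φ a * c) := by
    intro p a ha
    simp only [c, φ, AlgHom.comp_apply, ← map_mul, inr_mul_inl ha (clc k).2, map_sgn_smul]
  have hdφ : ∀ {p : ZMod 2} {a : A.carrier}, a ∈ A.gr p → d * φ a = sgn p • (φ a * d) :=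
    fun ha => inr_mul_inl (isGraded_inl ha) (clc k).2
  -- The generators `c` and `d` act by the off-diagonal matrices with entries `1, 1` and `ε, -ε`.
  -- Both square to one, they anticommute, and `ε c d` becomes `diag (1, -1)`, so `e` becomes the
  -- first diagonal matrix unit.
  have hC := offDiag_mul_self A (one_mul (1 : k))
  have hε' : ε * -ε = 1 := by rw [mul_neg, hε, neg_neg]
  have hD := offDiag_mul_self A hε'
  have h₁ := superCommute_diagHom A (one_mul (1 : k))
  have h₂ : SuperCommute (tensorLift _ _ h₁) (clHom (k := k) (offDiag A ε (-ε)) hD) := by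
    refine SuperCommute.of_tensor ?_ ?_
    · have e : (tensorLift _ _ h₁).comp (inl A (Cl k)) = diagHom A :=
        AlgHom.ext fun a => tensorLift_inl _ _ h₁ a
      rw [e]
      exact superCommute_diagHom A hε'
    · have e : (tensorLift _ _ h₁).comp (inr A (Cl k)) = clHom (offDiag A 1 1) hC :=
        AlgHom.ext fun a => tensorLift_inr _ _ h₁ a
      rw [e]
      refine superCommute_cl ?_
      rw [clHom_clc, clHom_clc, offDiag_mul, offDiag_mul]
      ext i j
      fin_cases i <;> fin_cases j <;> simp
  have hρφ : ∀ a, tensorLift _ _ h₂ (φ a) = diagHom A a := fun a =>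
    (tensorLift_inl _ _ h₂ _).trans (tensorLift_inl _ _ h₁ a)
  have hρc : tensorLift _ _ h₂ c = offDiag A 1 1 :=
    (tensorLift_inl _ _ h₂ _).trans ((tensorLift_inr _ _ h₁ _).trans (clHom_clc _ _))
  have hρd : tensorLift _ _ h₂ d = offDiag A ε (-ε) :=
    (tensorLift_inr _ _ h₂ _).trans (clHom_clc _ _)
  { φ := φ
    φ_graded := isGraded_inl.comp isGraded_inl
    e := cliffordIdem ε c d
    c := c
    e_mem := Submodule.smul_mem _ _ (add_mem SetLike.GradedOne.one_mem
      (Submodule.smul_mem _ _ (mul_mem_gr c_mem d_mem (CharTwo.add_self_eq_zero 1))))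
    c_mem := c_mem
    e_mul_e := cliffordIdem_mul_self hε hc hd hcd
    c_mul_c := hc
    e_mul_c := cliffordIdem_mul hc hcd
    e_mul_φ := by
      intro a
      induction a using A.homogeneous_induction with
      | hom p a ha =>
        have h : c * d * φ a = φ a * (c * d) := by
          rw [mul_assoc, hdφ ha, mul_smul_comm, ← mul_assoc, hcφ ha, smul_mul_assoc, sgn_smul_smul,
            mul_assoc]
        rw [cliffordIdem, smul_mul_assoc, mul_smul_comm, add_mul, mul_add, smul_mul_assoc,
          mul_smul_comm, h, one_mul, mul_one]
      | add a b ha hb => rw [map_add, mul_add, ha, hb, add_mul]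
    c_mul_φ := fun _ _ ha => hcφ ha
    gen := by
      intro S hφ hcS heS
      have hdS : d ∈ S := by
        rw [eq_of_cliffordIdem (d := d) hε hc]
        exact S.neg_mem (S.smul_mem (S.mul_mem hcS (S.sub_mem (S.smul_mem heS _) S.one_mem)) _)
      refine tensor_subalgebra S (fun z => ?_) fun z => ?_
      · exact tensor_subalgebra (S.comap (inl (tensor A (Cl k)) (Cl k))) hφ
          (cl_subalgebra ((S.comap (inl (tensor A (Cl k)) (Cl k))).comap (inr A (Cl k))) hcS) z
      · exact cl_subalgebra (S.comap (inr (tensor A (Cl k)) (Cl k))) hdS z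
    ρ := tensorLift _ _ h₂
    ρ_graded := isGraded_tensorLift h₂
      (isGraded_tensorLift h₁ (isGraded_diagHom A)
        (isGraded_cl (by rw [clHom_clc]; exact offDiag_mem A _ _)))
      (isGraded_cl (by rw [clHom_clc]; exact offDiag_mem A _ _))
    ρ_φ₀ := fun a => by rw [hρφ]; rfl
    ρ_φ₁ := fun a => by rw [hρφ]; rfl
    ρ_e := by
      have h : ε • (offDiag A 1 1 * offDiag A ε (-ε)) = !![1, 0; 0, -1] := by
        have h₁ : ε • algebraMap k A.carrier (1 * -ε) = 1 := by
          rw [one_mul, Algebra.smul_def, ← map_mul, hε', map_one]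
        have h₂ : ε • algebraMap k A.carrier (1 * ε) = -1 := by
          rw [one_mul, Algebra.smul_def, ← map_mul, hε, map_neg, map_one]
        rw [offDiag_mul]
        ext i j
        fin_cases i <;> fin_cases j
        · exact h₁
        · exact smul_zero ε
        · exact smul_zero ε
        · exact h₂
      rw [cliffordIdem, map_smul, map_add, map_one, map_smul, map_mul, hρc, hρd, h]
      ext i j
      fin_cases i <;> fin_cases j
      · exact half_add_half (1 : A.carrier)
      · simp
      · simp
      · simp }

/-- An even number of Clifford factors does not change the Morita superequivalence class. -/
theorem nonempty_morita_even [Invertible (2 : k)] {ε : k} (hε : ε * ε = -1) (m : ℕ)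
    (A : SuperAlg.{u} k) :
    Nonempty (MoritaSuperequivalence (tensor A (tensorPow (Cl k) (2 * m))) A) := by
  induction m generalizing A with
  | zero => exact ⟨(tensorBase A).morita⟩
  | succ m ih =>
    -- The two outermost Clifford factors are absorbed into `A` by associativity; the induction
    -- hypothesis removes the other `2 * m`, and `cliffordMatrix` these two.
    obtain ⟨E⟩ := ih (tensor (tensor A (Cl k)) (Cl k))
    exact ⟨(tensorAssoc A (Cl k) (tensorPow (Cl k) (2 * m + 1))).morita.trans
      ((tensorAssoc (tensor A (Cl k)) (Cl k) (tensorPow (Cl k) (2 * m))).morita.trans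
        (E.trans (cliffordMatrix A hε).morita))⟩

theorem nonempty_morita_odd [Invertible (2 : k)] {ε : k} (hε : ε * ε = -1) (m : ℕ)
    (A : SuperAlg.{u} k) :
    Nonempty (MoritaSuperequivalence (tensor A (tensorPow (Cl k) (2 * m + 1)))
      (tensor A (Cl k))) := by
  -- One factor is set aside in `A`, and the even case removes the rest.
  obtain ⟨E⟩ := nonempty_morita_even hε m (tensor A (Cl k))
  exact ⟨(tensorAssoc A (Cl k) (tensorPow (Cl k) (2 * m))).morita.trans E⟩

theorem SuperIso.weaklyMorita {A B : SuperAlg.{u} k} {n : ℕ}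
    (Φ : SuperIso A (tensor B (tensorPow (Cl k) n))) : WeaklyMoritaSuperequivalent A B :=
  -- The empty tensor power is the ground ring, so tensoring `A` with it changes nothing.
  ⟨0, n, ⟨(tensorBase A).morita.trans Φ.morita⟩⟩

end CliffordMatrix

end OddNil

/-! ### The main theorem -/

theorem mainTheorem4 {k : Type u} [CommRing k] (h2 : IsUnit (2 : k)) (n : ℕ) :
    (∃ (Φ : OddNil.SuperIso (OddNil.NC (OddNil.Cl k) n)
          (OddNil.tensor (OddNil.ONC k n) (OddNil.tensorPow (OddNil.Cl k) n)))
        (Ψ : OddNil.SuperIso (OddNil.NH n (OddNil.clFrobenius k))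
          (OddNil.tensor (OddNil.ONH k n) (OddNil.tensorPow (OddNil.Cl k) n))),
      (∀ i : Fin n, Φ.toAlgEquiv (OddNil.ncC k i) = OddNil.inr _ _ (OddNil.clC k i)) ∧
      (∀ i : Fin (n - 1), Φ.toAlgEquiv (OddNil.ncU k i) =
        OddNil.inr _ _ (OddNil.clC k (OddNil.lo i) - OddNil.clC k (OddNil.hi i)) *
          OddNil.inl _ _ (OddNil.oncV k i)) ∧
      (∀ i : Fin n, Ψ.toAlgEquiv (OddNil.nhC k i) = OddNil.inr _ _ (OddNil.clC k i)) ∧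
      (∀ i : Fin (n - 1), Ψ.toAlgEquiv (OddNil.nhU k i) =
        OddNil.inr _ _ (OddNil.clC k (OddNil.lo i) - OddNil.clC k (OddNil.hi i)) *
          OddNil.inl _ _ (OddNil.onhV k i)) ∧
      (∀ i : Fin n, Ψ.toAlgEquiv (OddNil.nhX k i) = OddNil.inl _ _ (OddNil.onhY k i))) ∧
    OddNil.WeaklyMoritaSuperequivalent (OddNil.NC (OddNil.Cl k) n) (OddNil.ONC k n) ∧
    OddNil.WeaklyMoritaSuperequivalent (OddNil.NH n (OddNil.clFrobenius k)) (OddNil.ONH k n) ∧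
    ((∃ ε : k, ε * ε = -1) →
      (Even n →
        Nonempty (OddNil.MoritaSuperequivalence (OddNil.NC (OddNil.Cl k) n) (OddNil.ONC k n)) ∧
        Nonempty (OddNil.MoritaSuperequivalence (OddNil.NH n (OddNil.clFrobenius k))
          (OddNil.ONH k n))) ∧
      (Odd n →
        Nonempty (OddNil.MoritaSuperequivalence (OddNil.NC (OddNil.Cl k) n)
          (OddNil.tensor (OddNil.ONC k n) (OddNil.Cl k))) ∧
        Nonempty (OddNil.MoritaSuperequivalence (OddNil.NH n (OddNil.clFrobenius k))
          (OddNil.tensor (OddNil.ONH k n) (OddNil.Cl k))))) := by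
  have := h2.invertible
  obtain ⟨Φ, hΦc, hΦu⟩ := OddNil.exists_ncIso k n
  obtain ⟨Ψ, hΨc, hΨu, hΨx⟩ := OddNil.exists_nhIso k n
  refine ⟨⟨Φ, Ψ, hΦc, hΦu, hΨc, hΨu, hΨx⟩, Φ.weaklyMorita, Ψ.weaklyMorita, ?_⟩
  rintro ⟨ε, hε⟩
  refine ⟨fun hn => ?_, fun hn => ?_⟩
  -- Divisibility yields the form `2 * m` of the even case, where `Even` itself would give `m + m`.
  · obtain ⟨m, rfl⟩ := hn.two_dvd
    obtain ⟨E⟩ := OddNil.nonempty_morita_even hε m (OddNil.ONC k (2 * m))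
    obtain ⟨E'⟩ := OddNil.nonempty_morita_even hε m (OddNil.ONH k (2 * m))
    exact ⟨⟨Φ.morita.trans E⟩, ⟨Ψ.morita.trans E'⟩⟩
  · obtain ⟨m, rfl⟩ := hn
    obtain ⟨E⟩ := OddNil.nonempty_morita_odd hε m (OddNil.ONC k (2 * m + 1))
    obtain ⟨E'⟩ := OddNil.nonempty_morita_odd hε m (OddNil.ONH k (2 * m + 1))
    exact ⟨⟨Φ.morita.trans E⟩, ⟨Ψ.morita.trans E'⟩⟩
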